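/- **Conventions.** All manifolds, bundles, sections are smooth (manifolds finite-dimensional, Hausdorff, second countable). A *Courant algebroid* over $M$ is a vector bundle $E\to M$ with a fibrewise nondegenerate symmetric pairing $\langle\cdot,\cdot\rangle$, an anchor $\rho:E\to TM$ and an $\mathbb R$-bilinear bracket $[\![\cdot,\cdot]\!]$ on $\Gamma(E)$ with $\pounds_{\rho(e)}\langle e_1,e_2\rangle=\langle[\![e,e_1]\!],e_2\rangle+\langle e_1,[\![e,e_2]\!]\rangle$, $\langle[\![e,e]\!],e_1\rangle=\tfrac12\pounds_{\rho(e_1)}\langle e,e\rangle$ and $[\![e,[\![e_1,e_2]\!]]\!]=[\![[\![e,e_1]\!],e_2]\!]+[\![e_1,[\![e,e_2]\!]]\!]$. Let $\rho^*:T^*M\to E$ be given by $\langle\rho^*\alpha,e\rangle=\alpha(\rho(e))$. $E$ is *exact* if $0\to T^*M\xrightarrow{\rho^*}E\xrightarrow{\rho}TM\to0$ is exact. For an isotropic splitting $\sigma:TM\to E$ of $\rho$, with $\sigma^*:E\to T^*M$, $(\sigma^*b)(v)=\langle b,\sigma(v)\rangle$, and a vector field $X$, put $\mathsf{ad}^\sigma_Xe=[\![\sigma(X),e]\!]-\rho^*\sigma^*[\![\sigma(X),\sigma(\rho(e))]\!]$.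 A *generalised metric* is a bundle involution $\tau$ of $E$ such that $\langle\cdot,\tau\,\cdot\rangle$ is symmetric and positive definite; $V^\pm=\ker(\tau\mp1)$, and $e^\pm$ are the components of $e\in E=V^+\oplus V^-$. A *divergence* is an $\mathbb R$-linear map $\mathrm{div}:\Gamma(E)\to C^\infty(M)$ with $\mathrm{div}(fe)=f\,\mathrm{div}\,e+\pounds_{\rho(e)}f$. For $v\in\Gamma(V^+)$, $w\in\Gamma(V^-)$, $$\mathrm{GRic}(v,w)=\mathrm{div}\,[\![w,v]\!]^+-\pounds_{\rho(w)}\mathrm{div}\,v-\mathrm{Tr}_{V^+}\bigl([\![[\![\,\cdot\,,w]\!]^-,v]\!]^+\bigr).$$ The *generalised scalar curvature* is $\mathrm{GR}=\tfrac12(S^++S^-)$, where for local frames $(e_a)$ of $V^+$ and $(f_\alpha)$ of $V^-$ with $\langle e_a,e_b\rangle=\delta_{ab}$, $\langle f_\alpha,f_\beta\rangle=-\delta_{\alpha\beta}$, $$S^+=-4\sum_a\pounds_{\rho(e_a)}\mathrm{div}\,e_a-2\sum_a(\mathrm{div}\,e_a)^2+\tfrac13\sum_{a,b,c}\langle[\![e_a,e_b]\!],e_c\rangle^2-\sum_{a,b,\alpha}\langle[\![e_a,e_b]\!],f_\alpha\rangle^2,$$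 and $S^-$ is obtained by exchanging the roles of $(e_a)$ and $(f_\alpha)$. Fix a constant $\kappa\in\mathbb R$, the normalisation of the identification of endomorphisms $\partial_t\tau$ with bilinear forms on $V^+\times V^-$. A *solution of the generalised Ricci flow* on $[0,T)$, $T>0$, is a family $(\tau(t),\mathrm{div}(t))$ of generalised metrics and divergences, jointly smooth in $(t,x)\in[0,T)\times M$, such that at every $t\in[0,T)$ (one-sided derivatives at $t=0$) $$\langle(\partial_t\tau)v,w\rangle=-2\kappa\,\mathrm{GRic}_{\tau(t),\mathrm{div}(t)}(v,w)\quad(v\in\Gamma(V^+),\ w\in\Gamma(V^-)),\qquad \partial_t(\mathrm{div}\,e)=-\pounds_{\rho(e)}\mathrm{GR}_{\tau(t),\mathrm{div}(t)}\quad(e\in\Gamma(E)).$$ **Reduction.** Let $E$ be an exact Courant algebroid over $M$, and let $K\subset E$ be an isotropic subbundle with $\rho(K^\perp)=TM$. Let $\Gamma_{\rm bas}(K^\perp)=\{e\in\Gamma(K^\perp):[\![\Gamma(K),e]\!]\subset\Gamma(K)\}$, and suppose that $K^\perp$ is spanned pointwise by $\Gamma_{\rm bas}(K^\perp)$ and that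 $\rho(K)$ is tangent to a foliation whose leaf space is a manifold $\mathcal Q$ with quotient map the surjective submersion $\varpi:M\to\mathcal Q$. The *reduced Courant algebroid* $\underline E\to\mathcal Q$ is the Courant algebroid with $\Gamma(\underline E)\cong\Gamma_{\rm bas}(K^\perp)/\Gamma(K)$ and with pairing, anchor and bracket inherited from $E$; there are fibrewise quotient maps $\natural_m:K^\perp_m\to K^\perp_m/K_m\cong\underline E_{\varpi(m)}$. An isotropic splitting $\sigma$ of $E$ is *adapted* to $K$ if $\sigma(TM)\subset K^\perp$ and $\sigma(Y)\in\Gamma_{\rm bas}(K^\perp)$ for every $\varpi$-projectable vector field $Y$; it induces the splitting $\underline\sigma(\varpi_*v)=\natural(\sigma(v))$ of $\underline E$. **Setting.** Let $K_1,K_2\subset E$ be of the same rank, each as above, with $\varpi_i:M\to\mathcal Q_i$, $\underline E_i$, $\natural_i$. For $(q_1,q_2)\in C=\{(\varpi_1(m),\varpi_2(m)):m\in M\}$ let $$R_{(q_1,q_2)}=\{(\natural_1e,\natural_2e): e\in (K_1^\perp\cap K_2^\perp)_m,\ (\varpi_1(m),\varpi_2(m))=(q_1,q_2)\}\subset(\underline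 E_1)_{q_1}\times(\underline E_2)_{q_2}.$$ Assume: 1. $\rho(K_1)\cap\rho(K_2)$ has constant rank; each $R_{(q_1,q_2)}$ is a linear subspace; $[Y,Z]$ is a section of $\ker d\varpi_1+\ker d\varpi_2$ whenever $Y\in\Gamma(\ker d\varpi_1)$ and $Z\in\Gamma(\ker d\varpi_2)$; $K_1\cap K_2=0$ and $K_2^\perp\cap K_1\subset K_2$. 2. $D_1=(\varpi_1)_*\rho(K_2)$ is a well-defined distribution on $\mathcal Q_1$. Fix an open cover $\{U^{(i)}\}$ of $\mathcal Q_1$ and, for each $i$, finitely many vector fields $X^{(i)}_k$ on $U^{(i)}$ that span $D_1$ at every point of $U^{(i)}$. 3. There are isotropic splittings $\sigma_1,\sigma_2$ of $E$, with $\sigma_i$ adapted to $K_i$, which are *locally compatible*: for every $i$, $[\![\sigma_2(Y),e]\!]=\mathsf{ad}^{\sigma_1}_Ye$ on $\varpi_1^{-1}(U^{(i)})$ for all $e\in\Gamma(E)$ and all vector fields $Y$ on $\varpi_1^{-1}(U^{(i)})$ that are sections of $\rho(K_2)$ and project to an element of $\mathrm{Span}_{\mathbb R}\{X^{(i)}_k\}$.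 4. $\underline E_1$ is spanned pointwise by its locally $D_1$-invariant sections, i.e. by the sections $e\in\Gamma(\underline E_1)$ with $\mathsf{ad}^{\underline\sigma_1}_{X^{(i)}_k}e=0$ on $U^{(i)}$ for all $i,k$, where $\underline\sigma_1$ is the splitting of $\underline E_1$ induced by $\sigma_1$. Generalised metrics $\tau_1,\tau_2$ and divergences $\mathrm{div}_1,\mathrm{div}_2$ on $\underline E_1,\underline E_2$ are *T-dual* if, for every $c\in C$, $R_c=R_c^+\oplus R_c^-$ with $R_c^\pm=R_c\cap(V_1^\pm\times V_2^\pm)$ (that is, $R$ is a generalised isometry), and if $(\mathrm{div}_1e_1)(q_1)=(\mathrm{div}_2e_2)(q_2)$ for all $(q_1,q_2)\in C$ and all $e_1\in\Gamma(\underline E_1)$, $e_2\in\Gamma(\underline E_2)$ with $(e_1,e_2)|_C\in R$. **Theorem.** In this setting, let $(\tau_1(t),\mathrm{div}_1(t))$ be a solution of the generalised Ricci flow on $\underline E_1$ for $t\in[0,T)$ which is locally $D_1$-invariant with respect to the fixed generators for every $t\in[0,T)$: for all $i,k$, $\mathsf{ad}^{\underline\sigma_1}_{X^{(i)}_k}$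 preserves $\Gamma(U^{(i)},V_1^+(t))$, and $\pounds_{X^{(i)}_k}(\mathrm{div}_1(t)\,e)=\mathrm{div}_1(t)(\mathsf{ad}^{\underline\sigma_1}_{X^{(i)}_k}e)$ on $U^{(i)}$ for all sections $e$. Then there is a unique family $(\tau_2(t),\mathrm{div}_2(t))$, $t\in[0,T)$, of generalised metrics and divergences on $\underline E_2$ that is T-dual to $(\tau_1(t),\mathrm{div}_1(t))$ for every $t$, and it is a solution of the generalised Ricci flow on $\underline E_2$ on $[0,T)$ (with the same $\kappa$). -/

import Mathlib

open Set Filter Topology Manifold ContDiff Bundle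

noncomputable section

namespace GenGeom

section OneBundle

variable (B : Type*) [NormedAddCommGroup B] [NormedSpace ℝ B]
  {M : Type*} [TopologicalSpace M] [ChartedSpace B M]
  (F : Type*) [NormedAddCommGroup F] [NormedSpace ℝ F]
  (V : M → Type*) [TopologicalSpace (TotalSpace F V)]
  [∀ x, AddCommGroup (V x)] [∀ x, Module ℝ (V x)] [∀ x, TopologicalSpace (V x)]
  [FiberBundle F V] [VectorBundle ℝ F V]

/-- Smooth global sections of a vector bundle `V` with model fibre `F`. -/
abbrev Sec := Cₛ^∞⟮𝓘(ℝ, B); F, V⟯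

/-- Smooth real functions. -/
abbrev SmoothFun (B : Type*) [NormedAddCommGroup B] [NormedSpace ℝ B]
    (M : Type*) [TopologicalSpace M] [ChartedSpace B M] :=
  C^∞⟮𝓘(ℝ, B), M; 𝓘(ℝ, ℝ), ℝ⟯

/-- The tangent space of a manifold `M` modelled on the vector space `B`. -/
abbrev TSp (B : Type*) [NormedAddCommGroup B] [NormedSpace ℝ B]
    {M : Type*} [TopologicalSpace M] [ChartedSpace B M] (x : M) :=
  TangentSpace 𝓘(ℝ, B) x

/-- The differential of a map between manifolds, as a linear map of tangent spaces. -/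
def dMap (B : Type*) [NormedAddCommGroup B] [NormedSpace ℝ B]
    {M : Type*} [TopologicalSpace M] [ChartedSpace B M]
    (B' : Type*) [NormedAddCommGroup B'] [NormedSpace ℝ B']
    {N : Type*} [TopologicalSpace N] [ChartedSpace B' N]
    (f : M → N) (x : M) : TSp B x →ₗ[ℝ] TSp B' (f x) :=
  (mfderiv 𝓘(ℝ, B) 𝓘(ℝ, B') f x).toLinearMap

/-- The derivative of a real function along a tangent vector. -/
def dirDeriv (B : Type*) [NormedAddCommGroup B] [NormedSpace ℝ B]
    {M : Type*} [TopologicalSpace M] [ChartedSpace B M]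
    (f : M → ℝ) (x : M) (v : TSp B x) : ℝ :=
  mfderiv 𝓘(ℝ, B) 𝓘(ℝ, ℝ) f x v

/-- Smoothness on a set of a (rough) vector field. -/
def SmoothVFOn (B : Type*) [NormedAddCommGroup B] [NormedSpace ℝ B]
    {M : Type*} [TopologicalSpace M] [ChartedSpace B M] [IsManifold 𝓘(ℝ, B) ∞ M]
    (X : ∀ x : M, TSp B x) (U : Set M) : Prop :=
  ContMDiffOn 𝓘(ℝ, B) (𝓘(ℝ, B).prod 𝓘(ℝ, B)) ∞
    (fun x => (⟨x, X x⟩ : TotalSpace B (TangentSpace 𝓘(ℝ, B) : M → Type _))) U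

/-- Smoothness of a (rough) section of `V`. -/
def SmoothSec (s : ∀ x, V x) : Prop :=
  ContMDiff 𝓘(ℝ, B) (𝓘(ℝ, B).prod 𝓘(ℝ, F)) ∞ (fun x => (⟨x, s x⟩ : TotalSpace F V))

variable {B F V} in
/-- The product of a smooth function and a smooth section. -/
def funSmul (f : SmoothFun B M) (s : Sec B F V) : Sec B F V :=
  ⟨fun x => f x • s x, f.contMDiff.smul_section s.contMDiff⟩

/-- A Courant algebroid structure on the vector bundle `V`. -/
structure CourantAlgebroid [IsManifold 𝓘(ℝ, B) ∞ M] where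
  /-- the fibrewise pairing -/
  pairing : ∀ x, V x →ₗ[ℝ] V x →ₗ[ℝ] ℝ
  /-- the anchor -/
  anchor : ∀ x, V x →ₗ[ℝ] TSp B x
  /-- the Dorfman bracket -/
  bracket : Sec B F V →ₗ[ℝ] Sec B F V →ₗ[ℝ] Sec B F V
  pairing_symm : ∀ x (a b : V x), pairing x a b = pairing x b a
  pairing_nondegenerate : ∀ x, Function.Bijective (pairing x)
  pairing_smooth : ∀ s t : Sec B F V,
    ContMDiff 𝓘(ℝ, B) 𝓘(ℝ, ℝ) ∞ (fun x => pairing x (s x) (t x))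
  anchor_smooth : ∀ s : Sec B F V, SmoothVFOn B (fun x => anchor x (s x)) univ
  invariance : ∀ (e e₁ e₂ : Sec B F V) (x : M),
    dirDeriv B (fun y => pairing y (e₁ y) (e₂ y)) x (anchor x (e x)) =
      pairing x (bracket e e₁ x) (e₂ x) + pairing x (e₁ x) (bracket e e₂ x)
  symmetric_part : ∀ (e e₁ : Sec B F V) (x : M),
    pairing x (bracket e e x) (e₁ x) =
      (1 / 2 : ℝ) * dirDeriv B (fun y => pairing y (e y) (e y)) x (anchor x (e₁ x))
  jacobi : ∀ e e₁ e₂ : Sec B F V,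
    bracket e (bracket e₁ e₂) = bracket (bracket e e₁) e₂ + bracket e₁ (bracket e e₂)

end OneBundle

section Structures

variable {B : Type*} [NormedAddCommGroup B] [NormedSpace ℝ B]
  {M : Type*} [TopologicalSpace M] [ChartedSpace B M] [IsManifold 𝓘(ℝ, B) ∞ M]
  {F : Type*} [NormedAddCommGroup F] [NormedSpace ℝ F]
  {V : M → Type*} [TopologicalSpace (TotalSpace F V)]
  [∀ x, AddCommGroup (V x)] [∀ x, Module ℝ (V x)] [∀ x, TopologicalSpace (V x)]
  [FiberBundle F V] [VectorBundle ℝ F V]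

namespace CourantAlgebroid

variable (C : CourantAlgebroid B F V)

/-- `ρ^* : T^*M → E`, defined by `⟨ρ^* α, e⟩ = α (ρ e)`. -/
def rhoStar (x : M) (α : TSp B x →ₗ[ℝ] ℝ) : V x :=
  (LinearEquiv.ofBijective (C.pairing x) (C.pairing_nondegenerate x)).symm (α ∘ₗ C.anchor x)

/-- Exactness of `0 → T^*M → E → TM → 0`. -/
def IsExact : Prop :=
  ∀ x, Function.Injective (C.rhoStar x) ∧ Function.Surjective (C.anchor x) ∧
    ∀ a : V x, C.anchor x a = 0 ↔ ∃ α, C.rhoStar x α = a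

/-- The orthogonal complement of a family of subspaces of the fibres. -/
def perp (K : ∀ x, Submodule ℝ (V x)) (x : M) : Submodule ℝ (V x) where
  carrier := {a | ∀ k ∈ K x, C.pairing x k a = 0}
  add_mem' := fun {a b} ha hb k hk => by simp [ha k hk, hb k hk]
  zero_mem' := fun k _ => by simp
  smul_mem' := fun c a ha k hk => by simp [ha k hk]

/-- The distribution `ρ(K)`. -/
def anchorImage (K : ∀ x, Submodule ℝ (V x)) (x : M) : Submodule ℝ (TSp B x) :=
  (K x).map (C.anchor x)

end CourantAlgebroid

/-- The section `s` takes values in the family of subspaces `K`. -/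
def IsSecOf (K : ∀ x, Submodule ℝ (V x)) (s : Sec B F V) : Prop := ∀ x, s x ∈ K x

variable (B F) in
/-- A family of subspaces of the fibres of `V` is a smooth subbundle: it has constant rank and
every vector in it extends to a smooth section of it. -/
def IsSubbundle (K : ∀ x, Submodule ℝ (V x)) : Prop :=
  (∃ r : ℕ, ∀ x, Module.finrank ℝ (K x) = r) ∧
    ∀ x, ∀ a ∈ K x, ∃ s : Sec B F V, IsSecOf K s ∧ s x = a

/-- `e ∈ Γ_bas(K^⊥)`: sections of `K^⊥` which are basic with respect to `K`. -/
def IsBasic (C : CourantAlgebroid B F V) (K : ∀ x, Submodule ℝ (V x)) (e : Sec B F V) : Prop :=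
  IsSecOf (C.perp K) e ∧ ∀ k : Sec B F V, IsSecOf K k → IsSecOf K (C.bracket k e)

/-- An isotropic splitting `σ : TM → E` of the anchor. -/
structure Splitting (C : CourantAlgebroid B F V) where
  /-- the fibrewise linear map -/
  toFun : ∀ x, TSp B x →ₗ[ℝ] V x
  smooth : ∀ X : ∀ x : M, TSp B x, SmoothVFOn B X univ → SmoothSec B F V (fun x => toFun x (X x))
  right_inverse : ∀ x v, C.anchor x (toFun x v) = v
  isotropic : ∀ x v w, C.pairing x (toFun x v) (toFun x w) = 0

namespace Splitting

variable {C : CourantAlgebroid B F V} (σ : Splitting C)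

/-- The section `σ(ρ(e))`. -/
def sigmaRho (e : Sec B F V) : Sec B F V :=
  ⟨fun x => σ.toFun x (C.anchor x (e x)), σ.smooth _ (C.anchor_smooth e)⟩

/-- The `σ`-adjoint action `ad^σ_a e = ⟦a, e⟧ - ρ^* σ^* ⟦a, σ(ρ(e))⟧`, where
`σ^* : E → T^*M` is `(σ^* b)(v) = ⟨b, σ v⟩`. -/
def ad (a e : Sec B F V) (x : M) : V x :=
  C.bracket a e x - C.rhoStar x (C.pairing x (C.bracket a (σ.sigmaRho e) x) ∘ₗ σ.toFun x)

end Splitting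

/-- A generalised metric: an involution `τ` of `E` over the identity such that
`⟨·, τ ·⟩` is a (symmetric) positive-definite fibrewise metric. -/
structure GenMetric (C : CourantAlgebroid B F V) where
  /-- the fibrewise linear map -/
  toFun : ∀ x, V x →ₗ[ℝ] V x
  smooth : ∀ s : Sec B F V, SmoothSec B F V (fun x => toFun x (s x))
  involutive : ∀ x a, toFun x (toFun x a) = a
  symm : ∀ x a b, C.pairing x a (toFun x b) = C.pairing x b (toFun x a)
  posDef : ∀ x a, a ≠ 0 → 0 < C.pairing x a (toFun x a)

namespace GenMetric

variable {C : CourantAlgebroid B F V} (τ : GenMetric C)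

/-- The action of `τ` on sections. -/
def map (s : Sec B F V) : Sec B F V := ⟨fun x => τ.toFun x (s x), τ.smooth s⟩

/-- The projection of a section to `V⁺`. -/
def plus (s : Sec B F V) : Sec B F V := (1 / 2 : ℝ) • (s + τ.map s)

/-- The projection of a section to `V⁻`. -/
def minus (s : Sec B F V) : Sec B F V := (1 / 2 : ℝ) • (s - τ.map s)

/-- Membership in the fibre of `V⁺`. -/
def MemPlus {x : M} (a : V x) : Prop := τ.toFun x a = a

/-- Membership in the fibre of `V⁻`. -/
def MemMinus {x : M} (a : V x) : Prop := τ.toFun x a = -a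

end GenMetric

/-- A divergence operator on a Courant algebroid. -/
structure Divergence (C : CourantAlgebroid B F V) where
  /-- the underlying `ℝ`-linear map -/
  toFun : Sec B F V →ₗ[ℝ] SmoothFun B M
  leibniz : ∀ (f : SmoothFun B M) (e : Sec B F V) (x : M),
    toFun (funSmul f e) x = f x * toFun e x + dirDeriv B f x (C.anchor x (e x))

section Curvature

variable {C : CourantAlgebroid B F V} (τ : GenMetric C) (dv : Divergence C)

open Classical in
/-- The trace at `x` over `V⁺` of the endomorphism `u ↦ ⟦⟦u, w⟧⁻, v⟧⁺` of `V⁺`. For `v` a section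
of `V⁺` and `w` a section of `V⁻` this map is `C^∞`-linear in `u`, so it comes from an endomorphism
`A` of the fibre; `A` is extended by zero to `V⁻`, which does not change the trace. -/
def ricciTrace (v w : Sec B F V) (x : M) : ℝ :=
  if h : ∃ A : V x →ₗ[ℝ] V x, ∀ u : Sec B F V,
      A (u x) = τ.plus (C.bracket (τ.minus (C.bracket (τ.plus u) w)) v) x
  then LinearMap.trace ℝ (V x) h.choose else 0

/-- The generalised Ricci tensor
`GRic_{V⁺, div}(v, w) = div ⟦w, v⟧⁺ - £_{ρ(w)} (div v) - Tr_{V⁺} ⟦⟦·, w⟧⁻, v⟧⁺`,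
for `v ∈ Γ(V⁺)` and `w ∈ Γ(V⁻)`. With this order of the first bracket the expression is
`C^∞`-bilinear. -/
def GRic (v w : Sec B F V) (x : M) : ℝ :=
  dv.toFun (τ.plus (C.bracket w v)) x - dirDeriv B (dv.toFun v) x (C.anchor x (w x))
    - ricciTrace τ v w x

/-- `(e, f)` is, near `x`, a smooth frame of `V⁺ ⊕ V⁻`, with `e` an orthonormal frame of `V⁺` and
`f` an orthonormal frame of `V⁻` (on which the pairing is negative definite). -/
structure IsOrthoFrame (x : M) {p q : ℕ} (e : Fin p → Sec B F V) (f : Fin q → Sec B F V) :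
    Prop where
  rank : p + q = Module.finrank ℝ F
  plus : ∀ᶠ y in 𝓝 x, ∀ a, τ.MemPlus (e a y)
  minus : ∀ᶠ y in 𝓝 x, ∀ a, τ.MemMinus (f a y)
  plus_ortho : ∀ᶠ y in 𝓝 x, ∀ a b, C.pairing y (e a y) (e b y) = if a = b then 1 else 0
  minus_ortho : ∀ᶠ y in 𝓝 x, ∀ a b, C.pairing y (f a y) (f b y) = if a = b then -1 else 0

/-- The contribution of one of the two summands `V⁺`, `V⁻`, with frame `e`, to the generalised
scalar curvature; `f` is a frame of the other summand. -/
def scalarPart (x : M) {p q : ℕ} (e : Fin p → Sec B F V) (f : Fin q → Sec B F V) : ℝ :=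
  -4 * ∑ a, dirDeriv B (dv.toFun (e a)) x (C.anchor x (e a x))
    - 2 * ∑ a, (dv.toFun (e a) x) ^ 2
    + (1 / 3 : ℝ) * ∑ a, ∑ b, ∑ c, (C.pairing x (C.bracket (e a) (e b) x) (e c x)) ^ 2
    - ∑ a, ∑ b, ∑ c, (C.pairing x (C.bracket (e a) (e b) x) (f c x)) ^ 2

open Classical in
/-- The generalised scalar curvature `GR_{V⁺, div}`, i.e. the `τ`-trace of the full generalised
Ricci tensor of any Levi-Civita Courant algebroid connection with divergence `div`, written out in
an orthonormal frame near the point; the value does not depend on the frame. It is normalised so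
that on `TM ⊕ T^*M` twisted by `H`, with `V⁺ = graph(g)` and the divergence of the density
`exp(-2φ) μ_g`, it is `R_g - (1/12) H_{ijk} H^{ijk} + 4 Δφ - 4 |dφ|²`. -/
def GR (x : M) : ℝ :=
  if h : ∃ (p q : ℕ) (ef : (Fin p → Sec B F V) × (Fin q → Sec B F V)),
      IsOrthoFrame τ x ef.1 ef.2
  then
    (1 / 2 : ℝ) *
      (scalarPart dv x h.choose_spec.choose_spec.choose.1 h.choose_spec.choose_spec.choose.2
        + scalarPart dv x h.choose_spec.choose_spec.choose.2 h.choose_spec.choose_spec.choose.1)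
  else 0

end Curvature

/-- `(τ(t), div(t))`, `t ∈ [0, T)`, is a smooth solution of the generalised Ricci flow
`∂τ/∂t = -2 GRic`, `∂div/∂t = -𝒟 GR`. The endomorphism `∂τ/∂t` is symmetric for the pairing and
interchanges `V⁺` and `V⁻`, hence is the same as the bilinear form `⟨(∂τ/∂t) v, w⟩` on `V⁺ × V⁻`;
`κ` is the normalisation of this identification. Since `⟨𝒟 f, e⟩ = £_{ρ(e)} f`, the second
equation is `∂/∂t (div e) = -£_{ρ(e)} GR`. -/
structure IsGenRicciFlow {C : CourantAlgebroid B F V} (κ T : ℝ) (τ : ℝ → GenMetric C)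
    (dv : ℝ → Divergence C) : Prop where
  smooth_metric : ∀ s s' : Sec B F V,
    ContMDiffOn (𝓘(ℝ, ℝ).prod 𝓘(ℝ, B)) 𝓘(ℝ, ℝ) ∞
      (fun p : ℝ × M => C.pairing p.2 ((τ p.1).toFun p.2 (s p.2)) (s' p.2)) (Ico 0 T ×ˢ univ)
  smooth_div : ∀ s : Sec B F V,
    ContMDiffOn (𝓘(ℝ, ℝ).prod 𝓘(ℝ, B)) 𝓘(ℝ, ℝ) ∞
      (fun p : ℝ × M => (dv p.1).toFun s p.2) (Ico 0 T ×ˢ univ)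
  metric_eq : ∀ t ∈ Ico 0 T, ∀ v w : Sec B F V,
    (∀ x, (τ t).MemPlus (v x)) → (∀ x, (τ t).MemMinus (w x)) → ∀ x,
      HasDerivWithinAt (fun r => C.pairing x ((τ r).toFun x (v x)) (w x))
        (-2 * κ * GRic (τ t) (dv t) v w x) (Ico 0 T) t
  div_eq : ∀ t ∈ Ico 0 T, ∀ (e : Sec B F V) (x : M),
    HasDerivWithinAt (fun r => (dv r).toFun e x)
      (-dirDeriv B (GR (τ t) (dv t)) x (C.anchor x (e x))) (Ico 0 T) t

section LocalInvariance

/-! A distribution is given on the members of an open cover by finitely many generating vector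
fields `X i k`, each smooth on `U i`. Values at `x ∈ U i` of brackets with the local section
`σ(X i k)` are computed with any global section `a` that agrees with it near `x`. -/

variable {C : CourantAlgebroid B F V} (σ : Splitting C) {ι : Type*} (U : ι → Set M) {r : ι → ℕ}
  (X : ∀ i, Fin (r i) → ∀ x : M, TSp B x)

/-- The generalised metric is locally invariant: `ad^σ_{X i k}` preserves `Γ(U i, V⁺)`. -/
def IsLocInvMetric (τ : GenMetric C) : Prop :=
  ∀ (i : ι) (k : Fin (r i)), ∀ x ∈ U i, ∀ a w : Sec B F V,
    (∀ᶠ y in 𝓝 x, a y = σ.toFun y (X i k y)) → (∀ᶠ y in 𝓝 x, τ.MemPlus (w y)) →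
      τ.MemPlus (σ.ad a w x)

/-- The divergence is locally compatible: `£_{X i k} (div e) = div (ad^σ_{X i k} e)` on `U i`. -/
def IsLocCompatDiv (dv : Divergence C) : Prop :=
  ∀ (i : ι) (k : Fin (r i)), ∀ x ∈ U i, ∀ a e b : Sec B F V,
    (∀ᶠ y in 𝓝 x, a y = σ.toFun y (X i k y)) → (∀ᶠ y in 𝓝 x, b y = σ.ad a e y) →
      dirDeriv B (dv.toFun e) x (X i k x) = dv.toFun b x

/-- The section is locally invariant: `ad^σ_{X i k} e = 0` on `U i`. -/
def IsLocInvSec (e : Sec B F V) : Prop :=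
  ∀ (i : ι) (k : Fin (r i)), ∀ x ∈ U i, ∀ a : Sec B F V,
    (∀ᶠ y in 𝓝 x, a y = σ.toFun y (X i k y)) → σ.ad a e x = 0

end LocalInvariance

end Structures

section Reduction

variable {B : Type*} [NormedAddCommGroup B] [NormedSpace ℝ B]
  {M : Type*} [TopologicalSpace M] [ChartedSpace B M] [IsManifold 𝓘(ℝ, B) ∞ M]
  {F : Type*} [NormedAddCommGroup F] [NormedSpace ℝ F]
  {V : M → Type*} [TopologicalSpace (TotalSpace F V)]
  [∀ x, AddCommGroup (V x)] [∀ x, Module ℝ (V x)] [∀ x, TopologicalSpace (V x)]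
  [FiberBundle F V] [VectorBundle ℝ F V]
  {B₁ : Type*} [NormedAddCommGroup B₁] [NormedSpace ℝ B₁]
  {Q₁ : Type*} [TopologicalSpace Q₁] [ChartedSpace B₁ Q₁] [IsManifold 𝓘(ℝ, B₁) ∞ Q₁]
  {F₁ : Type*} [NormedAddCommGroup F₁] [NormedSpace ℝ F₁]
  {V₁ : Q₁ → Type*} [TopologicalSpace (TotalSpace F₁ V₁)]
  [∀ x, AddCommGroup (V₁ x)] [∀ x, Module ℝ (V₁ x)] [∀ x, TopologicalSpace (V₁ x)]
  [FiberBundle F₁ V₁] [VectorBundle ℝ F₁ V₁]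

/-- `C₁` is the reduction of the Courant algebroid `C` by the isotropic subbundle `K`: the map `ϖ`
is the quotient map of `M` to the leaf space of the foliation integrating `ρ(K)` (a surjective
submersion whose fibres are the leaves, i.e. are connected and tangent to `ρ(K)`), and `nat` is
the fibrewise quotient `K^⊥ → K^⊥/K`, which identifies `Γ_bas(K^⊥)/Γ(K)` with the sections of the
reduced bundle and intertwines pairings, anchors and brackets. -/
structure IsReduction (C : CourantAlgebroid B F V) (K : ∀ x, Submodule ℝ (V x)) (ϖ : M → Q₁)
    (C₁ : CourantAlgebroid B₁ F₁ V₁) (nat : ∀ m, C.perp K m →ₗ[ℝ] V₁ (ϖ m)) : Prop where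
  subbundle : IsSubbundle B F K
  isotropic : ∀ m, K m ≤ C.perp K m
  anchor_perp : ∀ m, C.anchorImage (C.perp K) m = ⊤
  enough_basic : ∀ m, ∀ a ∈ C.perp K m, a ∈ Submodule.span ℝ {b | ∃ e, IsBasic C K e ∧ e m = b}
  smooth_proj : ContMDiff 𝓘(ℝ, B) 𝓘(ℝ, B₁) ∞ ϖ
  surjective_proj : Function.Surjective ϖ
  submersion : ∀ m, Function.Surjective (dMap B B₁ ϖ m)
  ker_proj : ∀ m, LinearMap.ker (dMap B B₁ ϖ m) = C.anchorImage K m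
  connected_leaves : ∀ q, IsConnected (ϖ ⁻¹' {q})
  nat_surjective : ∀ m, Function.Surjective (nat m)
  nat_ker : ∀ m (a : C.perp K m), nat m a = 0 ↔ (a : V m) ∈ K m
  nat_pairing : ∀ m (a b : C.perp K m),
    C₁.pairing (ϖ m) (nat m a) (nat m b) = C.pairing m a b
  nat_anchor : ∀ m (a : C.perp K m),
    C₁.anchor (ϖ m) (nat m a) = dMap B B₁ ϖ m (C.anchor m a)
  descend : ∀ e, IsBasic C K e → ∃ e₁ : Sec B₁ F₁ V₁,
    ∀ m (h : e m ∈ C.perp K m), nat m ⟨e m, h⟩ = e₁ (ϖ m)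
  lift : ∀ e₁ : Sec B₁ F₁ V₁, ∃ e, IsBasic C K e ∧
    ∀ m (h : e m ∈ C.perp K m), nat m ⟨e m, h⟩ = e₁ (ϖ m)
  nat_bracket : ∀ (e e' : Sec B F V) (e₁ e₁' : Sec B₁ F₁ V₁), IsBasic C K e → IsBasic C K e' →
    (∀ m (h : e m ∈ C.perp K m), nat m ⟨e m, h⟩ = e₁ (ϖ m)) →
    (∀ m (h : e' m ∈ C.perp K m), nat m ⟨e' m, h⟩ = e₁' (ϖ m)) →
    ∀ m (h : C.bracket e e' m ∈ C.perp K m), nat m ⟨C.bracket e e' m, h⟩ = C₁.bracket e₁ e₁' (ϖ m)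

variable (B₁) in
/-- The isotropic splitting `σ` is adapted to `K`. -/
structure IsAdapted {C : CourantAlgebroid B F V} (σ : Splitting C) (K : ∀ x, Submodule ℝ (V x))
    (ϖ : M → Q₁) : Prop where
  mem_perp : ∀ m v, σ.toFun m v ∈ C.perp K m
  basic : ∀ (Y : ∀ m : M, TSp B m) (Y₁ : ∀ q : Q₁, TSp B₁ q),
    SmoothVFOn B Y univ → SmoothVFOn B₁ Y₁ univ → (∀ m, dMap B B₁ ϖ m (Y m) = Y₁ (ϖ m)) →
    ∀ e : Sec B F V, (∀ m, e m = σ.toFun m (Y m)) → IsBasic C K e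

/-- The splitting `σ₁` of the reduced Courant algebroid is induced by the adapted splitting `σ`. -/
def IsInducedSplitting {C : CourantAlgebroid B F V} {C₁ : CourantAlgebroid B₁ F₁ V₁}
    {K : ∀ x, Submodule ℝ (V x)} {ϖ : M → Q₁} (nat : ∀ m, C.perp K m →ₗ[ℝ] V₁ (ϖ m))
    (σ : Splitting C) (σ₁ : Splitting C₁) : Prop :=
  ∀ m (v : TSp B m) (h : σ.toFun m v ∈ C.perp K m),
    σ₁.toFun (ϖ m) (dMap B B₁ ϖ m v) = nat m ⟨σ.toFun m v, h⟩

variable (B₁) in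
/-- Local compatibility of splittings: `⟦σ₂(Y), e⟧ = ad^{σ₁}_Y e` on `ϖ⁻¹(U i)` for all vector
fields `Y` on `ϖ⁻¹(U i)` which are sections of `ρ(K₂)` and project to an element of the real span
of the vector fields `X i k`. -/
def IsLocCompatible {C : CourantAlgebroid B F V} (σ₁ σ₂ : Splitting C)
    (K₂ : ∀ x, Submodule ℝ (V x)) (ϖ : M → Q₁) {ι : Type*} (U : ι → Set Q₁) {r : ι → ℕ}
    (X : ∀ i, Fin (r i) → ∀ q : Q₁, TSp B₁ q) : Prop :=
  ∀ (i : ι) (Y : ∀ m : M, TSp B m), SmoothVFOn B Y (ϖ ⁻¹' U i) →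
    (∀ m ∈ ϖ ⁻¹' U i, Y m ∈ C.anchorImage K₂ m) →
    (∃ c : Fin (r i) → ℝ, ∀ m ∈ ϖ ⁻¹' U i, dMap B B₁ ϖ m (Y m) = ∑ k, c k • X i k (ϖ m)) →
    ∀ m ∈ ϖ ⁻¹' U i, ∀ a₁ a₂ e : Sec B F V,
      (∀ᶠ y in 𝓝 m, a₁ y = σ₁.toFun y (Y y)) → (∀ᶠ y in 𝓝 m, a₂ y = σ₂.toFun y (Y y)) →
      C.bracket a₂ e m = σ₁.ad a₁ e m

variable {B₂ : Type*} [NormedAddCommGroup B₂] [NormedSpace ℝ B₂]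
  {Q₂ : Type*} [TopologicalSpace Q₂] [ChartedSpace B₂ Q₂] [IsManifold 𝓘(ℝ, B₂) ∞ Q₂]
  {F₂ : Type*} [NormedAddCommGroup F₂] [NormedSpace ℝ F₂]
  {V₂ : Q₂ → Type*} [TopologicalSpace (TotalSpace F₂ V₂)]
  [∀ x, AddCommGroup (V₂ x)] [∀ x, Module ℝ (V₂ x)] [∀ x, TopologicalSpace (V₂ x)]
  [FiberBundle F₂ V₂] [VectorBundle ℝ F₂ V₂]

/-- The T-duality relation `R = {(♮₁(e), ♮₂(e)) | e ∈ K₁^⊥ ∩ K₂^⊥}`, supported on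
`C = {(ϖ₁(m), ϖ₂(m))}`: `TDualRel nat₁ nat₂ q₁ q₂ a b` says that `(q₁, q₂) ∈ C` and that
`(a, b)` is in the fibre of `R` over `(q₁, q₂)`. -/
inductive TDualRel {C : CourantAlgebroid B F V} {K₁ K₂ : ∀ x, Submodule ℝ (V x)}
    {ϖ₁ : M → Q₁} {ϖ₂ : M → Q₂} (nat₁ : ∀ m, C.perp K₁ m →ₗ[ℝ] V₁ (ϖ₁ m))
    (nat₂ : ∀ m, C.perp K₂ m →ₗ[ℝ] V₂ (ϖ₂ m)) : ∀ (q₁ : Q₁) (q₂ : Q₂), V₁ q₁ → V₂ q₂ → Prop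
  | mk (m : M) (e : V m) (h₁ : e ∈ C.perp K₁ m) (h₂ : e ∈ C.perp K₂ m) :
      TDualRel nat₁ nat₂ (ϖ₁ m) (ϖ₂ m) (nat₁ m ⟨e, h₁⟩) (nat₂ m ⟨e, h₂⟩)

/-- The relation `R` is a generalised isometry between `τ₁` and `τ₂`: `R = R⁺ ⊕ R⁻` over each point
of its support, where `R^± = R ∩ (V₁^± × V₂^±)`. -/
def IsGenIsometry {C₁ : CourantAlgebroid B₁ F₁ V₁} {C₂ : CourantAlgebroid B₂ F₂ V₂}
    (R : ∀ (q₁ : Q₁) (q₂ : Q₂), V₁ q₁ → V₂ q₂ → Prop) (τ₁ : GenMetric C₁) (τ₂ : GenMetric C₂) :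
    Prop :=
  ∀ (q₁ : Q₁) (q₂ : Q₂) (a : V₁ q₁) (b : V₂ q₂), R q₁ q₂ a b ↔
    ∃ (ap am : V₁ q₁) (bp bm : V₂ q₂),
      (R q₁ q₂ ap bp ∧ τ₁.MemPlus ap ∧ τ₂.MemPlus bp) ∧
      (R q₁ q₂ am bm ∧ τ₁.MemMinus am ∧ τ₂.MemMinus bm) ∧ a = ap + am ∧ b = bp + bm

/-- The divergences `dv₁` and `dv₂` are `R`-related: `dv₁ e₁` and `dv₂ e₂` agree over the support
`{(ϖ₁(m), ϖ₂(m))}` of `R` whenever the sections `e₁` and `e₂` are `R`-related. -/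
def IsRelatedDiv {C₁ : CourantAlgebroid B₁ F₁ V₁} {C₂ : CourantAlgebroid B₂ F₂ V₂}
    (ϖ₁ : M → Q₁) (ϖ₂ : M → Q₂) (R : ∀ (q₁ : Q₁) (q₂ : Q₂), V₁ q₁ → V₂ q₂ → Prop)
    (dv₁ : Divergence C₁) (dv₂ : Divergence C₂) : Prop :=
  ∀ (e₁ : Sec B₁ F₁ V₁) (e₂ : Sec B₂ F₂ V₂),
    (∀ m, R (ϖ₁ m) (ϖ₂ m) (e₁ (ϖ₁ m)) (e₂ (ϖ₂ m))) →
    ∀ m, dv₁.toFun e₁ (ϖ₁ m) = dv₂.toFun e₂ (ϖ₂ m)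

end Reduction

end GenGeom

end

open GenGeom

/-! Over every point m of M the relation R is the graph of a linear isometry. The two transversality
assumptions give K₁ ∩ K₂^⊥ = 0, equality of ranks turns this into E = K₁ ⊕ K₂^⊥, and so each vector
of the first reduced bundle has exactly one lift to K₁^⊥ ∩ K₂^⊥ (`IsTDualPair.exists_natRel`,
`IsTDualPair.exists_transfer`). Linearity of R over points of C makes this isometry depend only on
(ϖ₁ m, ϖ₂ m). It may still vary with m along a fibre of ϖ₂, and this is the obstruction to
transporting structures to the second quotient. Invariance removes it.

The heart is `IsTDualPair.exists_relSec`: an invariant section e₁ is R-related to a section over the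
second quotient. For this its lift e to K₁^⊥ ∩ K₂^⊥ has to be K₂-basic. If k is a section of K₂,
then ⟦k, e⟧ pairs to zero with K₂, and its pairing with w in K₁^⊥ ∩ K₂^⊥ equals ⟨k, ⟦e, w⟧⟩, which
depends only on the value of k at the point (`IsTDualPair.isBasic_right`). So k may be replaced by
σ₂(Y), where Y is a section of ρ(K₂) which projects to a combination of the generators with constant
coefficients (`IsTDualPair.exists_lift_on`). Local compatibility turns the bracket into ad^{σ₁}_Y e,
which descends to the adjoint action of the generators on e₁. That vanishes, so the bracket lies in
K₁ at the point and is orthogonal to w.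

Related sections are closed under brackets, since brackets are computed on common lifts to M, and
derivatives along them of functions with equal pull-backs to M agree (`RelSec.bracket`,
`IsTDualPair.dirDeriv_eq`). Invariant sections span, so they provide related frames near every
point. An invariant metric preserves the invariant sections, so its transport does not depend on the
point of the ϖ₂-fibre (`IsTDualPair.exists_dual_metric`). The divergence of an invariant section is
constant along D₁, hence its pull-back is constant on the connected fibres of ϖ₂ and descends; the
Leibniz rule extends the values found in this way (`IsTDualPair.exists_dual_div`). Uniqueness holds
because R reaches every vector of the second bundle and related frames determine a divergence.

The Ricci tensor and the scalar curvature are built from brackets, pairings, divergences and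
anchors, so T-dual data should have equal curvatures. Two facts make this precise. `GRic` is
tensorial, so it may be evaluated on related sections. `GR`, which is written in one chosen frame,
does not depend on that frame (`scalarPart_eq`), so it may be evaluated in related orthonormal
frames, obtained by a Gram-Schmidt process that stays inside the related sections. Both flow
equations then pass to the second quotient, and joint smoothness passes along local sections of ϖ₂
(`IsTDualPair.isGenRicciFlow_right`). -/

noncomputable section

namespace GenGeom

set_option linter.unusedSectionVars false

/-! ### Directional derivatives of real functions on a manifold. -/

section Derivative

variable {B : Type*} [NormedAddCommGroup B] [NormedSpace ℝ B]
  {M : Type*} [TopologicalSpace M] [ChartedSpace B M]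

/-- Smoothness at a point of a real function. -/
abbrev SmoothAt (B : Type*) [NormedAddCommGroup B] [NormedSpace ℝ B]
    {M : Type*} [TopologicalSpace M] [ChartedSpace B M] (f : M → ℝ) (x : M) : Prop :=
  ContMDiffAt 𝓘(ℝ, B) 𝓘(ℝ, ℝ) ∞ f x

lemma SmoothAt.mdifferentiableAt {f : M → ℝ} {x : M} (h : SmoothAt B f x) :
    MDifferentiableAt 𝓘(ℝ, B) 𝓘(ℝ, ℝ) f x :=
  ContMDiffAt.mdifferentiableAt h (by simp)

lemma SmoothFun.smoothAt (f : SmoothFun B M) (x : M) : SmoothAt B f x := f.contMDiff x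

lemma SmoothAt.mul {f g : M → ℝ} {x : M} (hf : SmoothAt B f x) (hg : SmoothAt B g x) :
    SmoothAt B (fun y => f y * g y) x := by
  have := ContMDiffAt.smul hf hg
  exact this

lemma SmoothAt.add {f g : M → ℝ} {x : M} (hf : SmoothAt B f x) (hg : SmoothAt B g x) :
    SmoothAt B (fun y => f y + g y) x := ContMDiffAt.add hf hg

lemma SmoothAt.sub {f g : M → ℝ} {x : M} (hf : SmoothAt B f x) (hg : SmoothAt B g x) :
    SmoothAt B (fun y => f y - g y) x := ContMDiffAt.sub hf hg

lemma SmoothAt.sum {ι : Type*} {s : Finset ι} {f : ι → M → ℝ} {x : M}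
    (hf : ∀ i ∈ s, SmoothAt B (f i) x) : SmoothAt B (fun y => ∑ i ∈ s, f i y) x :=
  contMDiffAt_finsetSum hf

lemma smoothAt_const {c : ℝ} {x : M} : SmoothAt B (fun _ : M => c) x := contMDiffAt_const

lemma dirDeriv_congr {f g : M → ℝ} {x : M} (h : f =ᶠ[𝓝 x] g) (v : TSp B x) :
    dirDeriv B f x v = dirDeriv B g x v := by
  unfold dirDeriv
  rw [h.mfderiv_eq]
  rfl

@[simp] lemma dirDeriv_zero_vec (f : M → ℝ) (x : M) : dirDeriv B f x 0 = 0 := by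
  unfold dirDeriv; exact map_zero (mfderiv 𝓘(ℝ, B) 𝓘(ℝ, ℝ) f x)

lemma dirDeriv_add_vec (f : M → ℝ) (x : M) (v w : TSp B x) :
    dirDeriv B f x (v + w) = dirDeriv B f x v + dirDeriv B f x w := by
  unfold dirDeriv; exact map_add (mfderiv 𝓘(ℝ, B) 𝓘(ℝ, ℝ) f x) v w

lemma dirDeriv_smul_vec (f : M → ℝ) (x : M) (c : ℝ) (v : TSp B x) :
    dirDeriv B f x (c • v) = c * dirDeriv B f x v := by
  unfold dirDeriv; exact map_smul (mfderiv 𝓘(ℝ, B) 𝓘(ℝ, ℝ) f x) c v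

/-- The derivative of a function at a point, as a linear form. -/
def dForm (B : Type*) [NormedAddCommGroup B] [NormedSpace ℝ B]
    {M : Type*} [TopologicalSpace M] [ChartedSpace B M] (f : M → ℝ) (x : M) : TSp B x →ₗ[ℝ] ℝ where
  toFun := dirDeriv B f x
  map_add' := dirDeriv_add_vec f x
  map_smul' := dirDeriv_smul_vec f x

@[simp] lemma dForm_apply (f : M → ℝ) (x : M) (v : TSp B x) : dForm B f x v = dirDeriv B f x v :=
  rfl

lemma dirDeriv_sum_vec (f : M → ℝ) (x : M) {ι : Type*} (s : Finset ι) (v : ι → TSp B x) :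
    dirDeriv B f x (∑ i ∈ s, v i) = ∑ i ∈ s, dirDeriv B f x (v i) := map_sum (dForm B f x) v s

lemma dirDeriv_neg_vec (f : M → ℝ) (x : M) (v : TSp B x) :
    dirDeriv B f x (-v) = -dirDeriv B f x v := map_neg (dForm B f x) v

lemma dirDeriv_sub_vec (f : M → ℝ) (x : M) (v w : TSp B x) :
    dirDeriv B f x (v - w) = dirDeriv B f x v - dirDeriv B f x w := map_sub (dForm B f x) v w

@[simp] lemma dirDeriv_const (c : ℝ) (x : M) (v : TSp B x) :
    dirDeriv B (fun _ : M => c) x v = 0 := by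
  unfold dirDeriv
  rw [mfderiv_const]
  rfl

lemma dirDeriv_add {f g : M → ℝ} {x : M} (hf : SmoothAt B f x) (hg : SmoothAt B g x)
    (v : TSp B x) :
    dirDeriv B (fun y => f y + g y) x v = dirDeriv B f x v + dirDeriv B g x v := by
  have := (hf.mdifferentiableAt.hasMFDerivAt.add hg.mdifferentiableAt.hasMFDerivAt).mfderiv
  unfold dirDeriv
  exact DFunLike.congr_fun this v

lemma dirDeriv_sum {ι : Type*} (s : Finset ι) {f : ι → M → ℝ} {x : M}
    (hf : ∀ i ∈ s, SmoothAt B (f i) x) (v : TSp B x) :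
    dirDeriv B (fun y => ∑ i ∈ s, f i y) x v = ∑ i ∈ s, dirDeriv B (f i) x v := by
  classical
  induction s using Finset.induction_on with
  | empty => simp
  | insert a s ha ih =>
    simp only [Finset.sum_insert ha]
    rw [dirDeriv_add (hf a (by simp)) (SmoothAt.sum fun i hi => hf i (by simp [hi])),
      ih fun i hi => hf i (by simp [hi])]

lemma dirDeriv_mul {f g : M → ℝ} {x : M} (hf : SmoothAt B f x) (hg : SmoothAt B g x)
    (v : TSp B x) :
    dirDeriv B (fun y => f y * g y) x v = f x * dirDeriv B g x v + g x * dirDeriv B f x v := by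
  have := (hf.mdifferentiableAt.hasMFDerivAt.mul hg.mdifferentiableAt.hasMFDerivAt).mfderiv
  unfold dirDeriv
  exact DFunLike.congr_fun this v

lemma dirDeriv_const_mul {f : M → ℝ} {x : M} (c : ℝ) (hf : SmoothAt B f x) (v : TSp B x) :
    dirDeriv B (fun y => c * f y) x v = c * dirDeriv B f x v := by
  rw [dirDeriv_mul smoothAt_const hf]; simp

lemma dirDeriv_neg {f : M → ℝ} {x : M} (hf : SmoothAt B f x) (v : TSp B x) :
    dirDeriv B (fun y => -f y) x v = -dirDeriv B f x v := by
  have := dirDeriv_const_mul (-1) hf v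
  simpa using this

lemma dirDeriv_comp {B' : Type*} [NormedAddCommGroup B'] [NormedSpace ℝ B']
    {N : Type*} [TopologicalSpace N] [ChartedSpace B' N] {f : M → N} {g : N → ℝ} {x : M}
    (hg : MDifferentiableAt 𝓘(ℝ, B') 𝓘(ℝ, ℝ) g (f x))
    (hf : MDifferentiableAt 𝓘(ℝ, B) 𝓘(ℝ, B') f x) (v : TSp B x) :
    dirDeriv B (fun y => g (f y)) x v = dirDeriv B' g (f x) (dMap B B' f x v) :=
  mfderiv_comp_apply x hg hf v

end Derivative

/-! ### Smooth coefficients with respect to local frames. -/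

section Bundles

variable {B : Type*} [NormedAddCommGroup B] [NormedSpace ℝ B]
  {M : Type*} [TopologicalSpace M] [ChartedSpace B M]
  {F : Type*} [NormedAddCommGroup F] [NormedSpace ℝ F]
  {V : M → Type*} [TopologicalSpace (TotalSpace F V)]
  [∀ x, AddCommGroup (V x)] [∀ x, Module ℝ (V x)] [∀ x, TopologicalSpace (V x)]
  [FiberBundle F V]

variable (B F) in
/-- Smoothness at a point of a (rough) section of `V`. -/
abbrev SmoothSecAt (s : ∀ x, V x) (x : M) : Prop :=
  ContMDiffAt 𝓘(ℝ, B) (𝓘(ℝ, B).prod 𝓘(ℝ, F)) ∞ (fun x => (⟨x, s x⟩ : TotalSpace F V)) x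

lemma Sec.smoothSecAt [VectorBundle ℝ F V] (s : Sec B F V) (x : M) :
    SmoothSecAt B F (fun y => s y) x :=
  s.contMDiff x

lemma SmoothSecAt.congr {s t : ∀ x, V x} {x : M} (hs : SmoothSecAt B F s x)
    (h : ∀ᶠ y in 𝓝 x, t y = s y) : SmoothSecAt B F t x :=
  ContMDiffAt.congr_of_eventuallyEq hs (by filter_upwards [h] with y hy; rw [hy])

variable [VectorBundle ℝ F V]

lemma SmoothSecAt.smul {f : M → ℝ} {s : ∀ x, V x} {x : M} (hf : SmoothAt B f x)
    (hs : SmoothSecAt B F s x) : SmoothSecAt B F (fun y => f y • s y) x :=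
  ContMDiffAt.smul_section hf hs

lemma SmoothSecAt.add {s t : ∀ x, V x} {x : M} (hs : SmoothSecAt B F s x)
    (ht : SmoothSecAt B F t x) : SmoothSecAt B F (fun y => s y + t y) x :=
  ContMDiffAt.add_section hs ht

lemma SmoothSecAt.sum {ι : Type*} {s : Finset ι} {t : ι → ∀ x, V x} {x : M}
    (ht : ∀ i ∈ s, SmoothSecAt B F (t i) x) : SmoothSecAt B F (fun y => ∑ i ∈ s, t i y) x :=
  ContMDiffAt.sum_section ht

@[simp] lemma funSmul_apply (f : SmoothFun B M) (s : Sec B F V) (x : M) :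
    funSmul f s x = f x • s x := rfl

@[simp] lemma sec_add_apply (s t : Sec B F V) (x : M) : (s + t) x = s x + t x := rfl
@[simp] lemma sec_sub_apply (s t : Sec B F V) (x : M) : (s - t) x = s x - t x := rfl
@[simp] lemma sec_neg_apply (s : Sec B F V) (x : M) : (-s) x = -s x := rfl
@[simp] lemma sec_smul_apply (c : ℝ) (s : Sec B F V) (x : M) : (c • s) x = c • s x := rfl

@[simp] lemma sec_sum_apply {ι : Type*} (s : Finset ι) (t : ι → Sec B F V) (x : M) :
    (∑ i ∈ s, t i) x = ∑ i ∈ s, t i x := by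
  classical
  induction s using Finset.induction_on with
  | empty => simp
  | insert a s ha ih => simp [Finset.sum_insert ha, ih]

lemma finrank_fiber (x : M) : Module.finrank ℝ (V x) = Module.finrank ℝ F :=
  ((trivializationAt F V x).continuousLinearEquivAt ℝ x
    (FiberBundle.mem_baseSet_trivializationAt F V x)).toLinearEquiv.finrank_eq

variable (F) in
lemma finiteDimensional_fiber [FiniteDimensional ℝ F] (x : M) : FiniteDimensional ℝ (V x) :=
  ((trivializationAt F V x).continuousLinearEquivAt ℝ x
    (FiberBundle.mem_baseSet_trivializationAt F V x)).toLinearEquiv.symm.finiteDimensional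

variable (F) in
/-- The vector `a` read in the trivialization at `x₀`. -/
def trivSnd (x₀ : M) {x : M} (a : V x) : F := (trivializationAt F V x₀ ⟨x, a⟩).2

lemma SmoothSecAt.trivSnd {s : ∀ x, V x} {x : M} (hs : SmoothSecAt B F s x) :
    ContMDiffAt 𝓘(ℝ, B) 𝓘(ℝ, F) ∞ (fun y => trivSnd F x (s y)) x :=
  (Bundle.contMDiffAt_section x).1 hs

lemma trivSnd_eventually (x₀ : M) : ∀ᶠ x in 𝓝 x₀, ∃ L : V x ≃ₗ[ℝ] F, ∀ a, trivSnd F x₀ a = L a := by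
  filter_upwards [(trivializationAt F V x₀).open_baseSet.mem_nhds
    (FiberBundle.mem_baseSet_trivializationAt F V x₀)] with x hx
  exact ⟨((trivializationAt F V x₀).continuousLinearEquivAt ℝ x hx).toLinearEquiv, fun a => rfl⟩

variable {ι : Type*} [Fintype ι]

lemma eventually_linearIndependent [FiniteDimensional ℝ F] {e : ι → ∀ x, V x} {x : M}
    (he : ∀ i, SmoothSecAt B F (e i) x) (hli : LinearIndependent ℝ fun i => e i x) :
    ∀ᶠ y in 𝓝 x, LinearIndependent ℝ fun i => e i y := by
  have hx := (trivSnd_eventually (F := F) (V := V) x).self_of_nhds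
  obtain ⟨L, hL⟩ := hx
  have h1 : LinearIndependent ℝ (fun i => trivSnd F x (e i x)) := by
    have := hli.map' L.toLinearMap (by simp)
    simp only [hL]
    exact this
  have h2 : ContinuousAt (fun y => fun i => trivSnd F x (e i y)) x :=
    continuousAt_pi.2 fun i => (he i).trivSnd.continuousAt
  filter_upwards [h2.eventually h1.eventually, trivSnd_eventually (F := F) (V := V) x]
    with y hy ⟨L, hL⟩
  have : LinearIndependent ℝ (fun i => L (e i y)) := by simpa [hL] using hy
  exact LinearIndependent.of_comp L.toLinearMap this

/-- Coefficients with respect to linearly independent smooth sections are smooth. -/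
lemma smoothAt_coeff [FiniteDimensional ℝ F] {e : ι → ∀ x, V x} {x : M}
    (he : ∀ i, SmoothSecAt B F (e i) x) (hli : LinearIndependent ℝ fun i => e i x)
    {s : ∀ x, V x} (hs : SmoothSecAt B F s x) {f : ι → M → ℝ}
    (hf : ∀ᶠ y in 𝓝 x, s y = ∑ i, f i y • e i y) (i : ι) : SmoothAt B (f i) x := by
  classical
  obtain ⟨L, hL⟩ := (trivSnd_eventually (F := F) (V := V) x).self_of_nhds
  have h1 : LinearIndependent ℝ (fun i => trivSnd F x (e i x)) := by
    have := hli.map' L.toLinearMap (by simp)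
    simp only [hL]
    exact this
  obtain ⟨l, hl⟩ := (Fintype.linearCombination ℝ (fun i => trivSnd F x (e i x))).exists_leftInverse_of_injective
    (LinearMap.ker_eq_bot.2 (linearIndependent_iff_injective_fintypeLinearCombination.1 h1))
  let lc : F →L[ℝ] (ι → ℝ) := LinearMap.toContinuousLinearMap l
  -- The sections need not form a full frame, so the matrix is made square by a left inverse `l` of
  -- the combination map at `x`. Then `A x = 1`, so `A y` is invertible for y near `x`, and the
  -- coefficients of `s` are `A y` inverse applied to the image of `s y` under `l`.
  let A : M → ((ι → ℝ) →L[ℝ] (ι → ℝ)) := fun y =>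
    ∑ j, (ContinuousLinearMap.proj j : (ι → ℝ) →L[ℝ] ℝ).smulRight (lc (trivSnd F x (e j y)))
  have hA : ContMDiffAt 𝓘(ℝ, B) 𝓘(ℝ, (ι → ℝ) →L[ℝ] (ι → ℝ)) ∞ A x := by
    refine contMDiffAt_finsetSum fun j _ => ?_
    have h3 : ContMDiffAt 𝓘(ℝ, B) 𝓘(ℝ, ι → ℝ) ∞ (fun y => lc (trivSnd F x (e j y))) x :=
      lc.contMDiff.contMDiffAt.comp x (he j).trivSnd
    exact ((ContinuousLinearMap.smulRightL ℝ (ι → ℝ) (ι → ℝ)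
      (ContinuousLinearMap.proj j)).contMDiff.contMDiffAt).comp x h3
  have hAx : A x = 1 := by
    apply ContinuousLinearMap.ext
    intro c
    have := LinearMap.congr_fun hl c
    simp only [LinearMap.comp_apply, Fintype.linearCombination_apply, map_sum, map_smul,
      LinearMap.id_apply] at this
    simpa [A, lc] using this
  have hinv : ContMDiffAt 𝓘(ℝ, B) 𝓘(ℝ, (ι → ℝ) →L[ℝ] (ι → ℝ)) ∞ (fun y => Ring.inverse (A y)) x := by
    have h4 := contDiffAt_ringInverse (n := ∞) ℝ (1 : ((ι → ℝ) →L[ℝ] (ι → ℝ))ˣ)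
    rw [Units.val_one, ← hAx] at h4
    exact h4.contMDiffAt.comp x hA
  have hls : ContMDiffAt 𝓘(ℝ, B) 𝓘(ℝ, ι → ℝ) ∞ (fun y => lc (trivSnd F x (s y))) x :=
    lc.contMDiff.contMDiffAt.comp x hs.trivSnd
  have hunit : ∀ᶠ y in 𝓝 x, IsUnit (A y) := by
    have : {a : (ι → ℝ) →L[ℝ] (ι → ℝ) | IsUnit a} ∈ 𝓝 (A x) :=
      Units.isOpen.mem_nhds (by rw [hAx]; exact isUnit_one)
    exact hA.continuousAt.eventually this
  have hfin : ContMDiffAt 𝓘(ℝ, B) 𝓘(ℝ, ι → ℝ) ∞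
      (fun y => Ring.inverse (A y) (lc (trivSnd F x (s y)))) x := hinv.clm_apply hls
  have hfi : ContMDiffAt 𝓘(ℝ, B) 𝓘(ℝ, ℝ) ∞
      (fun y => (Ring.inverse (A y) (lc (trivSnd F x (s y)))) i) x :=
    (ContinuousLinearMap.proj (R := ℝ) (φ := fun _ : ι => ℝ) i).contMDiff.contMDiffAt.comp x hfin
  refine hfi.congr_of_eventuallyEq ?_
  filter_upwards [hunit, hf, trivSnd_eventually (F := F) (V := V) x] with y hy hsy ⟨L, hL⟩
  have h5 : lc (trivSnd F x (s y)) = A y (fun j => f j y) := by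
    rw [hsy, hL]
    simp [A, hL]
  have h6 : Ring.inverse (A y) * A y = 1 := Ring.inverse_mul_cancel _ hy
  have h7 : Ring.inverse (A y) (A y (fun j => f j y)) = fun j => f j y := by
    exact DFunLike.congr_fun h6 _
  rw [h5, h7]

/-- Near a point, every smooth section has smooth coefficients with respect to a family of smooth
sections which is a basis at the point. -/
lemma exists_coeff_rough [FiniteDimensional ℝ F] {e : ι → ∀ x, V x} {x : M}
    (he : ∀ᶠ y in 𝓝 x, ∀ i, SmoothSecAt B F (e i) y) (hli : LinearIndependent ℝ fun i => e i x)
    (hcard : Fintype.card ι = Module.finrank ℝ F) :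
    ∃ f : (∀ x, V x) → ι → M → ℝ, (∀ s, ∀ᶠ y in 𝓝 x, s y = ∑ i, f s i y • e i y) ∧
      ∀ s, (∀ᶠ y in 𝓝 x, SmoothSecAt B F s y) → ∀ i, ∀ᶠ y in 𝓝 x, SmoothAt B (f s i) y := by
  classical
  have hli' := eventually_linearIndependent he.self_of_nhds hli
  have hexp : ∀ᶠ y in 𝓝 x, ∀ a : V y, ∃ c : ι → ℝ, a = ∑ i, c i • e i y := by
    filter_upwards [hli'] with y hy a
    have : FiniteDimensional ℝ (V y) := finiteDimensional_fiber F y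
    have hsp := hy.span_eq_top_of_card_eq_finrank' (by rw [hcard, finrank_fiber (F := F)])
    have ha : a ∈ Submodule.span ℝ (range fun i => e i y) := by rw [hsp]; trivial
    obtain ⟨c, hc⟩ := (Submodule.mem_span_range_iff_exists_fun ℝ).1 ha
    exact ⟨c, hc.symm⟩
  -- Coefficients are chosen point by point, with the value 0 where no expansion exists. Their
  -- smoothness is not built in; it comes from `smoothAt_coeff` and uniqueness near `x`.
  choose f hf using fun (s : ∀ x, V x) (y : M) =>
    (show ∃ c : ι → ℝ, (∃ c : ι → ℝ, s y = ∑ i, c i • e i y) → s y = ∑ i, c i • e i y by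
      by_cases h : ∃ c : ι → ℝ, s y = ∑ i, c i • e i y
      · exact ⟨h.choose, fun _ => h.choose_spec⟩
      · exact ⟨0, fun h' => absurd h' h⟩)
  have hmain : ∀ s, ∀ᶠ y in 𝓝 x, s y = ∑ i, f s y i • e i y := fun s => by
    filter_upwards [hexp] with y hy
    exact hf s y (hy _)
  refine ⟨fun s i y => f s y i, hmain, fun s hs i => ?_⟩
  filter_upwards [hs, (hmain s).eventually_nhds, he, hli'] with y h1 h2 h3 h4
  exact smoothAt_coeff h3 h4 h1 h2 i

end Bundles

/-! ### Extending germs to global objects, and tensoriality. -/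

section Bump

variable {B : Type*} [NormedAddCommGroup B] [NormedSpace ℝ B] [FiniteDimensional ℝ B]
  {M : Type*} [TopologicalSpace M] [T2Space M] [ChartedSpace B M] [IsManifold 𝓘(ℝ, B) ∞ M]

lemma exists_bump {x : M} {U : Set M} (hU : U ∈ 𝓝 x) :
    ∃ ψ : SmoothFun B M, (∀ᶠ y in 𝓝 x, ψ y = 1) ∧ tsupport ψ ⊆ U := by
  obtain ⟨f, -, hf⟩ := (SmoothBumpFunction.nhds_basis_tsupport (I := 𝓘(ℝ, B)) x).mem_iff.1 hU
  exact ⟨⟨f, f.contMDiff⟩, f.eventuallyEq_one, hf⟩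

lemma exists_smoothFun_eventuallyEq {f : M → ℝ} {x : M} (hf : ∀ᶠ y in 𝓝 x, SmoothAt B f y) :
    ∃ g : SmoothFun B M, ∀ᶠ y in 𝓝 x, g y = f y := by
  obtain ⟨ψ, h1, h2⟩ := exists_bump (B := B) (x := x) hf
  refine ⟨⟨fun y => ψ y * f y, ?_⟩, ?_⟩
  · refine contMDiff_of_tsupport fun y hy => ?_
    have hy' : y ∈ tsupport ψ := closure_mono (by
      intro z hz
      exact left_ne_zero_of_mul hz) hy
    exact (ψ.smoothAt y).mul (h2 hy')
  · filter_upwards [h1] with y hy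
    change ψ y * f y = f y
    rw [hy, one_mul]

lemma smoothAt_dirDeriv {f : M → ℝ} {X : ∀ x : M, TSp B x} {x : M}
    (hf : ∀ᶠ y in 𝓝 x, SmoothAt B f y) (hX : SmoothSecAt B B X x) :
    SmoothAt B (fun y => dirDeriv B f y (X y)) x := by
  -- A globally smooth function with the same germ is used, so that its tangent map is smooth
  -- everywhere and can be composed with the section `X`.
  obtain ⟨g, hg⟩ := exists_smoothFun_eventuallyEq hf
  have h1 := (g.contMDiff.contMDiff_tangentMap (m := ∞) (by simp)).contMDiffAt.comp x hX
  have h2 := (contMDiff_snd_tangentBundle_modelSpace (n := ∞) ℝ 𝓘(ℝ, ℝ)).contMDiffAt.comp x h1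
  refine ContMDiffAt.congr_of_eventuallyEq h2 ?_
  filter_upwards [hg.eventually_nhds] with y hy
  exact (dirDeriv_congr hy _).symm

variable
  {F : Type*} [NormedAddCommGroup F] [NormedSpace ℝ F]
  {V : M → Type*} [TopologicalSpace (TotalSpace F V)]
  [∀ x, AddCommGroup (V x)] [∀ x, Module ℝ (V x)] [∀ x, TopologicalSpace (V x)]
  [FiberBundle F V] [VectorBundle ℝ F V]

lemma exists_sec_eventuallyEq {s : ∀ x, V x} {x : M} (hs : ∀ᶠ y in 𝓝 x, SmoothSecAt B F s y) :
    ∃ t : Sec B F V, ∀ᶠ y in 𝓝 x, t y = s y := by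
  obtain ⟨U, hU, hUo, hxU⟩ := eventually_nhds_iff.1 hs
  obtain ⟨ψ, h1, h2⟩ := exists_bump (B := B) (x := x) (hUo.mem_nhds hxU)
  refine ⟨⟨fun y => ψ y • s y, ContMDiffOn.smul_section_of_tsupport ψ.contMDiff.contMDiffOn hUo h2
    fun y hy => (hU y hy).contMDiffWithinAt⟩, ?_⟩
  filter_upwards [h1] with y hy
  change ψ y • s y = s y
  rw [hy, one_smul]

lemma exists_sec_apply_eq [ContMDiffVectorBundle ∞ F V 𝓘(ℝ, B)] {x : M} (a : V x) :
    ∃ s : Sec B F V, s x = a := by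
  obtain ⟨U, hU, hs⟩ := FiberBundle.exists_contMDiffOn_extend (k := ∞) 𝓘(ℝ, B) F a
  obtain ⟨t, ht⟩ := exists_sec_eventuallyEq (B := B) (F := F) (s := FiberBundle.extend F a) (x := x) (by
    filter_upwards [eventually_mem_nhds_iff.2 hU] with y hy
    exact (hs y (mem_of_mem_nhds hy)).contMDiffAt hy)
  exact ⟨t, by rw [ht.self_of_nhds]; simp⟩

/-- Near a point, every smooth section is a combination, with smooth coefficients, of smooth
sections which form a basis at the point. -/
lemma exists_coeff {ι : Type*} [Fintype ι] [FiniteDimensional ℝ F] (e : ι → Sec B F V) {x : M}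
    (hli : LinearIndependent ℝ fun i => e i x) (hcard : Fintype.card ι = Module.finrank ℝ F)
    (s : Sec B F V) : ∃ f : ι → SmoothFun B M, ∀ᶠ y in 𝓝 x, s y = ∑ i, f i y • e i y := by
  obtain ⟨f, h1, h2⟩ := exists_coeff_rough (B := B) (e := fun i y => e i y) (x := x)
    (Eventually.of_forall fun y i => (e i).smoothSecAt y) hli hcard
  choose g hg using fun i => exists_smoothFun_eventuallyEq (h2 (fun y => s y)
    (Eventually.of_forall fun y => s.smoothSecAt y) i)
  refine ⟨g, ?_⟩
  filter_upwards [h1 fun y => s y, eventually_all.2 hg] with y h1 h2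
  simp only [h2]
  exact h1

/-- There are smooth sections which form a basis at a given point. -/
lemma exists_basis_sec [FiniteDimensional ℝ F] [ContMDiffVectorBundle ∞ F V 𝓘(ℝ, B)] (x : M) :
    ∃ e : Fin (Module.finrank ℝ F) → Sec B F V, LinearIndependent ℝ fun i => e i x := by
  have : FiniteDimensional ℝ (V x) := finiteDimensional_fiber F x
  let b := Module.finBasisOfFinrankEq ℝ (V x) (finrank_fiber (F := F) x)
  choose e he using fun i => exists_sec_apply_eq (B := B) (F := F) (b i)
  refine ⟨e, ?_⟩
  simp only [he]
  exact b.linearIndependent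

variable [FiniteDimensional ℝ F] [ContMDiffVectorBundle ∞ F V 𝓘(ℝ, B)]

/-- An operation on smooth sections which is linear over the smooth functions at a point is given by
a linear map on the fibre. -/
lemma exists_linearMap_of_tensorial {A : Type*} [AddCommGroup A] [Module ℝ A] {x : M}
    (Φ : Sec B F V → A) (hadd : ∀ s t, Φ (s + t) = Φ s + Φ t)
    (hsmul : ∀ (f : SmoothFun B M) s, Φ (funSmul f s) = f x • Φ s) :
    ∃ L : V x →ₗ[ℝ] A, ∀ s, L (s x) = Φ s := by
  have hzero : Φ 0 = 0 := by simpa using hadd 0 0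
  have hsum : ∀ {κ : Type _} (S : Finset κ) (t : κ → Sec B F V), Φ (∑ i ∈ S, t i) = ∑ i ∈ S, Φ (t i) := by
    intro κ S t
    classical
    induction S using Finset.induction_on with
    | empty => simpa using hzero
    | insert a S ha ih => rw [Finset.sum_insert ha, Finset.sum_insert ha, hadd, ih]
  -- Linearity over functions already forces locality: a bump function supported where the two
  -- sections agree makes them equal globally without changing their images under `Φ`.
  have hloc : ∀ s t : Sec B F V, (∀ᶠ y in 𝓝 x, s y = t y) → Φ s = Φ t := by
    intro s t h
    obtain ⟨ψ, h1, h2⟩ := exists_bump (B := B) h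
    have : funSmul ψ s = funSmul ψ t := by
      ext y
      by_cases hy : y ∈ tsupport ψ
      · rw [funSmul_apply, funSmul_apply, h2 hy]
      · simp [image_eq_zero_of_notMem_tsupport hy]
    have h3 := congrArg Φ this
    rwa [hsmul, hsmul, h1.self_of_nhds, one_smul, one_smul] at h3
  obtain ⟨e, he⟩ := exists_basis_sec (B := B) (F := F) (V := V) x
  have hval : ∀ s : Sec B F V, ∃ c : Fin (Module.finrank ℝ F) → ℝ, s x = ∑ i, c i • e i x ∧ Φ s = ∑ i, c i • Φ (e i) := by
    intro s
    obtain ⟨f, hf⟩ := exists_coeff e he (by simp) s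
    refine ⟨fun i => f i x, hf.self_of_nhds, ?_⟩
    rw [hloc s (∑ i, funSmul (f i) (e i)) (by filter_upwards [hf] with y hy; simpa using hy), hsum]
    simp [hsmul]
  have hcongr : ∀ s t : Sec B F V, s x = t x → Φ s = Φ t := by
    intro s t hst
    obtain ⟨c, hc, hc'⟩ := hval s
    obtain ⟨d, hd, hd'⟩ := hval t
    have : c = d := by
      have h0 : ∑ i, (c i - d i) • e i x = 0 := by
        simp only [sub_smul, Finset.sum_sub_distrib, ← hc, ← hd, hst, sub_self]
      funext i
      exact sub_eq_zero.1 (Fintype.linearIndependent_iff.1 he _ h0 i)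
    rw [hc', hd', this]
  choose ext hext using fun a : V x => exists_sec_apply_eq (B := B) (F := F) a
  refine ⟨{ toFun := fun a => Φ (ext a), map_add' := fun a b => ?_, map_smul' := fun c a => ?_ },
    fun s => hcongr _ _ (hext _)⟩
  · rw [← hadd]; exact hcongr _ _ (by simp [hext])
  · have := hsmul ⟨fun _ => c, contMDiff_const⟩ (ext a)
    rw [RingHom.id_apply]
    refine Eq.trans (hcongr _ _ ?_) this
    rw [hext]
    change c • a = c • ext a x
    rw [hext]

end Bump

/-! ### Consequences of the Courant algebroid axioms. -/

section Calculus

variable {B : Type*} [NormedAddCommGroup B] [NormedSpace ℝ B] [FiniteDimensional ℝ B]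
  {M : Type*} [TopologicalSpace M] [T2Space M] [ChartedSpace B M] [IsManifold 𝓘(ℝ, B) ∞ M]
  {F : Type*} [NormedAddCommGroup F] [NormedSpace ℝ F] [FiniteDimensional ℝ F]
  {V : M → Type*} [TopologicalSpace (TotalSpace F V)]
  [∀ x, AddCommGroup (V x)] [∀ x, Module ℝ (V x)] [∀ x, TopologicalSpace (V x)]
  [FiberBundle F V] [VectorBundle ℝ F V] [ContMDiffVectorBundle ∞ F V 𝓘(ℝ, B)]

lemma smoothFun_sum_apply {ι : Type*} (S : Finset ι) (g : ι → SmoothFun B M) (x : M) :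
    (∑ i ∈ S, g i) x = ∑ i ∈ S, g i x := by
  classical
  induction S using Finset.induction_on with
  | empty => rfl
  | insert a S ha ih => rw [Finset.sum_insert ha, Finset.sum_insert ha, ← ih]; rfl

lemma funSmul_congr {f : SmoothFun B M} {s t : Sec B F V}
    (h : ∀ y ∈ tsupport f, s y = t y) : funSmul f s = funSmul f t := by
  ext y
  by_cases hy : y ∈ tsupport f
  · rw [funSmul_apply, funSmul_apply, h y hy]
  · simp [image_eq_zero_of_notMem_tsupport hy]

namespace CourantAlgebroid

variable (C : CourantAlgebroid B F V)

/-- The pairing of two sections, as a smooth function. -/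
def pairFun (s t : Sec B F V) : SmoothFun B M :=
  ⟨fun x => C.pairing x (s x) (t x), C.pairing_smooth s t⟩

@[simp] lemma pairFun_apply (s t : Sec B F V) (x : M) :
    C.pairFun s t x = C.pairing x (s x) (t x) := rfl

/-- The derivative of a smooth function along the anchor of a section. -/
def lieFun (e : Sec B F V) (f : SmoothFun B M) : SmoothFun B M :=
  ⟨fun x => dirDeriv B f x (C.anchor x (e x)), fun x => smoothAt_dirDeriv
    (Eventually.of_forall fun y => f.smoothAt y) ((C.anchor_smooth e x (mem_univ x)).contMDiffAt univ_mem)⟩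

@[simp] lemma lieFun_apply (e : Sec B F V) (f : SmoothFun B M) (x : M) :
    C.lieFun e f x = dirDeriv B f x (C.anchor x (e x)) := rfl

lemma smoothAt_pairing (s t : Sec B F V) (x : M) :
    SmoothAt B (fun y => C.pairing y (s y) (t y)) x := C.pairing_smooth s t x

lemma pairing_ext {x : M} {a b : V x} (h : ∀ c, C.pairing x a c = C.pairing x b c) : a = b :=
  (C.pairing_nondegenerate x).1 (LinearMap.ext h)

lemma pairing_ext_sec {x : M} {a b : V x}
    (h : ∀ c : Sec B F V, C.pairing x a (c x) = C.pairing x b (c x)) : a = b :=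
  C.pairing_ext fun c => by
    obtain ⟨s, rfl⟩ := exists_sec_apply_eq (B := B) (F := F) c
    exact h s

@[simp] lemma pairing_rhoStar {x : M} (α : TSp B x →ₗ[ℝ] ℝ) (a : V x) :
    C.pairing x (C.rhoStar x α) a = α (C.anchor x a) := by
  have := (LinearEquiv.ofBijective (C.pairing x) (C.pairing_nondegenerate x)).apply_symm_apply
    (α ∘ₗ C.anchor x)
  exact LinearMap.congr_fun this a

lemma bracket_add_left (a b c : Sec B F V) : C.bracket (a + b) c = C.bracket a c + C.bracket b c := by
  simp

/-- The Leibniz rule is not among the axioms. It follows from invariance of the pairing, because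
nondegeneracy allows both sides to be tested against an arbitrary section. -/
lemma bracket_funSmul_right (a b : Sec B F V) (f : SmoothFun B M) :
    C.bracket a (funSmul f b) = funSmul f (C.bracket a b) + funSmul (C.lieFun a f) b := by
  ext x
  refine C.pairing_ext_sec fun c => ?_
  have h1 := C.invariance a (funSmul f b) c x
  have h2 := C.invariance a b c x
  have h3 := dirDeriv_mul (f.smoothAt x) (C.smoothAt_pairing b c x) (C.anchor x (a x))
  simp only [funSmul_apply, map_smul, LinearMap.smul_apply, smul_eq_mul] at h1
  simp only [sec_add_apply, funSmul_apply, map_add, LinearMap.add_apply, map_smul,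
    LinearMap.smul_apply, smul_eq_mul, lieFun_apply]
  rw [h2] at h3
  linarith

/-- Polarisation of the axiom `symmetric_part`. -/
lemma pairing_bracket_swap (a b : Sec B F V) (x : M) (c : V x) :
    C.pairing x (C.bracket a b x) c + C.pairing x (C.bracket b a x) c =
      dirDeriv B (fun y => C.pairing y (a y) (b y)) x (C.anchor x c) := by
  obtain ⟨s, rfl⟩ := exists_sec_apply_eq (B := B) (F := F) c
  have h1 := C.symmetric_part a s x
  have h2 := C.symmetric_part b s x
  have h3 := C.symmetric_part (a + b) s x
  have h4 : (fun y => C.pairing y ((a + b) y) ((a + b) y)) = fun y =>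
      (C.pairing y (a y) (a y) + C.pairing y (b y) (b y)) + 2 * C.pairing y (a y) (b y) := by
    funext y
    simp only [sec_add_apply, map_add, LinearMap.add_apply]
    rw [C.pairing_symm y (b y) (a y)]
    ring
  rw [h4, dirDeriv_add ((C.smoothAt_pairing a a x).add (C.smoothAt_pairing b b x))
    (smoothAt_const.mul (C.smoothAt_pairing a b x)),
    dirDeriv_add (C.smoothAt_pairing a a x) (C.smoothAt_pairing b b x),
    dirDeriv_const_mul 2 (C.smoothAt_pairing a b x)] at h3
  simp only [map_add, LinearMap.add_apply, sec_add_apply] at h3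
  linarith

lemma bracket_swap (a b : Sec B F V) (x : M) :
    C.bracket b a x =
      C.rhoStar x (dForm B (fun y => C.pairing y (a y) (b y)) x) - C.bracket a b x := by
  refine C.pairing_ext fun c => ?_
  have := C.pairing_bracket_swap a b x c
  simp only [map_sub, LinearMap.sub_apply, pairing_rhoStar, dForm_apply]
  linarith

/-- The symmetric part of the bracket is the image of d⟨a, b⟩ under `rhoStar`, and this vanishes for
a pair with zero pairing. The two uses are sections of V⁺ against V⁻ and sections of K against K^⊥.
-/
lemma bracket_swap_of_orthogonal {a b : Sec B F V}
    (h : ∀ y, C.pairing y (a y) (b y) = 0) : C.bracket b a = -C.bracket a b := by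
  ext x
  refine C.pairing_ext fun c => ?_
  have := C.pairing_bracket_swap a b x c
  simp only [h, dirDeriv_const] at this
  simp only [sec_neg_apply, map_neg, LinearMap.neg_apply]
  linarith

lemma pairing_bracket_funSmul_left (a b : Sec B F V) (f : SmoothFun B M) (x : M) (c : V x) :
    C.pairing x (C.bracket (funSmul f a) b x) c = f x * C.pairing x (C.bracket a b x) c
      - dirDeriv B f x (C.anchor x (b x)) * C.pairing x (a x) c
      + C.pairing x (a x) (b x) * dirDeriv B f x (C.anchor x c) := by
  have h1 := C.pairing_bracket_swap (funSmul f a) b x c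
  have h2 := C.pairing_bracket_swap a b x c
  have h3 := dirDeriv_mul (f.smoothAt x) (C.smoothAt_pairing a b x) (C.anchor x c)
  rw [C.bracket_funSmul_right] at h1
  simp only [sec_add_apply, funSmul_apply, map_add, LinearMap.add_apply, map_smul,
    LinearMap.smul_apply, smul_eq_mul, lieFun_apply] at h1
  rw [h3] at h1
  linear_combination h1 - f x * h2

lemma bracket_funSmul_left_of_orthogonal {a b : Sec B F V} (f : SmoothFun B M)
    (h : ∀ y, C.pairing y (a y) (b y) = 0) :
    C.bracket (funSmul f a) b = funSmul f (C.bracket a b) - funSmul (C.lieFun b f) a := by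
  ext x
  refine C.pairing_ext fun c => ?_
  rw [C.pairing_bracket_funSmul_left, h]
  simp

/-- Multiplication by a bump function makes the two arguments equal globally; the derivative terms
of the Leibniz rule cancel because the arguments agree at the point. -/
lemma bracket_congr_right (a : Sec B F V) {b b' : Sec B F V} {x : M}
    (h : ∀ᶠ y in 𝓝 x, b y = b' y) : C.bracket a b x = C.bracket a b' x := by
  obtain ⟨ψ, h1, h2⟩ := exists_bump (B := B) h
  have h3 := congrArg (fun s => C.bracket a s x) (funSmul_congr h2)
  simp only [bracket_funSmul_right, sec_add_apply, funSmul_apply, h1.self_of_nhds, one_smul,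
    lieFun_apply, h.self_of_nhds] at h3
  exact add_right_cancel h3

lemma bracket_congr_left {a a' : Sec B F V} (b : Sec B F V) {x : M}
    (h : ∀ᶠ y in 𝓝 x, a y = a' y) : C.bracket a b x = C.bracket a' b x := by
  rw [C.bracket_swap b a, C.bracket_swap b a', C.bracket_congr_right b h]
  congr 2
  ext v
  simp only [dForm_apply]
  exact dirDeriv_congr (by filter_upwards [h] with y hy; rw [hy]) v

lemma bracket_congr {a a' b b' : Sec B F V} {x : M} (ha : ∀ᶠ y in 𝓝 x, a y = a' y)
    (hb : ∀ᶠ y in 𝓝 x, b y = b' y) : C.bracket a b x = C.bracket a' b' x :=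
  (C.bracket_congr_left b ha).trans (C.bracket_congr_right a' hb)

/-- A point where the fibre is trivial, or there is a section which does not vanish. -/
lemma subsingleton_or_exists_sec (x : M) : Subsingleton (V x) ∨ ∃ c : Sec B F V, c x ≠ 0 := by
  by_cases h : Subsingleton (V x)
  · exact Or.inl h
  · rw [not_subsingleton_iff_nontrivial] at h
    obtain ⟨a, ha⟩ := exists_ne (0 : V x)
    obtain ⟨s, rfl⟩ := exists_sec_apply_eq (B := B) (F := F) a
    exact Or.inr ⟨s, ha⟩

/-- The anchor maps brackets to commutators of vector fields. -/
lemma dirDeriv_anchor_bracket (a b : Sec B F V) (f : SmoothFun B M) (x : M) :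
    dirDeriv B f x (C.anchor x (C.bracket a b x)) =
      dirDeriv B (C.lieFun b f) x (C.anchor x (a x)) -
        dirDeriv B (C.lieFun a f) x (C.anchor x (b x)) := by
  rcases subsingleton_or_exists_sec (B := B) (F := F) (V := V) x with h | ⟨c, hc⟩
  · rw [Subsingleton.elim (C.bracket a b x) 0, Subsingleton.elim (a x) 0,
      Subsingleton.elim (b x) 0]
    simp
  -- The Jacobi identity is applied to f·c and compared with f times the identity for c. What is
  -- left is a multiple of `c`, and `c` does not vanish at the point.
  · have h1 := congrArg (fun s => s x) (C.jacobi a b (funSmul f c))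
    have h2 := congrArg (fun s => s x) (C.jacobi a b c)
    simp only [bracket_funSmul_right, map_add, sec_add_apply, funSmul_apply, lieFun_apply] at h1 h2
    rw [h2] at h1
    have h3 : (dirDeriv B (C.lieFun b f) x (C.anchor x (a x)) -
        dirDeriv B (C.lieFun a f) x (C.anchor x (b x)) -
        dirDeriv B f x (C.anchor x (C.bracket a b x))) • c x = 0 := by
      rw [← sub_eq_zero] at h1
      rw [← h1]
      module
    have h4 := (smul_eq_zero.1 h3).resolve_right hc
    linarith

/-- `⟨𝒟 f, 𝒟 g⟩ = 0`. -/
lemma dirDeriv_anchor_rhoStar (f h : SmoothFun B M) (x : M) :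
    dirDeriv B h x (C.anchor x (C.rhoStar x (dForm B f x))) = 0 := by
  let P : (TSp B x →ₗ[ℝ] ℝ) → ℝ := fun α => dirDeriv B h x (C.anchor x (C.rhoStar x α))
  have hradd : ∀ α β, C.rhoStar x (α + β) = C.rhoStar x α + C.rhoStar x β := fun α β =>
    C.pairing_ext fun c => by simp
  have hrsmul : ∀ (r : ℝ) α, C.rhoStar x (r • α) = r • C.rhoStar x α := fun r α =>
    C.pairing_ext fun c => by simp
  have hPadd : ∀ α β, P (α + β) = P α + P β := fun α β => by
    simp only [P, hradd, map_add, dirDeriv_add_vec]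
  have hPsmul : ∀ (r : ℝ) α, P (r • α) = r * P α := fun r α => by
    simp only [P, hrsmul, map_smul, dirDeriv_smul_vec]
  -- On functions of the form ⟨a, b⟩: the anchor turns brackets into commutators, so it kills the
  -- symmetric part of the bracket, and this part is the image of d⟨a, b⟩ under `rhoStar`.
  have hbr : ∀ a b : Sec B F V, P (dForm B (fun y => C.pairing y (a y) (b y)) x) = 0 := by
    intro a b
    have h1 := C.dirDeriv_anchor_bracket a b h x
    have h2 := C.dirDeriv_anchor_bracket b a h x
    rw [C.bracket_swap a b, map_sub, dirDeriv_sub_vec] at h2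
    simp only [P]
    linarith
  rcases subsingleton_or_exists_sec (B := B) (F := F) (V := V) x with hs | ⟨c, hc⟩
  · rw [Subsingleton.elim (C.rhoStar x _) 0]; simp
  · have : ∃ b : Sec B F V, C.pairing x (c x) (b x) ≠ 0 := by
      by_contra! hcon
      exact hc (C.pairing_ext_sec fun b => by simpa using hcon b)
    obtain ⟨b, hb⟩ := this
    -- For general `f`, the function ⟨f c, b⟩ has differential f d⟨c, b⟩ + ⟨c, b⟩ df. The first term
    -- is already known to be killed, and ⟨c, b⟩ is nonzero at the point.
    have h1 := hbr (funSmul f c) b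
    have h2 : dForm B (fun y => C.pairing y (funSmul f c y) (b y)) x =
        f x • dForm B (fun y => C.pairing y (c y) (b y)) x + C.pairing x (c x) (b x) • dForm B f x := by
      ext v
      simp only [funSmul_apply, map_smul, LinearMap.smul_apply, smul_eq_mul, dForm_apply,
        LinearMap.add_apply]
      exact dirDeriv_mul (f.smoothAt x) (C.smoothAt_pairing c b x) v
    rw [h2, hPadd, hPsmul, hPsmul, hbr, mul_zero, zero_add] at h1
    exact (mul_eq_zero.1 h1).resolve_left hb

end CourantAlgebroid

namespace Divergence

variable {C : CourantAlgebroid B F V} (dv : Divergence C)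

lemma map_funSmul (f : SmoothFun B M) (e : Sec B F V) :
    dv.toFun (funSmul f e) = f * dv.toFun e + C.lieFun e f := by
  ext x; exact dv.leibniz f e x

lemma congr {e e' : Sec B F V} {x : M} (h : ∀ᶠ y in 𝓝 x, e y = e' y) :
    dv.toFun e x = dv.toFun e' x := by
  obtain ⟨ψ, h1, h2⟩ := exists_bump (B := B) h
  have h3 := congrArg (fun s => dv.toFun s x) (funSmul_congr h2)
  simp only [dv.leibniz, h1.self_of_nhds, one_mul, h.self_of_nhds] at h3
  linarith

/-- The value of the divergence on a combination of sections with smooth coefficients. -/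
lemma apply_of_eq_sum {ι : Type*} [Fintype ι] {f : ι → SmoothFun B M} {e : ι → Sec B F V}
    {s : Sec B F V} {x : M} (h : ∀ᶠ y in 𝓝 x, s y = ∑ i, f i y • e i y) :
    dv.toFun s x = ∑ i, (f i x * dv.toFun (e i) x + dirDeriv B (f i) x (C.anchor x (e i x))) := by
  rw [dv.congr (e' := ∑ i, funSmul (f i) (e i)) (by filter_upwards [h] with y hy; simpa using hy)]
  rw [map_sum]
  rw [smoothFun_sum_apply]
  exact Finset.sum_congr rfl fun i _ => dv.leibniz _ _ _

@[ext] lemma ext_toFun {d d' : Divergence C} (h : ∀ e x, d.toFun e x = d'.toFun e x) : d = d' := by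
  cases d; cases d'
  congr
  ext e x
  exact h e x

end Divergence

namespace GenMetric

variable {C : CourantAlgebroid B F V} (τ : GenMetric C)

lemma ext_toFun {τ τ' : GenMetric C} (h : ∀ x a, τ.toFun x a = τ'.toFun x a) : τ = τ' := by
  cases τ; cases τ'
  congr
  funext x
  exact LinearMap.ext (h x)

@[simp] lemma map_apply (s : Sec B F V) (x : M) : τ.map s x = τ.toFun x (s x) := rfl

@[simp] lemma plus_apply (s : Sec B F V) (x : M) :
    τ.plus s x = (1 / 2 : ℝ) • (s x + τ.toFun x (s x)) := rfl

@[simp] lemma minus_apply (s : Sec B F V) (x : M) :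
    τ.minus s x = (1 / 2 : ℝ) • (s x - τ.toFun x (s x)) := rfl

lemma memPlus_half {x : M} (a : V x) : τ.MemPlus ((1 / 2 : ℝ) • (a + τ.toFun x a)) := by
  simp [MemPlus, τ.involutive, add_comm]

lemma memMinus_half {x : M} (a : V x) : τ.MemMinus ((1 / 2 : ℝ) • (a - τ.toFun x a)) := by
  simp only [MemMinus, map_smul, map_sub, τ.involutive]
  module

lemma memPlus_plus (s : Sec B F V) (x : M) : τ.MemPlus (τ.plus s x) := τ.memPlus_half _

lemma memMinus_minus (s : Sec B F V) (x : M) : τ.MemMinus (τ.minus s x) := τ.memMinus_half _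

lemma plus_of_memPlus {s : Sec B F V} (h : ∀ x, τ.MemPlus (s x)) : τ.plus s = s := by
  ext x
  rw [plus_apply, h x]
  module

lemma plus_of_memMinus {s : Sec B F V} (h : ∀ x, τ.MemMinus (s x)) : τ.plus s = 0 := by
  ext x
  rw [plus_apply, h x]
  simp

lemma minus_of_memMinus {s : Sec B F V} (h : ∀ x, τ.MemMinus (s x)) : τ.minus s = s := by
  ext x
  rw [minus_apply, h x]
  module

lemma minus_of_memPlus {s : Sec B F V} (h : ∀ x, τ.MemPlus (s x)) : τ.minus s = 0 := by
  ext x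
  rw [minus_apply, h x]
  simp

lemma plus_add (s t : Sec B F V) : τ.plus (s + t) = τ.plus s + τ.plus t := by
  ext x; simp only [plus_apply, sec_add_apply, map_add]; module

lemma minus_add (s t : Sec B F V) : τ.minus (s + t) = τ.minus s + τ.minus t := by
  ext x; simp only [minus_apply, sec_add_apply, map_add]; module

lemma plus_sub (s t : Sec B F V) : τ.plus (s - t) = τ.plus s - τ.plus t := by
  ext x; simp only [plus_apply, sec_sub_apply, map_sub]; module

lemma minus_sub (s t : Sec B F V) : τ.minus (s - t) = τ.minus s - τ.minus t := by
  ext x; simp only [minus_apply, sec_sub_apply, map_sub]; module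

lemma plus_funSmul (f : SmoothFun B M) (s : Sec B F V) :
    τ.plus (funSmul f s) = funSmul f (τ.plus s) := by
  ext x; simp only [plus_apply, funSmul_apply, map_smul]; module

lemma minus_funSmul (f : SmoothFun B M) (s : Sec B F V) :
    τ.minus (funSmul f s) = funSmul f (τ.minus s) := by
  ext x; simp only [minus_apply, funSmul_apply, map_smul]; module

lemma plus_add_minus (s : Sec B F V) : τ.plus s + τ.minus s = s := by
  ext x; simp only [sec_add_apply, plus_apply, minus_apply]; module

lemma pairing_eq_zero {x : M} {a b : V x} (ha : τ.MemPlus a) (hb : τ.MemMinus b) :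
    C.pairing x a b = 0 := by
  have h := τ.symm x a b
  rw [ha, hb, map_neg, C.pairing_symm x b a] at h
  linarith

end GenMetric

end Calculus

/-! ### Index identities behind frame independence of the scalar curvature. -/

section FrameAlgebra

lemma sum_rotate {p : ℕ} (g : Fin p → Fin p → Fin p → ℝ) :
    ∑ a, ∑ b, ∑ c, g a b c = ∑ a, ∑ b, ∑ c, g b c a := by
  symm
  rw [Finset.sum_comm]
  refine Finset.sum_congr rfl fun b _ => ?_
  rw [Finset.sum_comm]

/-- The algebraic identity behind the frame independence of the generalised scalar curvature. -/
lemma frame_change_identity {p q : ℕ} (c D : Fin p → Fin p → Fin p → ℝ)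
    (hc : ∀ i j k, c i j k = c k i j) (hD : ∀ i j k, D i j k = -D i k j)
    (cf : Fin p → Fin p → Fin q → ℝ) (Df : Fin q → Fin p → Fin p → ℝ)
    (DD : Fin p → Fin p → Fin p → Fin p → ℝ) (d : Fin p → ℝ) (Dd : Fin p → ℝ)
    (h3 : ∀ i j, DD i j i j + DD i j j i + ∑ a, (D j a j * D i a i + D i a j * D j a i) = 0)
    (h4 : ∀ i j, DD i j i j - DD j i i j = ∑ k, c i j k * D k i j - ∑ k, cf i j k * Df k i j)
    (h6 : ∀ i j, ∑ k, D k i j ^ 2 = ∑ k, Df k i j ^ 2) :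
    -4 * ∑ a, (Dd a + ∑ b, D a a b * d b + ∑ b, DD a b a b) - 2 * ∑ a, (d a + ∑ b, D b a b) ^ 2
      + (1 / 3 : ℝ) * ∑ a, ∑ b, ∑ k, (c a b k + D a b k - D b a k + D k a b) ^ 2
      - ∑ a, ∑ b, ∑ k, (cf a b k + Df k a b) ^ 2 =
    -4 * ∑ a, Dd a - 2 * ∑ a, d a ^ 2 + (1 / 3 : ℝ) * ∑ a, ∑ b, ∑ k, c a b k ^ 2
      - ∑ a, ∑ b, ∑ k, cf a b k ^ 2 := by
  have e1 : ∑ a, ∑ b, D a a b * d b = -∑ a, d a * ∑ b, D b a b := by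
    rw [Finset.sum_comm, ← Finset.sum_neg_distrib]
    refine Finset.sum_congr rfl fun b _ => ?_
    rw [Finset.mul_sum, ← Finset.sum_neg_distrib]
    exact Finset.sum_congr rfl fun a _ => by rw [hD a a b]; ring
  have e2 : ∑ a, (d a + ∑ b, D b a b) ^ 2 =
      ∑ a, d a ^ 2 + 2 * ∑ a, d a * ∑ b, D b a b + ∑ a, (∑ b, D b a b) ^ 2 := by
    rw [Finset.mul_sum, ← Finset.sum_add_distrib, ← Finset.sum_add_distrib]
    exact Finset.sum_congr rfl fun a _ => by ring
  -- The contracted first-order terms from the orthogonality relation are the square of the extra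
  -- term in the divergence.
  have hsq : ∑ i, ∑ j, ∑ a, D j a j * D i a i = ∑ a, (∑ b, D b a b) ^ 2 := by
    simp only [sq, Finset.sum_mul_sum]
    rw [sum_rotate]
    refine Finset.sum_congr rfl fun a _ => ?_
    rw [Finset.sum_comm]
  have hQ : ∑ i, ∑ j, ∑ a, D i a j * D j a i = -∑ i, ∑ j, ∑ k, D i j k * D j k i := by
    rw [← Finset.sum_neg_distrib]
    refine Finset.sum_congr rfl fun i _ => ?_
    rw [← Finset.sum_neg_distrib]
    refine Finset.sum_congr rfl fun j _ => ?_
    rw [← Finset.sum_neg_distrib]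
    refine Finset.sum_congr rfl fun k _ => ?_
    rw [hD i k j]; ring
  have hZ' : ∑ i, ∑ j, DD i j j i = ∑ i, ∑ j, DD j i i j := Finset.sum_comm
  have e3 : ∑ i, ∑ j, DD i j i j + ∑ i, ∑ j, DD i j j i + (∑ a, (∑ b, D b a b) ^ 2
      - ∑ i, ∑ j, ∑ k, D i j k * D j k i) = 0 := by
    rw [← hsq, sub_eq_add_neg, ← hQ]
    simp only [← Finset.sum_add_distrib]
    refine Finset.sum_eq_zero fun i _ => Finset.sum_eq_zero fun j _ => ?_
    exact h3 i j
  have hN : ∑ i, ∑ j, ∑ k, c i j k * D k i j = ∑ i, ∑ j, ∑ k, c i j k * D i j k := by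
    rw [sum_rotate fun i j k => c i j k * D i j k, sum_rotate fun i j k => c j k i * D j k i]
    refine Finset.sum_congr rfl fun i _ => Finset.sum_congr rfl fun j _ =>
      Finset.sum_congr rfl fun k _ => ?_
    rw [hc i j k]
  have e4 : ∑ i, ∑ j, DD i j i j - ∑ i, ∑ j, DD i j j i =
      ∑ i, ∑ j, ∑ k, c i j k * D i j k - ∑ i, ∑ j, ∑ k, cf i j k * Df k i j := by
    rw [hZ', ← hN]
    simp only [← Finset.sum_sub_distrib]
    refine Finset.sum_congr rfl fun i _ => Finset.sum_congr rfl fun j _ => ?_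
    rw [h4]
  have e6 : ∑ i, ∑ j, ∑ k, D i j k ^ 2 = ∑ i, ∑ j, ∑ k, Df k i j ^ 2 := by
    rw [sum_rotate, sum_rotate]
    exact Finset.sum_congr rfl fun i _ => Finset.sum_congr rfl fun j _ => h6 i j
  -- In the square of the cyclic sum the three cross terms with `c` coincide, and so do the three
  -- diagonal terms and the three mixed terms. The weight 1/3 therefore reduces them to the same
  -- size as the terms in `cf`.
  have e5 : ∑ a, ∑ b, ∑ k, (c a b k + D a b k - D b a k + D k a b) ^ 2 =
      ∑ i, ∑ j, ∑ k, c i j k ^ 2 + 6 * ∑ i, ∑ j, ∑ k, c i j k * D i j k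
        + 3 * ∑ i, ∑ j, ∑ k, D i j k ^ 2 + 6 * ∑ i, ∑ j, ∑ k, D i j k * D j k i := by
    have r1 : ∑ i, ∑ j, ∑ k, c i j k * D j k i = ∑ i, ∑ j, ∑ k, c i j k * D i j k := by
      rw [sum_rotate fun i j k => c i j k * D i j k]
      refine Finset.sum_congr rfl fun i _ => Finset.sum_congr rfl fun j _ =>
        Finset.sum_congr rfl fun k _ => ?_
      rw [hc j k i]
    have r2 : ∑ i, ∑ j, ∑ k, D j k i ^ 2 = ∑ i, ∑ j, ∑ k, D i j k ^ 2 :=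
      (sum_rotate fun i j k => D i j k ^ 2).symm
    have r3 : ∑ i, ∑ j, ∑ k, D k i j ^ 2 = ∑ i, ∑ j, ∑ k, D i j k ^ 2 := sum_rotate _
    have r4 : ∑ i, ∑ j, ∑ k, D j k i * D k i j = ∑ i, ∑ j, ∑ k, D i j k * D j k i :=
      (sum_rotate fun i j k => D i j k * D j k i).symm
    have r5 : ∑ i, ∑ j, ∑ k, D k i j * D i j k = ∑ i, ∑ j, ∑ k, D i j k * D j k i := sum_rotate _
    have r0 : ∑ a, ∑ b, ∑ k, (c a b k + D a b k - D b a k + D k a b) ^ 2 =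
        ∑ i, ∑ j, ∑ k, c i j k ^ 2 + 2 * ∑ i, ∑ j, ∑ k, c i j k * D i j k
        + 2 * ∑ i, ∑ j, ∑ k, c i j k * D j k i + 2 * ∑ i, ∑ j, ∑ k, c i j k * D k i j
        + ∑ i, ∑ j, ∑ k, D i j k ^ 2 + ∑ i, ∑ j, ∑ k, D j k i ^ 2 + ∑ i, ∑ j, ∑ k, D k i j ^ 2
        + 2 * ∑ i, ∑ j, ∑ k, D i j k * D j k i + 2 * ∑ i, ∑ j, ∑ k, D j k i * D k i j
        + 2 * ∑ i, ∑ j, ∑ k, D k i j * D i j k := by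
      simp only [Finset.mul_sum, ← Finset.sum_add_distrib]
      refine Finset.sum_congr rfl fun i _ => Finset.sum_congr rfl fun j _ =>
        Finset.sum_congr rfl fun k _ => ?_
      rw [hD j i k]; ring
    rw [r0, r1, r2, r3, r4, r5, hN]
    ring
  have e7 : ∑ a, ∑ b, ∑ k, (cf a b k + Df k a b) ^ 2 = ∑ a, ∑ b, ∑ k, cf a b k ^ 2
      + 2 * ∑ i, ∑ j, ∑ k, cf i j k * Df k i j + ∑ i, ∑ j, ∑ k, Df k i j ^ 2 := by
    simp only [Finset.mul_sum, ← Finset.sum_add_distrib]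
    refine Finset.sum_congr rfl fun i _ => Finset.sum_congr rfl fun j _ =>
      Finset.sum_congr rfl fun k _ => ?_
    ring
  simp only [Finset.sum_add_distrib] at *
  rw [e1, e2, e5, e7]
  -- The four copies of the second derivatives D_a D_b O_ab split into a symmetric half, governed by
  -- orthogonality (`e3`), and an antisymmetric half, governed by the commutator (`e4`); `e6`
  -- cancels the squares of first derivatives.
  linear_combination (-2 : ℝ) * e3 - 2 * e4 + e6

lemma sum_sq_of_orthogonal {p : ℕ} (A : Fin p → Fin p → ℝ)
    (hA : ∀ b k, ∑ a, A a b * A a k = if b = k then 1 else 0) (g : Fin p → Fin p → ℝ) :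
    ∑ a, ∑ b, ∑ k, A a b * A a k * g b k = ∑ b, g b b := by
  calc ∑ a, ∑ b, ∑ k, A a b * A a k * g b k = ∑ b, ∑ k, (∑ a, A a b * A a k) * g b k := by
        rw [Finset.sum_comm]
        refine Finset.sum_congr rfl fun b _ => ?_
        rw [Finset.sum_comm]
        simp only [Finset.sum_mul]
    _ = ∑ b, g b b := by simp [hA]

lemma sum_sq_rotate {p : ℕ} (A : Fin p → Fin p → ℝ)
    (hA : ∀ b k, ∑ a, A a b * A a k = if b = k then 1 else 0) (x : Fin p → ℝ) :
    ∑ a, (∑ b, A a b * x b) ^ 2 = ∑ b, x b ^ 2 := by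
  have := sum_sq_of_orthogonal A hA fun b k => x b * x k
  simp only [sq]
  rw [← this]
  refine Finset.sum_congr rfl fun a _ => ?_
  rw [Finset.sum_mul_sum]
  exact Finset.sum_congr rfl fun b _ => Finset.sum_congr rfl fun k _ => by ring

end FrameAlgebra

/-! ### Tensoriality of the generalised Ricci tensor. -/

section Ricci

variable {B : Type*} [NormedAddCommGroup B] [NormedSpace ℝ B] [FiniteDimensional ℝ B]
  {M : Type*} [TopologicalSpace M] [T2Space M] [ChartedSpace B M] [IsManifold 𝓘(ℝ, B) ∞ M]
  {F : Type*} [NormedAddCommGroup F] [NormedSpace ℝ F] [FiniteDimensional ℝ F]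
  {V : M → Type*} [TopologicalSpace (TotalSpace F V)]
  [∀ x, AddCommGroup (V x)] [∀ x, Module ℝ (V x)] [∀ x, TopologicalSpace (V x)]
  [FiberBundle F V] [VectorBundle ℝ F V] [ContMDiffVectorBundle ∞ F V 𝓘(ℝ, B)]
  {C : CourantAlgebroid B F V} (τ : GenMetric C) (dv : Divergence C)

/-- The endomorphism of which the Ricci trace is taken. -/
def IsRicciEndo (v w : Sec B F V) (x : M) (A : V x →ₗ[ℝ] V x) : Prop :=
  ∀ u : Sec B F V, A (u x) = τ.plus (C.bracket (τ.minus (C.bracket (τ.plus u) w)) v) x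

variable {τ} in
lemma IsRicciEndo.trace_eq {v w : Sec B F V} {x : M} {A : V x →ₗ[ℝ] V x}
    (hA : IsRicciEndo τ v w x A) : ricciTrace τ v w x = LinearMap.trace ℝ (V x) A := by
  have hex : ∃ A : V x →ₗ[ℝ] V x, ∀ u : Sec B F V,
    A (u x) = τ.plus (C.bracket (τ.minus (C.bracket (τ.plus u) w)) v) x := ⟨A, hA⟩
  rw [ricciTrace, dif_pos hex]
  congr 1
  ext a
  obtain ⟨u, rfl⟩ := exists_sec_apply_eq (B := B) (F := F) a
  rw [hA, hex.choose_spec u]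

variable {τ} in
-- Orthogonality of V⁺ and V⁻ removes the term with the gradient of `f`; the other derivative term
-- is a multiple of a section of V⁺ and is removed by the projection to V⁻.
lemma minus_bracket_funSmul {u w : Sec B F V} (hw : ∀ x, τ.MemMinus (w x)) (f : SmoothFun B M) :
    τ.minus (C.bracket (τ.plus (funSmul f u)) w) =
      funSmul f (τ.minus (C.bracket (τ.plus u) w)) := by
  rw [τ.plus_funSmul, C.bracket_funSmul_left_of_orthogonal f
    fun y => τ.pairing_eq_zero (τ.memPlus_plus u y) (hw y), τ.minus_sub, τ.minus_funSmul,
    τ.minus_funSmul, τ.minus_of_memPlus (τ.memPlus_plus u)]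
  ext y; simp

variable {τ} in
lemma plus_bracket_funSmul {z v : Sec B F V} (hz : ∀ x, τ.MemMinus (z x))
    (hv : ∀ x, τ.MemPlus (v x)) (f : SmoothFun B M) :
    τ.plus (C.bracket (funSmul f z) v) = funSmul f (τ.plus (C.bracket z v)) := by
  rw [C.bracket_funSmul_left_of_orthogonal f
    fun y => (C.pairing_symm y _ _).trans (τ.pairing_eq_zero (hv y) (hz y)), τ.plus_sub,
    τ.plus_funSmul, τ.plus_funSmul, τ.plus_of_memMinus hz]
  ext y; simp

lemma exists_isRicciEndo {v w : Sec B F V} (hv : ∀ x, τ.MemPlus (v x))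
    (hw : ∀ x, τ.MemMinus (w x)) (x : M) : ∃ A, IsRicciEndo τ v w x A := by
  refine exists_linearMap_of_tensorial
    (fun u => τ.plus (C.bracket (τ.minus (C.bracket (τ.plus u) w)) v) x) (fun s t => ?_)
    fun f s => ?_
  · simp [τ.plus_add, τ.minus_add]
  · rw [minus_bracket_funSmul hw, plus_bracket_funSmul (τ.memMinus_minus _) hv]; rfl

lemma GRic_add_left {v v' w : Sec B F V} (hv : ∀ x, τ.MemPlus (v x))
    (hv' : ∀ x, τ.MemPlus (v' x)) (hw : ∀ x, τ.MemMinus (w x)) (x : M) :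
    GRic τ dv (v + v') w x = GRic τ dv v w x + GRic τ dv v' w x := by
  obtain ⟨A, hA⟩ := exists_isRicciEndo τ hv hw x
  obtain ⟨A', hA'⟩ := exists_isRicciEndo τ hv' hw x
  have hAA : IsRicciEndo τ (v + v') w x (A + A') := fun u => by
    rw [LinearMap.add_apply, hA, hA', map_add, τ.plus_add]; rfl
  have h1 : dirDeriv B (dv.toFun (v + v')) x (C.anchor x (w x)) =
      dirDeriv B (dv.toFun v) x (C.anchor x (w x)) + dirDeriv B (dv.toFun v') x (C.anchor x (w x)) := by
    rw [map_add, ← dirDeriv_add (SmoothFun.smoothAt _ x) (SmoothFun.smoothAt _ x)]; rfl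
  have h2 : dv.toFun (τ.plus (C.bracket w (v + v'))) x =
      dv.toFun (τ.plus (C.bracket w v)) x + dv.toFun (τ.plus (C.bracket w v')) x := by
    rw [map_add, τ.plus_add, map_add]; rfl
  rw [GRic, GRic, GRic, hAA.trace_eq, hA.trace_eq, hA'.trace_eq, h1, h2, map_add]
  ring

lemma GRic_add_right {v w w' : Sec B F V} (hv : ∀ x, τ.MemPlus (v x))
    (hw : ∀ x, τ.MemMinus (w x)) (hw' : ∀ x, τ.MemMinus (w' x)) (x : M) :
    GRic τ dv v (w + w') x = GRic τ dv v w x + GRic τ dv v w' x := by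
  obtain ⟨A, hA⟩ := exists_isRicciEndo τ hv hw x
  obtain ⟨A', hA'⟩ := exists_isRicciEndo τ hv hw' x
  have hAA : IsRicciEndo τ v (w + w') x (A + A') := fun u => by
    rw [LinearMap.add_apply, hA, hA', map_add, τ.minus_add, C.bracket_add_left, τ.plus_add]; rfl
  have h2 : dv.toFun (τ.plus (C.bracket (w + w') v)) x =
      dv.toFun (τ.plus (C.bracket w v)) x + dv.toFun (τ.plus (C.bracket w' v)) x := by
    rw [C.bracket_add_left, τ.plus_add, map_add]; rfl
  rw [GRic, GRic, GRic, hAA.trace_eq, hA.trace_eq, hA'.trace_eq, h2, map_add, sec_add_apply,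
    map_add, dirDeriv_add_vec]
  ring

/-- The endomorphism under the trace acquires a rank one summand whose trace is the derivative of
`f` along ⟦w, v⟧⁺. The divergence of ⟦f w, v⟧⁺ produces the same term, and the two cancel. -/
lemma GRic_funSmul_right {v w : Sec B F V} (hv : ∀ x, τ.MemPlus (v x))
    (hw : ∀ x, τ.MemMinus (w x)) (f : SmoothFun B M) (x : M) :
    GRic τ dv v (funSmul f w) x = f x * GRic τ dv v w x := by
  have : FiniteDimensional ℝ (V x) := finiteDimensional_fiber F x
  obtain ⟨A, hA⟩ := exists_isRicciEndo τ hv hw x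
  have hperp : ∀ y, C.pairing y (w y) (v y) = 0 := fun y =>
    (C.pairing_symm y _ _).trans (τ.pairing_eq_zero (hv y) (hw y))
  -- the rank one correction of the endomorphism
  let l : V x →ₗ[ℝ] ℝ := dForm B f x ∘ₗ C.anchor x ∘ₗ ((1 / 2 : ℝ) • (LinearMap.id + τ.toFun x))
  have hl : ∀ u : Sec B F V, l (u x) = C.lieFun (τ.plus u) f x := fun u => rfl
  have hAA : IsRicciEndo τ v (funSmul f w) x
      (f x • A + l.smulRight (τ.plus (C.bracket w v) x)) := fun u => by
    rw [C.bracket_funSmul_right, τ.minus_add, τ.minus_funSmul, τ.minus_funSmul,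
      τ.minus_of_memMinus hw, C.bracket_add_left, τ.plus_add,
      plus_bracket_funSmul (τ.memMinus_minus _) hv, plus_bracket_funSmul hw hv,
      LinearMap.add_apply, LinearMap.smul_apply, hA, LinearMap.smulRight_apply, hl]
    rfl
  have h2 : dv.toFun (τ.plus (C.bracket (funSmul f w) v)) x =
      f x * dv.toFun (τ.plus (C.bracket w v)) x +
        dirDeriv B f x (C.anchor x (τ.plus (C.bracket w v) x)) := by
    rw [plus_bracket_funSmul hw hv, dv.leibniz]
  have h3 : l (τ.plus (C.bracket w v) x) = dirDeriv B f x (C.anchor x (τ.plus (C.bracket w v) x)) := by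
    rw [hl, τ.plus_of_memPlus (τ.memPlus_plus _)]; rfl
  rw [GRic, GRic, hAA.trace_eq, hA.trace_eq, h2, map_add, map_smul, LinearMap.trace_smulRight, h3,
    funSmul_apply, map_smul, dirDeriv_smul_vec, smul_eq_mul]
  ring

/-- The rank one correction here has trace minus the derivative of `f` along ⟦w, v⟧⁻. Together with
the divergence term it produces the derivative along the whole bracket ⟦w, v⟧, and this cancels the
commutator of the two second derivatives of `f`. -/
lemma GRic_funSmul_left {v w : Sec B F V} (hv : ∀ x, τ.MemPlus (v x))
    (hw : ∀ x, τ.MemMinus (w x)) (f : SmoothFun B M) (x : M) :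
    GRic τ dv (funSmul f v) w x = f x * GRic τ dv v w x := by
  have : FiniteDimensional ℝ (V x) := finiteDimensional_fiber F x
  obtain ⟨A, hA⟩ := exists_isRicciEndo τ hv hw x
  obtain ⟨l, hl⟩ := exists_linearMap_of_tensorial (x := x) (B := B) (F := F) (V := V)
    (fun u => C.lieFun (τ.minus (C.bracket (τ.plus u) w)) f x)
    (fun s t => by
      rw [τ.plus_add, C.bracket_add_left, τ.minus_add, C.lieFun_apply, C.lieFun_apply,
        C.lieFun_apply, sec_add_apply, map_add, dirDeriv_add_vec])
    (fun g s => by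
      rw [minus_bracket_funSmul hw, C.lieFun_apply, C.lieFun_apply, funSmul_apply, map_smul,
        dirDeriv_smul_vec, smul_eq_mul])
  have hAA : IsRicciEndo τ (funSmul f v) w x (f x • A + l.smulRight (v x)) := fun u => by
    rw [C.bracket_funSmul_right, τ.plus_add, τ.plus_funSmul, τ.plus_funSmul,
      τ.plus_of_memPlus hv, LinearMap.add_apply, LinearMap.smul_apply, hA,
      LinearMap.smulRight_apply, hl]
    rfl
  have hvw : C.bracket v w = -C.bracket w v := C.bracket_swap_of_orthogonal fun y =>
    (C.pairing_symm y _ _).trans (τ.pairing_eq_zero (hv y) (hw y))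
  have hlv : l (v x) = -dirDeriv B f x (C.anchor x (τ.minus (C.bracket w v) x)) := by
    have hneg : τ.minus (-C.bracket w v) x = -τ.minus (C.bracket w v) x := by
      simp only [GenMetric.minus_apply, sec_neg_apply, map_neg]
      module
    rw [hl, τ.plus_of_memPlus hv, hvw, C.lieFun_apply, hneg, map_neg, dirDeriv_neg_vec]
  have h1 : dv.toFun (τ.plus (C.bracket w (funSmul f v))) x =
      f x * dv.toFun (τ.plus (C.bracket w v)) x +
        dirDeriv B f x (C.anchor x (τ.plus (C.bracket w v) x)) +
        (C.lieFun w f x * dv.toFun v x + dirDeriv B (C.lieFun w f) x (C.anchor x (v x))) := by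
    rw [C.bracket_funSmul_right, τ.plus_add, τ.plus_funSmul, τ.plus_funSmul,
      τ.plus_of_memPlus hv, map_add, ← dv.leibniz, ← dv.leibniz]; rfl
  have h2 : dirDeriv B (dv.toFun (funSmul f v)) x (C.anchor x (w x)) =
      f x * dirDeriv B (dv.toFun v) x (C.anchor x (w x)) +
        dv.toFun v x * dirDeriv B f x (C.anchor x (w x)) +
        dirDeriv B (C.lieFun v f) x (C.anchor x (w x)) := by
    rw [dv.map_funSmul, ← dirDeriv_mul (f.smoothAt x) (SmoothFun.smoothAt _ x),
      ← dirDeriv_add ((f.smoothAt x).mul (SmoothFun.smoothAt _ x)) (SmoothFun.smoothAt _ x)]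
    rfl
  have h3 := C.dirDeriv_anchor_bracket w v f x
  have h4 : dirDeriv B f x (C.anchor x (C.bracket w v x)) =
      dirDeriv B f x (C.anchor x (τ.plus (C.bracket w v) x)) +
        dirDeriv B f x (C.anchor x (τ.minus (C.bracket w v) x)) := by
    rw [← dirDeriv_add_vec, ← map_add, ← sec_add_apply, τ.plus_add_minus]
  rw [GRic, GRic, hAA.trace_eq, hA.trace_eq, h1, h2, map_add, map_smul, LinearMap.trace_smulRight,
    hlv, smul_eq_mul, C.lieFun_apply]
  linear_combination h3 - h4

/-- The generalised Ricci tensor is a tensor. -/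
lemma GRic_congr {v v' w w' : Sec B F V} (hv : ∀ x, τ.MemPlus (v x)) (hv' : ∀ x, τ.MemPlus (v' x))
    (hw : ∀ x, τ.MemMinus (w x)) (hw' : ∀ x, τ.MemMinus (w' x)) {x : M} (h : v x = v' x)
    (h' : w x = w' x) : GRic τ dv v w x = GRic τ dv v' w' x := by
  obtain ⟨L, hL⟩ := exists_linearMap_of_tensorial (x := x) (B := B) (F := F) (V := V)
    (fun s => GRic τ dv (τ.plus s) w x)
    (fun s t => by rw [τ.plus_add, GRic_add_left τ dv (τ.memPlus_plus _) (τ.memPlus_plus _) hw])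
    (fun f s => by rw [τ.plus_funSmul, GRic_funSmul_left τ dv (τ.memPlus_plus _) hw]; rfl)
  obtain ⟨L', hL'⟩ := exists_linearMap_of_tensorial (x := x) (B := B) (F := F) (V := V)
    (fun s => GRic τ dv v' (τ.minus s) x)
    (fun s t => by rw [τ.minus_add, GRic_add_right τ dv hv' (τ.memMinus_minus _) (τ.memMinus_minus _)])
    (fun f s => by rw [τ.minus_funSmul, GRic_funSmul_right τ dv hv' (τ.memMinus_minus _)]; rfl)
  have h1 := hL v
  have h2 := hL v'
  have h3 := hL' w
  have h4 := hL' w'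
  rw [τ.plus_of_memPlus hv] at h1
  rw [τ.plus_of_memPlus hv'] at h2
  rw [τ.minus_of_memMinus hw] at h3
  rw [τ.minus_of_memMinus hw'] at h4
  rw [← h1, h, h2, ← h3, h', h4]

end Ricci

/-! ### Frame independence and smoothness of the generalised scalar curvature. -/

section Scalar

variable {B : Type*} [NormedAddCommGroup B] [NormedSpace ℝ B] [FiniteDimensional ℝ B]
  {M : Type*} [TopologicalSpace M] [T2Space M] [ChartedSpace B M] [IsManifold 𝓘(ℝ, B) ∞ M]
  {F : Type*} [NormedAddCommGroup F] [NormedSpace ℝ F] [FiniteDimensional ℝ F]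
  {V : M → Type*} [TopologicalSpace (TotalSpace F V)]
  [∀ x, AddCommGroup (V x)] [∀ x, Module ℝ (V x)] [∀ x, TopologicalSpace (V x)]
  [FiberBundle F V] [VectorBundle ℝ F V] [ContMDiffVectorBundle ∞ F V 𝓘(ℝ, B)]
  {C : CourantAlgebroid B F V} {τ : GenMetric C} (dv : Divergence C)

/-- Expansion of a vector in an orthonormal basis of `V⁺ ⊕ V⁻`. -/
lemma eq_sum_of_orthonormal {y : M} {p q : ℕ} (hpq : p + q = Module.finrank ℝ F)
    {e : Fin p → V y} {f : Fin q → V y} (he : ∀ a, τ.MemPlus (e a)) (hf : ∀ a, τ.MemMinus (f a))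
    (hee : ∀ a b, C.pairing y (e a) (e b) = if a = b then 1 else 0)
    (hff : ∀ a b, C.pairing y (f a) (f b) = if a = b then -1 else 0) (u : V y) :
    u = ∑ a, C.pairing y u (e a) • e a - ∑ a, C.pairing y u (f a) • f a := by
  have : FiniteDimensional ℝ (V y) := finiteDimensional_fiber F y
  have hef : ∀ a b, C.pairing y (e a) (f b) = 0 := fun a b => τ.pairing_eq_zero (he a) (hf b)
  have hfe : ∀ a b, C.pairing y (f b) (e a) = 0 := fun a b =>
    (C.pairing_symm y _ _).trans (hef a b)
  have hli : LinearIndependent ℝ (Sum.elim e f) := by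
    rw [Fintype.linearIndependent_iff]
    intro g hg i
    rw [Fintype.sum_sum_type] at hg
    simp only [Sum.elim_inl, Sum.elim_inr] at hg
    rcases i with i | i
    · have := congrArg (fun z => C.pairing y z (e i)) hg
      simpa [hee, hfe] using this
    · have := congrArg (fun z => C.pairing y z (f i)) hg
      simpa [hff, hef] using this
  have hsp := hli.span_eq_top_of_card_eq_finrank' (by
    rw [finrank_fiber (F := F), ← hpq]; simp)
  refine C.pairing_ext fun c => ?_
  have hc : c ∈ Submodule.span ℝ (range (Sum.elim e f)) := by rw [hsp]; trivial
  induction hc using Submodule.span_induction with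
  | mem z hz =>
    obtain ⟨i | i, rfl⟩ := hz
    · simp [hee, hfe]
    · simp [hff, hef]
  | zero => simp
  | add a b _ _ ha hb => rw [map_add, map_add, ha, hb]
  | smul r a _ ha => rw [map_smul, map_smul, ha]

namespace IsOrthoFrame

variable {x : M} {p q p' q' : ℕ} {e : Fin p → Sec B F V} {f : Fin q → Sec B F V}
  {e' : Fin p' → Sec B F V} {f' : Fin q' → Sec B F V}

lemma eventually (h : IsOrthoFrame τ x e f) : ∀ᶠ y in 𝓝 x, IsOrthoFrame τ y e f := by
  filter_upwards [h.plus.eventually_nhds, h.minus.eventually_nhds, h.plus_ortho.eventually_nhds,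
    h.minus_ortho.eventually_nhds] with y h1 h2 h3 h4
  exact ⟨h.rank, h1, h2, h3, h4⟩

lemma expand (h : IsOrthoFrame τ x e f) (u : V x) :
    u = ∑ a, C.pairing x u (e a x) • e a x - ∑ a, C.pairing x u (f a x) • f a x :=
  eq_sum_of_orthonormal h.rank h.plus.self_of_nhds h.minus.self_of_nhds h.plus_ortho.self_of_nhds
    h.minus_ortho.self_of_nhds u

lemma expand_plus (h : IsOrthoFrame τ x e f) {u : V x} (hu : τ.MemPlus u) :
    u = ∑ a, C.pairing x u (e a x) • e a x := by
  have h1 := h.expand u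
  simp only [τ.pairing_eq_zero hu (h.minus.self_of_nhds _), zero_smul, Finset.sum_const_zero,
    sub_zero] at h1
  exact h1

lemma expand_minus (h : IsOrthoFrame τ x e f) {u : V x} (hu : τ.MemMinus u) :
    u = -∑ a, C.pairing x u (f a x) • f a x := by
  have h1 := h.expand u
  simp only [(C.pairing_symm x _ _).trans (τ.pairing_eq_zero (h.plus.self_of_nhds _) hu),
    zero_smul, Finset.sum_const_zero, zero_sub] at h1
  exact h1

/-- Parseval's identity for the frame e' of V⁺: the pairing of two vectors of V⁺ is the sum of the
products of their coefficients. -/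
lemma transition (h : IsOrthoFrame τ x e f) (h' : IsOrthoFrame τ x e' f') (b k : Fin p) :
    ∑ a, C.pairing x (e' a x) (e b x) * C.pairing x (e' a x) (e k x) = if b = k then 1 else 0 := by
  rw [← h.plus_ortho.self_of_nhds b k]
  conv_rhs => rw [h'.expand_plus (h.plus.self_of_nhds b)]
  simp only [map_sum, LinearMap.sum_apply, map_smul, LinearMap.smul_apply, smul_eq_mul]
  exact Finset.sum_congr rfl fun a _ => by rw [C.pairing_symm x (e b x)]

/-- The sum of the squares of all entries of the transition matrix is `p` when computed by columns
and `p'` when computed by rows. -/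
lemma card_eq (h : IsOrthoFrame τ x e f) (h' : IsOrthoFrame τ x e' f') : p = p' := by
  have h1 : ∑ b, ∑ a, C.pairing x (e' a x) (e b x) * C.pairing x (e' a x) (e b x) = (p : ℝ) := by
    simp only [h.transition h', if_true]; simp
  have h2 : ∑ a, ∑ b, C.pairing x (e b x) (e' a x) * C.pairing x (e b x) (e' a x) = (p' : ℝ) := by
    simp only [h'.transition h, if_true]; simp
  rw [Finset.sum_comm] at h1
  simp only [C.pairing_symm x (e' _ x)] at h1
  exact_mod_cast h1.symm.trans h2

/-- All derivative terms in the axioms vanish because the pairings within the frame are constant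
near `x`. -/
lemma bracket_cyclic (h : IsOrthoFrame τ x e f) (i j k : Fin p) :
    C.pairing x (C.bracket (e i) (e j) x) (e k x) =
      C.pairing x (C.bracket (e k) (e i) x) (e j x) := by
  have hconst : ∀ a b (v : TSp B x),
      dirDeriv B (fun y => C.pairing y (e a y) (e b y)) x v = 0 := fun a b v => by
    rw [dirDeriv_congr (g := fun _ => if a = b then 1 else 0)
      (by filter_upwards [h.plus_ortho] with y hy; exact hy a b)]
    simp
  have h1 := C.invariance (e i) (e j) (e k) x
  have h2 := C.pairing_bracket_swap (e i) (e k) x (e j x)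
  rw [hconst] at h1 h2
  rw [C.pairing_symm x (e j x)] at h1
  linarith

end IsOrthoFrame

/-- `scalarPart` for two frames which agree at the point. -/
lemma scalarPart_eq_of_apply_eq {x : M} {p q : ℕ} {e e' : Fin p → Sec B F V}
    {f f' : Fin q → Sec B F V} (h : IsOrthoFrame τ x e f) (h' : IsOrthoFrame τ x e' f')
    (he : ∀ a, e' a x = e a x) (hf : ∀ a, f' a x = f a x) :
    scalarPart dv x e' f' = scalarPart dv x e f := by
  -- The transition matrix between the two frames of V⁺. It is orthogonal near `x` and the identity
  -- at `x`, so only its first and second derivatives at `x` enter.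
  let O : Fin p → Fin p → SmoothFun B M := fun a b => C.pairFun (e' a) (e b)
  have hO : ∀ a b, O a b x = if a = b then 1 else 0 := fun a b => by
    simp only [O, C.pairFun_apply, he, h.plus_ortho.self_of_nhds a b]
  have hexp : ∀ᶠ y in 𝓝 x, ∀ a, e' a y = ∑ b, O a b y • e b y := by
    filter_upwards [h.eventually, h'.plus] with y hy hy' a
    exact hy.expand_plus (hy' a)
  have hOO : ∀ᶠ y in 𝓝 x, ∀ b k, ∑ a, O a b y * O a k y = if b = k then 1 else 0 := by
    filter_upwards [h.eventually, h'.eventually] with y hy hy' b k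
    exact hy.transition hy' b k
  -- first derivatives of the transition functions
  have hOO1 : ∀ᶠ y in 𝓝 x, ∀ b k (v : TSp B y),
      ∑ a, (O a b y * dirDeriv B (O a k) y v + O a k y * dirDeriv B (O a b) y v) = 0 := by
    filter_upwards [hOO.eventually_nhds] with y hy b k v
    have h1 := dirDeriv_congr (f := fun z => ∑ a, O a b z * O a k z)
      (g := fun _ => if b = k then 1 else 0) (by filter_upwards [hy] with z hz; exact hz b k) v
    rw [dirDeriv_const, dirDeriv_sum _ fun a _ => ((O a b).smoothAt y).mul ((O a k).smoothAt y)] at h1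
    rw [← h1]
    exact Finset.sum_congr rfl fun a _ =>
      (dirDeriv_mul ((O a b).smoothAt y) ((O a k).smoothAt y) v).symm
  -- The differential of an orthogonal matrix at the identity is antisymmetric.
  have hanti : ∀ (v : TSp B x) b k, dirDeriv B (O b k) x v = -dirDeriv B (O k b) x v := by
    intro v b k
    have h1 := hOO1.self_of_nhds b k v
    simp only [hO, ite_mul, one_mul, zero_mul, Finset.sum_add_distrib, Finset.sum_ite_eq',
      Finset.mem_univ, if_true] at h1
    linarith
  let D : Fin p → Fin p → Fin p → ℝ := fun i a b => dirDeriv B (O a b) x (C.anchor x (e i x))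
  let Df : Fin q → Fin p → Fin p → ℝ := fun i a b => dirDeriv B (O a b) x (C.anchor x (f i x))
  let DD : Fin p → Fin p → Fin p → Fin p → ℝ := fun i j a b =>
    dirDeriv B (C.lieFun (e j) (O a b)) x (C.anchor x (e i x))
  let c : Fin p → Fin p → Fin p → ℝ := fun i j k => C.pairing x (C.bracket (e i) (e j) x) (e k x)
  let cf : Fin p → Fin p → Fin q → ℝ := fun i j k =>
    C.pairing x (C.bracket (e i) (e j) x) (f k x)
  -- second derivatives
  have h3 : ∀ i j, DD i j i j + DD i j j i + ∑ a, (D j a j * D i a i + D i a j * D j a i) = 0 := by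
    intro i j
    have hev : ∀ᶠ y in 𝓝 x, ∑ a, (O a i y * C.lieFun (e j) (O a j) y +
        O a j y * C.lieFun (e j) (O a i) y) = 0 := by
      filter_upwards [hOO1] with y hy
      exact hy i j _
    have h1 := dirDeriv_congr (g := fun _ => 0) hev (C.anchor x (e i x))
    have hsm : ∀ a b k, SmoothAt B (fun y => O a b y * C.lieFun (e j) (O a k) y) x := fun a b k =>
      ((O a b).smoothAt x).mul ((C.lieFun (e j) (O a k)).smoothAt x)
    rw [dirDeriv_const, dirDeriv_sum _ fun a _ => (hsm a i j).add (hsm a j i)] at h1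
    have h2 : ∀ a, dirDeriv B (fun y => O a i y * C.lieFun (e j) (O a j) y +
        O a j y * C.lieFun (e j) (O a i) y) x (C.anchor x (e i x)) =
        (if a = i then DD i j a j else 0) + (if a = j then DD i j a i else 0) +
        (D j a j * D i a i + D i a j * D j a i) := by
      intro a
      rw [dirDeriv_add (hsm a i j) (hsm a j i), dirDeriv_mul ((O a i).smoothAt x)
        ((C.lieFun (e j) (O a j)).smoothAt x), dirDeriv_mul ((O a j).smoothAt x)
        ((C.lieFun (e j) (O a i)).smoothAt x), hO, hO]
      simp only [ite_mul, one_mul, zero_mul, C.lieFun_apply, D, DD]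
      ring
    simp only [h2, Finset.sum_add_distrib, Finset.sum_ite_eq', Finset.mem_univ, if_true] at h1
    simp only [Finset.sum_add_distrib]
    linarith
  -- The commutator of two derivatives is the derivative along the anchor of the bracket, expanded
  -- in the full frame. The V⁻ part has a minus sign because the pairing is negative there. In this
  -- way the mixed structure constants `cf` enter.
  have h4 : ∀ i j, DD i j i j - DD j i i j =
      ∑ k, c i j k * D k i j - ∑ k, cf i j k * Df k i j := by
    intro i j
    have h1 := C.dirDeriv_anchor_bracket (e i) (e j) (O i j) x
    rw [h.expand (C.bracket (e i) (e j) x)] at h1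
    simp only [map_sub, map_sum, map_smul, dirDeriv_sub_vec, dirDeriv_sum_vec,
      dirDeriv_smul_vec] at h1
    exact h1.symm
  -- This is the vanishing of ⟨𝒟 O_ij, 𝒟 O_ij⟩, split into its V⁺ and V⁻ parts, which contribute
  -- with opposite signs.
  have h6 : ∀ i j, ∑ k, D k i j ^ 2 = ∑ k, Df k i j ^ 2 := by
    intro i j
    have h1 := C.dirDeriv_anchor_rhoStar (O i j) (O i j) x
    rw [h.expand (C.rhoStar x _)] at h1
    simp only [map_sub, map_sum, map_smul, dirDeriv_sub_vec, dirDeriv_sum_vec,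
      dirDeriv_smul_vec, C.pairing_rhoStar, dForm_apply] at h1
    simp only [sq]
    exact sub_eq_zero.1 h1
  -- brackets
  have hbr : ∀ a b (z : V x), C.pairing x (C.bracket (e' a) (e' b) x) z =
      C.pairing x (C.bracket (e a) (e b) x) z
        + ∑ j, dirDeriv B (O b j) x (C.anchor x (e a x)) * C.pairing x (e j x) z
        - ∑ j, dirDeriv B (O a j) x (C.anchor x (e b x)) * C.pairing x (e j x) z
        + dirDeriv B (O a b) x (C.anchor x z) := by
    intro a b z
    have h1 : C.bracket (e' a) (e' b) x =
        C.bracket (∑ i, funSmul (O a i) (e i)) (∑ j, funSmul (O b j) (e j)) x :=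
      C.bracket_congr (by filter_upwards [hexp] with y hy; simpa using hy a)
        (by filter_upwards [hexp] with y hy; simpa using hy b)
    have h2 : ∀ i j, C.pairing x (C.bracket (funSmul (O a i) (e i)) (funSmul (O b j) (e j)) x) z =
        O b j x * (O a i x * C.pairing x (C.bracket (e i) (e j) x) z
          - dirDeriv B (O a i) x (C.anchor x (e j x)) * C.pairing x (e i x) z
          + C.pairing x (e i x) (e j x) * dirDeriv B (O a i) x (C.anchor x z))
        + O a i x * dirDeriv B (O b j) x (C.anchor x (e i x)) * C.pairing x (e j x) z := by
      intro i j
      rw [C.bracket_funSmul_right, sec_add_apply, map_add, LinearMap.add_apply, funSmul_apply,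
        map_smul, LinearMap.smul_apply, C.pairing_bracket_funSmul_left, funSmul_apply, map_smul,
        LinearMap.smul_apply, C.lieFun_apply, funSmul_apply, map_smul, dirDeriv_smul_vec,
        smul_eq_mul, smul_eq_mul]
    have h5 : C.pairing x (C.bracket (e' a) (e' b) x) z = ∑ j, ∑ i,
        C.pairing x (C.bracket (funSmul (O a i) (e i)) (funSmul (O b j) (e j)) x) z := by
      rw [h1]
      simp only [map_sum, LinearMap.sum_apply, sec_sum_apply]
    rw [h5]
    simp only [h2, hO, h.plus_ortho.self_of_nhds]
    simp only [ite_mul, one_mul, zero_mul, Finset.sum_add_distrib, mul_add, mul_sub,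
      Finset.sum_sub_distrib, mul_ite, mul_zero, Finset.sum_ite_eq, Finset.sum_ite_eq',
      Finset.mem_univ, if_true, Finset.sum_ite_irrel, Finset.sum_const_zero]
    ring
  have hc' : ∀ a b k, C.pairing x (C.bracket (e' a) (e' b) x) (e' k x) =
      c a b k + D a b k - D b a k + D k a b := by
    intro a b k
    rw [he, hbr]
    simp [h.plus_ortho.self_of_nhds, c, D]
  have hcf' : ∀ a b k, C.pairing x (C.bracket (e' a) (e' b) x) (f' k x) =
      cf a b k + Df k a b := by
    intro a b k
    rw [hf, hbr]
    simp [τ.pairing_eq_zero (h.plus.self_of_nhds _) (h.minus.self_of_nhds k), cf, Df]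
  -- divergences
  have hd : ∀ᶠ y in 𝓝 x, ∀ a, dv.toFun (e' a) y =
      ∑ b, (O a b y * dv.toFun (e b) y + C.lieFun (e b) (O a b) y) := by
    filter_upwards [hexp.eventually_nhds] with y hy a
    exact dv.apply_of_eq_sum (by filter_upwards [hy] with z hz; exact hz a)
  have hdx : ∀ a, dv.toFun (e' a) x = dv.toFun (e a) x + ∑ b, D b a b := by
    intro a
    rw [hd.self_of_nhds a]
    simp [Finset.sum_add_distrib, hO, D]
  have hDd : ∀ a, dirDeriv B (dv.toFun (e' a)) x (C.anchor x (e' a x)) =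
      dirDeriv B (dv.toFun (e a)) x (C.anchor x (e a x)) + ∑ b, D a a b * dv.toFun (e b) x +
        ∑ b, DD a b a b := by
    intro a
    have hsm : ∀ b, SmoothAt B (fun y => O a b y * dv.toFun (e b) y) x := fun b =>
      ((O a b).smoothAt x).mul ((dv.toFun (e b)).smoothAt x)
    have h1 := dirDeriv_congr (f := dv.toFun (e' a))
      (g := fun y => ∑ b, (O a b y * dv.toFun (e b) y + C.lieFun (e b) (O a b) y))
      (by filter_upwards [hd] with y hy; exact hy a) (C.anchor x (e' a x))
    rw [dirDeriv_sum _ fun b _ => (hsm b).add ((C.lieFun (e b) (O a b)).smoothAt x)] at h1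
    rw [h1, he]
    have h2 : ∀ b, dirDeriv B (fun y => O a b y * dv.toFun (e b) y + C.lieFun (e b) (O a b) y) x
        (C.anchor x (e a x)) = (if a = b then dirDeriv B (dv.toFun (e b)) x (C.anchor x (e a x)) else 0)
          + D a a b * dv.toFun (e b) x + DD a b a b := by
      intro b
      rw [dirDeriv_add (hsm b) ((C.lieFun (e b) (O a b)).smoothAt x),
        dirDeriv_mul ((O a b).smoothAt x) ((dv.toFun (e b)).smoothAt x), hO]
      simp only [ite_mul, one_mul, zero_mul, D, DD]
      ring
    simp only [h2, Finset.sum_add_distrib, Finset.sum_ite_eq, Finset.mem_univ, if_true]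
  have key := frame_change_identity c D h.bracket_cyclic (fun i j k => hanti _ j k) cf Df DD
    (fun a => dv.toFun (e a) x) (fun a => dirDeriv B (dv.toFun (e a)) x (C.anchor x (e a x)))
    h3 h4 h6
  unfold scalarPart
  simp only [hc', hcf', hdx, hDd]
  exact key

/-- `scalarPart` is invariant under constant rotations of the frames. -/
lemma scalarPart_rotate {x : M} {p q : ℕ} (e : Fin p → Sec B F V) (f : Fin q → Sec B F V)
    (A : Fin p → Fin p → ℝ) (hA : ∀ b k, ∑ a, A a b * A a k = if b = k then 1 else 0)
    (A' : Fin q → Fin q → ℝ) (hA' : ∀ b k, ∑ a, A' a b * A' a k = if b = k then 1 else 0) :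
    scalarPart dv x (fun a => ∑ b, A a b • e b) (fun a => ∑ b, A' a b • f b) =
      scalarPart dv x e f := by
  have hdv : ∀ a, ∀ y, dv.toFun (∑ b, A a b • e b) y = ∑ b, A a b * dv.toFun (e b) y := by
    intro a y
    rw [map_sum, smoothFun_sum_apply]
    exact Finset.sum_congr rfl fun b _ => by rw [map_smul]; rfl
  have h1 : ∑ a, dirDeriv B (dv.toFun (∑ b, A a b • e b)) x (C.anchor x ((∑ b, A a b • e b) x)) =
      ∑ b, dirDeriv B (dv.toFun (e b)) x (C.anchor x (e b x)) := by
    rw [← sum_sq_of_orthogonal A hA fun b k => dirDeriv B (dv.toFun (e b)) x (C.anchor x (e k x))]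
    refine Finset.sum_congr rfl fun a _ => ?_
    rw [dirDeriv_congr (Eventually.of_forall (hdv a)), dirDeriv_sum _ fun b _ =>
      smoothAt_const.mul ((dv.toFun (e b)).smoothAt x)]
    refine Finset.sum_congr rfl fun b _ => ?_
    rw [dirDeriv_const_mul _ ((dv.toFun (e b)).smoothAt x), sec_sum_apply, map_sum,
      dirDeriv_sum_vec, Finset.mul_sum]
    refine Finset.sum_congr rfl fun k _ => ?_
    rw [sec_smul_apply, map_smul, dirDeriv_smul_vec]; ring
  have h2 : ∑ a, (dv.toFun (∑ b, A a b • e b) x) ^ 2 = ∑ b, (dv.toFun (e b) x) ^ 2 := by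
    simp only [hdv]
    exact sum_sq_rotate A hA _
  have h3 : ∀ z : Sec B F V, ∑ a, ∑ b, (C.pairing x (C.bracket (∑ i, A a i • e i)
      (∑ j, A b j • e j) x) (z x)) ^ 2 = ∑ a, ∑ b, (C.pairing x (C.bracket (e a) (e b) x) (z x)) ^ 2 := by
    intro z
    have hb : ∀ a b, C.pairing x (C.bracket (∑ i, A a i • e i) (∑ j, A b j • e j) x) (z x) =
        ∑ j, A b j * ∑ i, A a i * C.pairing x (C.bracket (e i) (e j) x) (z x) := by
      intro a b
      simp [map_sum, LinearMap.sum_apply]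
    simp only [hb]
    have : ∀ a, ∑ b, (∑ j, A b j * ∑ i, A a i * C.pairing x (C.bracket (e i) (e j) x) (z x)) ^ 2 =
        ∑ j, (∑ i, A a i * C.pairing x (C.bracket (e i) (e j) x) (z x)) ^ 2 := fun a =>
      sum_sq_rotate A hA _
    simp only [this]
    rw [Finset.sum_comm]
    have h' : ∀ j, ∑ a, (∑ i, A a i * C.pairing x (C.bracket (e i) (e j) x) (z x)) ^ 2 =
        ∑ i, (C.pairing x (C.bracket (e i) (e j) x) (z x)) ^ 2 := fun j => sum_sq_rotate A hA _
    simp only [h']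
    rw [Finset.sum_comm]
  have h4 : ∀ {n : ℕ} (g : Fin n → Sec B F V) (R : Fin n → Fin n → ℝ)
      (hR : ∀ b k, ∑ a, R a b * R a k = if b = k then 1 else 0) (s : V x),
      ∑ a, (C.pairing x s ((∑ b, R a b • g b) x)) ^ 2 = ∑ a, (C.pairing x s (g a x)) ^ 2 := by
    intro n g R hR s
    refine Eq.trans ?_ (sum_sq_rotate R hR fun b => C.pairing x s (g b x))
    simp
  have hcomm : ∀ {n : ℕ} (G : Fin p → Fin p → Fin n → ℝ),
      ∑ a, ∑ b, ∑ k, G a b k = ∑ k, ∑ a, ∑ b, G a b k := by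
    intro n G
    rw [Finset.sum_comm (s := (Finset.univ : Finset (Fin n)))]
    exact Finset.sum_congr rfl fun a _ => Finset.sum_comm
  have h5 : ∀ {n : ℕ} (g : Fin n → Sec B F V), ∑ a, ∑ b, ∑ k, (C.pairing x
      (C.bracket (∑ i, A a i • e i) (∑ j, A b j • e j) x) (g k x)) ^ 2 =
      ∑ a, ∑ b, ∑ k, (C.pairing x (C.bracket (e a) (e b) x) (g k x)) ^ 2 := fun g =>
    (hcomm _).trans ((Finset.sum_congr rfl fun k _ => h3 (g k)).trans (hcomm _).symm)
  unfold scalarPart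
  rw [h1, h2]
  simp only [h4 e A hA, h4 f A' hA', h5]

/-- `scalarPart` does not depend on the frame. -/
lemma scalarPart_eq {x : M} {p q : ℕ} {e e' : Fin p → Sec B F V}
    {f f' : Fin q → Sec B F V} (h : IsOrthoFrame τ x e f) (h' : IsOrthoFrame τ x e' f') :
    scalarPart dv x e' f' = scalarPart dv x e f := by
  let A : Fin p → Fin p → ℝ := fun a b => C.pairing x (e' a x) (e b x)
  -- The sign compensates for the negative definite pairing on V⁻, so that `A'` is the matrix
  -- expressing f' through f at `x`.
  let A' : Fin q → Fin q → ℝ := fun a b => -C.pairing x (f' a x) (f b x)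
  have hA : ∀ b k, ∑ a, A a b * A a k = if b = k then 1 else 0 := h.transition h'
  have hAr : ∀ b k, ∑ a, A b a * A k a = if b = k then 1 else 0 := fun b k => by
    rw [← h'.transition h b k]
    exact Finset.sum_congr rfl fun a _ => by simp only [A, C.pairing_symm x (e' _ x)]
  have hgen : ∀ {g g' : Fin q → Sec B F V} {k k' : Fin p → Sec B F V}, IsOrthoFrame τ x k g →
      IsOrthoFrame τ x k' g' → ∀ b k, ∑ a, C.pairing x (g' a x) (g b x) * C.pairing x (g' a x) (g k x) =
        if b = k then 1 else 0 := by
    intro g g' k k' h h' b j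
    have h1 := h.minus_ortho.self_of_nhds b j
    rw [h'.expand_minus (h.minus.self_of_nhds b)] at h1
    simp only [map_neg, LinearMap.neg_apply, map_sum, LinearMap.sum_apply, map_smul,
      LinearMap.smul_apply, smul_eq_mul] at h1
    simp only [C.pairing_symm x (g b x)] at h1
    split_ifs at h1 ⊢ <;> linarith
  have hA' : ∀ b k, ∑ a, A' a b * A' a k = if b = k then 1 else 0 := fun b k => by
    rw [← hgen h h' b k]
    exact Finset.sum_congr rfl fun a _ => by simp only [A', neg_mul_neg]
  have hAr' : ∀ b k, ∑ a, A' b a * A' k a = if b = k then 1 else 0 := fun b k => by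
    rw [← hgen h' h b k]
    exact Finset.sum_congr rfl fun a _ => by
      simp only [A', neg_mul_neg, C.pairing_symm x (f' _ x)]
  have hrot : IsOrthoFrame τ x (fun a => ∑ b, A a b • e b) (fun a => ∑ b, A' a b • f b) := by
    refine ⟨h.rank, ?_, ?_, ?_, ?_⟩
    · filter_upwards [h.plus] with y hy a
      simp only [GenMetric.MemPlus, sec_sum_apply, sec_smul_apply, map_sum, map_smul] at *
      simp only [hy]
    · filter_upwards [h.minus] with y hy a
      simp only [GenMetric.MemMinus, sec_sum_apply, sec_smul_apply, map_sum, map_smul] at *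
      simp only [hy, smul_neg, Finset.sum_neg_distrib]
    · filter_upwards [h.plus_ortho] with y hy a b
      simp only [sec_sum_apply, sec_smul_apply, map_sum, map_smul, LinearMap.sum_apply,
        LinearMap.smul_apply, hy, smul_eq_mul, mul_ite, mul_one, mul_zero,
        Finset.sum_ite_eq', Finset.mem_univ, if_true]
      rw [← hAr a b]
      exact Finset.sum_congr rfl fun _ _ => by ring
    · filter_upwards [h.minus_ortho] with y hy a b
      simp only [sec_sum_apply, sec_smul_apply, map_sum, map_smul, LinearMap.sum_apply,
        LinearMap.smul_apply, hy, smul_eq_mul, mul_ite, mul_zero,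
        Finset.sum_ite_eq', Finset.mem_univ, if_true]
      have := hAr' a b
      have h2 : (if a = b then (-1 : ℝ) else 0) = -if a = b then 1 else 0 := by split_ifs <;> simp
      rw [h2, ← this, ← Finset.sum_neg_distrib]
      exact Finset.sum_congr rfl fun _ _ => by ring
  -- A rotation by the constant matrices `A`, `A'` makes the frames agree at `x`, so the general
  -- case reduces to constant rotations and to frames with equal values at the point.
  rw [← scalarPart_rotate dv e f A hA A' hA']
  refine scalarPart_eq_of_apply_eq dv hrot h' (fun a => ?_) fun a => ?_
  · rw [h.expand_plus (h'.plus.self_of_nhds a)]; simp [A]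
  · rw [h.expand_minus (h'.minus.self_of_nhds a)]; simp [A']

/-- The Courant algebroid with the opposite pairing. -/
def CourantAlgebroid.opp (C : CourantAlgebroid B F V) : CourantAlgebroid B F V where
  pairing x := -C.pairing x
  anchor := C.anchor
  bracket := C.bracket
  pairing_symm x a b := by simp [C.pairing_symm x a b]
  pairing_nondegenerate x := (Equiv.neg _).bijective.comp (C.pairing_nondegenerate x)
  pairing_smooth s t := (C.pairing_smooth s t).neg
  anchor_smooth := C.anchor_smooth
  invariance e e₁ e₂ x := by
    have := C.invariance e e₁ e₂ x
    simp only [LinearMap.neg_apply]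
    rw [dirDeriv_neg (C.smoothAt_pairing e₁ e₂ x)]
    linarith
  symmetric_part e e₁ x := by
    have := C.symmetric_part e e₁ x
    simp only [LinearMap.neg_apply]
    rw [dirDeriv_neg (C.smoothAt_pairing e e x)]
    linarith
  jacobi := C.jacobi

/-- The opposite generalised metric, for the opposite pairing. -/
def GenMetric.opp (τ : GenMetric C) : GenMetric C.opp where
  toFun x := -τ.toFun x
  smooth s := (τ.smooth s).neg_section
  involutive x a := by simp [τ.involutive]
  symm x a b := by simp [CourantAlgebroid.opp, τ.symm x a b]
  posDef x a ha := by simpa [CourantAlgebroid.opp] using τ.posDef x a ha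

/-- A divergence is a divergence for the opposite pairing. -/
def Divergence.opp (dv : Divergence C) : Divergence C.opp := ⟨dv.toFun, dv.leibniz⟩

lemma IsOrthoFrame.opp {x : M} {p q : ℕ} {e : Fin p → Sec B F V} {f : Fin q → Sec B F V}
    (h : IsOrthoFrame τ x e f) : IsOrthoFrame τ.opp x f e := by
  refine ⟨by rw [add_comm]; exact h.rank, ?_, ?_, ?_, ?_⟩
  · filter_upwards [h.minus] with y hy a
    simp [GenMetric.MemPlus, GenMetric.opp, show τ.toFun y (f a y) = -f a y from hy a]
  · filter_upwards [h.plus] with y hy a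
    simp [GenMetric.MemMinus, GenMetric.opp, show τ.toFun y (e a y) = e a y from hy a]
  · filter_upwards [h.minus_ortho] with y hy a b
    simp only [CourantAlgebroid.opp, LinearMap.neg_apply, hy]
    split_ifs <;> simp
  · filter_upwards [h.plus_ortho] with y hy a b
    simp only [CourantAlgebroid.opp, LinearMap.neg_apply, hy]
    split_ifs <;> simp

/-- The pairing enters only through squares. Hence the contribution of V⁻ can be treated as that of
V⁺ for the opposite pairing. -/
lemma scalarPart_opp (x : M) {p q : ℕ} (e : Fin p → Sec B F V) (f : Fin q → Sec B F V) :
    scalarPart dv.opp x e f = scalarPart dv x e f := by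
  simp [scalarPart, CourantAlgebroid.opp, Divergence.opp]

/-- The generalised scalar curvature can be computed in any orthonormal frame. -/
lemma GR_eq {x : M} {p q : ℕ} {e : Fin p → Sec B F V} {f : Fin q → Sec B F V}
    (h : IsOrthoFrame τ x e f) :
    GR τ dv x = (1 / 2 : ℝ) * (scalarPart dv x e f + scalarPart dv x f e) := by
  have aux : ∀ (p' q' : ℕ) (ef : (Fin p' → Sec B F V) × (Fin q' → Sec B F V)),
      IsOrthoFrame τ x ef.1 ef.2 → (1 / 2 : ℝ) * (scalarPart dv x ef.1 ef.2
        + scalarPart dv x ef.2 ef.1) = (1 / 2 : ℝ) * (scalarPart dv x e f + scalarPart dv x f e) := by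
    intro p' q' ef h1
    obtain rfl := h.card_eq h1
    obtain rfl : q = q' := by have := h.rank; have := h1.rank; omega
    rw [scalarPart_eq dv h h1, ← scalarPart_opp dv x ef.2, ← scalarPart_opp dv x f,
      scalarPart_eq dv.opp h.opp h1.opp]
  have hex : ∃ (p q : ℕ) (ef : (Fin p → Sec B F V) × (Fin q → Sec B F V)),
      IsOrthoFrame τ x ef.1 ef.2 := ⟨p, q, (e, f), h⟩
  rw [GR, dif_pos hex]
  exact aux _ _ _ hex.choose_spec.choose_spec.choose_spec

lemma smoothAt_scalarPart (x : M) {p q : ℕ} (e : Fin p → Sec B F V) (f : Fin q → Sec B F V) :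
    SmoothAt B (fun y => scalarPart dv y e f) x := by
  have hd : ∀ a, SmoothAt B (dv.toFun (e a)) x := fun a => SmoothFun.smoothAt _ x
  have h1 : SmoothAt B (fun y => ∑ a, dirDeriv B (dv.toFun (e a)) y (C.anchor y (e a y))) x :=
    SmoothAt.sum fun a _ => (C.lieFun (e a) (dv.toFun (e a))).smoothAt x
  have h2 : SmoothAt B (fun y => ∑ a, (dv.toFun (e a) y) ^ 2) x :=
    SmoothAt.sum fun a _ => by simp only [sq]; exact (hd a).mul (hd a)
  have h3 : ∀ {n : ℕ} (g : Fin n → Sec B F V),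
      SmoothAt B (fun y => ∑ a, ∑ b, ∑ c, (C.pairing y (C.bracket (e a) (e b) y) (g c y)) ^ 2) x :=
    fun g => SmoothAt.sum fun a _ => SmoothAt.sum fun b _ => SmoothAt.sum fun c _ => by
      simp only [sq]
      exact (C.smoothAt_pairing _ _ x).mul (C.smoothAt_pairing _ _ x)
  exact (((smoothAt_const.mul h1).sub (smoothAt_const.mul h2)).add
    (smoothAt_const.mul (h3 e))).sub (h3 f)

/-- The frame chosen in the definition of `GR` may change from point to point; frame independence
allows one frame to be used on a whole neighbourhood. -/
lemma smoothAt_GR {x : M} {p q : ℕ} {e : Fin p → Sec B F V} {f : Fin q → Sec B F V}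
    (h : IsOrthoFrame τ x e f) : SmoothAt B (GR τ dv) x := by
  have h1 : SmoothAt B (fun y => (1 / 2 : ℝ) * (scalarPart dv y e f + scalarPart dv y f e)) x :=
    smoothAt_const.mul ((smoothAt_scalarPart dv x e f).add (smoothAt_scalarPart dv x f e))
  refine ContMDiffAt.congr_of_eventuallyEq h1 ?_
  filter_upwards [h.eventually] with y hy
  exact GR_eq dv hy

end Scalar

/-! ### Local sections of submersions and functions constant on their fibres. -/

section Submersion

variable {B : Type*} [NormedAddCommGroup B] [NormedSpace ℝ B] [FiniteDimensional ℝ B]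
  {M : Type*} [TopologicalSpace M] [ChartedSpace B M] [IsManifold 𝓘(ℝ, B) ∞ M]
  {B' : Type*} [NormedAddCommGroup B'] [NormedSpace ℝ B'] [FiniteDimensional ℝ B']
  {Q : Type*} [TopologicalSpace Q] [ChartedSpace B' Q] [IsManifold 𝓘(ℝ, B') ∞ Q]
  {ϖ : M → Q}

/-- A submersion is, near a point, a projection. -/
lemma submersion_straighten (hϖ : ContMDiff 𝓘(ℝ, B) 𝓘(ℝ, B') ∞ ϖ) {m : M}
    (hs : Function.Surjective (dMap B B' ϖ m)) :
    ∃ (Z : Submodule ℝ B) (Φ : B' × Z → M) (pr : M → Z),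
      ContMDiffAt 𝓘(ℝ, B' × Z) 𝓘(ℝ, B) ∞ Φ (extChartAt 𝓘(ℝ, B') (ϖ m) (ϖ m), pr m) ∧
      (∀ᶠ w in 𝓝 (extChartAt 𝓘(ℝ, B') (ϖ m) (ϖ m), pr m),
        ϖ (Φ w) = (extChartAt 𝓘(ℝ, B') (ϖ m)).symm w.1) ∧
      (∀ᶠ m' in 𝓝 m, Φ (extChartAt 𝓘(ℝ, B') (ϖ m) (ϖ m'), pr m') = m') ∧ ContinuousAt pr m := by
  set φ := extChartAt 𝓘(ℝ, B) m with hφ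
  set ψ := extChartAt 𝓘(ℝ, B') (ϖ m) with hψ
  let g : B → B' := ψ ∘ ϖ ∘ φ.symm
  have hg : ContDiffAt ℝ ∞ g (φ m) := by
    have := (contMDiffAt_iff.1 (hϖ m)).2
    simpa only [modelWithCornersSelf_coe, range_id, contDiffWithinAt_univ] using this
  let A : B →L[ℝ] B' := fderiv ℝ g (φ m)
  have hA : ∀ v, A v = dMap B B' ϖ m v := by
    intro v
    have h1 : mfderiv 𝓘(ℝ, B) 𝓘(ℝ, B') ϖ m = fderivWithin ℝ g (range 𝓘(ℝ, B)) (φ m) := by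
      exact MDifferentiableAt.mfderiv ((hϖ m).mdifferentiableAt (by simp))
    rw [modelWithCornersSelf_coe, range_id, fderivWithin_univ] at h1
    change A v = mfderiv 𝓘(ℝ, B) 𝓘(ℝ, B') ϖ m v
    rw [h1]
    rfl
  have hAs : Function.Surjective A := fun w => by
    obtain ⟨v, hv⟩ := hs w
    exact ⟨v, (hA v).trans hv⟩
  let Z : Submodule ℝ B := LinearMap.ker A.toLinearMap
  obtain ⟨P, hP⟩ := Submodule.ClosedComplemented.of_finiteDimensional (𝕜 := ℝ) Z
  -- The map read in charts is completed by a projection onto the kernel of its derivative. The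
  -- derivative of the pair is bijective, so the inverse function theorem applies.
  let Ψ : B → B' × Z := fun x => (g x, P x)
  have hΨ : ContDiffAt ℝ ∞ Ψ (φ m) := hg.prodMk P.contDiff.contDiffAt
  have hbij : Function.Bijective (A.prod P) := by
    constructor
    · rw [injective_iff_map_eq_zero]
      intro v hv
      have h1 : A v = 0 := congrArg Prod.fst hv
      have h2 : P v = 0 := congrArg Prod.snd hv
      have h3 := hP ⟨v, h1⟩
      rw [h2] at h3
      exact (congrArg Subtype.val h3).symm
    · rintro ⟨b, z⟩
      obtain ⟨v, hv⟩ := hAs b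
      refine ⟨v - P v + z, Prod.ext ?_ ?_⟩
      · have h1 : A (P v : B) = 0 := (P v).2
        have h2 : A (z : B) = 0 := z.2
        simp [h1, h2, hv]
      · simp [hP]
  let L : B ≃L[ℝ] B' × Z := (LinearEquiv.ofBijective (A.prod P).toLinearMap hbij).toContinuousLinearEquiv
  have hL : HasFDerivAt Ψ (L : B →L[ℝ] B' × Z) (φ m) := by
    have h1 : HasFDerivAt Ψ (A.prod P) (φ m) :=
      (hg.differentiableAt (by simp)).hasFDerivAt.prodMk P.hasFDerivAt
    exact h1
  have hn : (∞ : WithTop ℕ∞) ≠ 0 := by simp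
  let T := hΨ.toOpenPartialHomeomorph Ψ hL hn
  let loc : B' × Z → B := hΨ.localInverse hL hn
  have hloc : ContDiffAt ℝ ∞ loc (Ψ (φ m)) := hΨ.to_localInverse hL hn
  have hlocx : loc (Ψ (φ m)) = φ m := hΨ.localInverse_apply_image hL hn
  have hright : ∀ᶠ w in 𝓝 (Ψ (φ m)), Ψ (loc w) = w :=
    T.eventually_right_inverse (hΨ.image_mem_toOpenPartialHomeomorph_target hL hn)
  have hleft : ∀ᶠ x in 𝓝 (φ m), loc (Ψ x) = x :=
    T.eventually_left_inverse (hΨ.mem_toOpenPartialHomeomorph_source hL hn)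
  have hgx : g (φ m) = ψ (ϖ m) := by
    simp [g, hφ]
  have hcm : ContinuousAt φ m := continuousAt_extChartAt m
  have htgt : φ.target ∈ 𝓝 (φ m) := extChartAt_target_mem_nhds m
  have hsrc : φ.source ∈ 𝓝 m := extChartAt_source_mem_nhds m
  have hΨm : Ψ (φ m) = (ψ (ϖ m), P (φ m)) := by rw [← hgx]
  refine ⟨Z, fun w => φ.symm (loc w), fun m' => P (φ m'), ?_, ?_, ?_, ?_⟩
  · rw [← hΨm]
    have h1 : ContMDiffAt 𝓘(ℝ, B) 𝓘(ℝ, B) ∞ φ.symm (loc (Ψ (φ m))) := by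
      rw [hlocx]
      exact (contMDiffOn_extChartAt_symm m).contMDiffAt htgt
    exact h1.comp _ hloc.contMDiffAt
  · rw [← hΨm]
    have h1 : ∀ᶠ w in 𝓝 (Ψ (φ m)), ϖ (φ.symm (loc w)) ∈ ψ.source := by
      have hc : ContinuousAt (fun w => ϖ (φ.symm (loc w))) (Ψ (φ m)) := by
        refine (hϖ.continuous.continuousAt).comp ?_
        refine ContinuousAt.comp ?_ hloc.continuousAt
        rw [hlocx]
        exact continuousAt_extChartAt_symm m
      refine hc.eventually ?_
      show ∀ᶠ y in 𝓝 (ϖ (φ.symm (loc (Ψ (φ m))))), y ∈ ψ.source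
      rw [hlocx, hφ, extChartAt_to_inv]
      exact extChartAt_source_mem_nhds (ϖ m)
    filter_upwards [hright, h1] with w hw hw1
    have h2 : ψ (ϖ (φ.symm (loc w))) = w.1 := congrArg Prod.fst hw
    rw [← h2, ψ.left_inv hw1]
  · filter_upwards [hcm.eventually hleft, hsrc] with m' h1 h2
    have h3 : Ψ (φ m') = (ψ (ϖ m'), P (φ m')) := by
      simp only [Ψ, g, Function.comp, φ.left_inv h2]
    rw [← h3, h1, φ.left_inv h2]
  · exact P.continuous.continuousAt.comp hcm

/-- Submersions have local sections. -/
lemma exists_local_section (hϖ : ContMDiff 𝓘(ℝ, B) 𝓘(ℝ, B') ∞ ϖ) {m : M}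
    (hs : Function.Surjective (dMap B B' ϖ m)) :
    ∃ s : Q → M, ContMDiffAt 𝓘(ℝ, B') 𝓘(ℝ, B) ∞ s (ϖ m) ∧ s (ϖ m) = m ∧
      ∀ᶠ q in 𝓝 (ϖ m), ϖ (s q) = q := by
  obtain ⟨Z, Φ, pr, h1, h2, h3, -⟩ := submersion_straighten hϖ hs
  have hsm : ContMDiffAt 𝓘(ℝ, B') 𝓘(ℝ, B' × Z) ∞
      (fun q => (extChartAt 𝓘(ℝ, B') (ϖ m) q, pr m)) (ϖ m) :=
    contMDiffAt_extChartAt.prodMk_space contMDiffAt_const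
  -- The section fixes the kernel coordinate at its value at `m`.
  refine ⟨fun q => Φ (extChartAt 𝓘(ℝ, B') (ϖ m) q, pr m), ?_, h3.self_of_nhds, ?_⟩
  · exact ContMDiffAt.comp (ϖ m) h1 hsm
  · filter_upwards [hsm.continuousAt.eventually h2, extChartAt_source_mem_nhds (I := 𝓘(ℝ, B')) (ϖ m)]
      with q hq hq'
    rw [hq]
    exact (extChartAt 𝓘(ℝ, B') (ϖ m)).left_inv hq'

/-- A function whose derivative vanishes along the fibres of a submersion is locally constant on
the fibres. -/
lemma eventually_eq_on_fiber (hϖ : ContMDiff 𝓘(ℝ, B) 𝓘(ℝ, B') ∞ ϖ)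
    (hs : ∀ m, Function.Surjective (dMap B B' ϖ m)) {f : M → ℝ}
    (hf : ∀ m, SmoothAt B f m) (hd : ∀ m v, dMap B B' ϖ m v = 0 → dirDeriv B f m v = 0) (m : M) :
    ∀ᶠ m' in 𝓝 m, ϖ m' = ϖ m → f m' = f m := by
  obtain ⟨Z, Φ, pr, h1, h2, h3, h4⟩ := submersion_straighten hϖ (hs m)
  set y₀ := extChartAt 𝓘(ℝ, B') (ϖ m) (ϖ m) with hy₀
  -- With the base coordinate fixed, `c` parametrises the fibre through `m`. The composite f ∘ c has
  -- zero derivative on a ball, which is convex, and so is constant there.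
  let c : Z → M := fun z => Φ (y₀, z)
  have hι : Continuous fun z : Z => (y₀, z) := by fun_prop
  have hc : ContMDiffAt 𝓘(ℝ, Z) 𝓘(ℝ, B) 1 c (pr m) :=
    (h1.of_le (by simp)).comp (pr m) (contMDiffAt_const.prodMk_space contMDiffAt_id)
  have hc' : ∀ᶠ z in 𝓝 (pr m), ContMDiffAt 𝓘(ℝ, Z) 𝓘(ℝ, B) 1 c z :=
    (contMDiffAt_iff_contMDiffAt_nhds (by simp)).1 hc
  have hϖc : ∀ᶠ z in 𝓝 (pr m), ϖ (c z) = ϖ m := by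
    filter_upwards [(hι.tendsto (pr m)).eventually h2] with z hz
    rw [hz, hy₀, extChartAt_to_inv]
  have hzero : ∀ᶠ z in 𝓝 (pr m), DifferentiableAt ℝ (f ∘ c) z ∧ fderiv ℝ (f ∘ c) z = 0 := by
    filter_upwards [hc', hϖc.eventually_nhds] with z hz hz'
    have hcd : MDifferentiableAt 𝓘(ℝ, Z) 𝓘(ℝ, B) c z := hz.mdifferentiableAt (by simp)
    have hfd := (hf (c z)).mdifferentiableAt
    have hϖd : MDifferentiableAt 𝓘(ℝ, B) 𝓘(ℝ, B') ϖ (c z) :=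
      (hϖ (c z)).mdifferentiableAt (by simp)
    have hcomp := mfderiv_comp z hfd hcd
    have hcomp' := mfderiv_comp z hϖd hcd
    have hconst : mfderiv 𝓘(ℝ, Z) 𝓘(ℝ, B') (ϖ ∘ c) z = 0 := by
      have : ϖ ∘ c =ᶠ[𝓝 z] fun _ => ϖ m := hz'
      rw [this.mfderiv_eq]
      exact mfderiv_const
    refine ⟨mdifferentiableAt_iff_differentiableAt.1 (hfd.comp z hcd), ?_⟩
    rw [← mfderiv_eq_fderiv, hcomp]
    ext u
    refine hd (c z) (mfderiv 𝓘(ℝ, Z) 𝓘(ℝ, B) c z u) ?_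
    rw [hconst] at hcomp'
    exact (DFunLike.congr_fun hcomp' u).symm
  obtain ⟨r, hr, hball⟩ := Metric.eventually_nhds_iff_ball.1 hzero
  have hcst : ∀ z ∈ Metric.ball (pr m) r, f (c z) = f (c (pr m)) := fun z hz =>
    Metric.isOpen_ball.is_const_of_fderiv_eq_zero (𝕜 := ℝ) (f := f ∘ c)
      (convex_ball (pr m) r).isPreconnected
      (fun z hz => (hball z hz).1.differentiableWithinAt) (fun z hz => (hball z hz).2) hz
      (Metric.mem_ball_self hr)
  filter_upwards [h3, h4.eventually (Metric.ball_mem_nhds _ hr)] with m' h5 h6 h7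
  rw [h7] at h5
  have h8 := hcst _ h6
  rw [show c (pr m') = m' from h5, show c (pr m) = m from h3.self_of_nhds] at h8
  exact h8

/-- A function whose derivative vanishes along the connected fibres of a submersion is constant on
the fibres. -/
lemma eq_on_fiber (hϖ : ContMDiff 𝓘(ℝ, B) 𝓘(ℝ, B') ∞ ϖ)
    (hs : ∀ m, Function.Surjective (dMap B B' ϖ m)) (hconn : ∀ q, IsConnected (ϖ ⁻¹' {q}))
    {f : M → ℝ} (hf : ∀ m, SmoothAt B f m)
    (hd : ∀ m v, dMap B B' ϖ m v = 0 → dirDeriv B f m v = 0) {m m' : M} (h : ϖ m = ϖ m') :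
    f m = f m' := by
  have := (hconn (ϖ m')).isPreconnected
  have hsub : IsPreconnected (univ : Set (ϖ ⁻¹' {ϖ m'})) :=
    (Subtype.preconnectedSpace this).isPreconnected_univ
  have hlc : IsLocallyConstant (fun z : ϖ ⁻¹' {ϖ m'} => f z) := by
    rw [IsLocallyConstant.iff_eventually_eq]
    intro z
    have h1 := eventually_eq_on_fiber hϖ hs hf hd (z : M)
    filter_upwards [continuous_subtype_val.continuousAt.eventually h1] with z' hz'
    exact hz' (z'.2.trans z.2.symm)
  exact hlc.apply_eq_of_isPreconnected hsub (x := ⟨m, h⟩) (y := ⟨m', rfl⟩) trivial trivial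

/-- Smoothness descends along submersions. -/
lemma smoothAt_of_comp (hϖ : ContMDiff 𝓘(ℝ, B) 𝓘(ℝ, B') ∞ ϖ) {m : M}
    (hs : Function.Surjective (dMap B B' ϖ m)) {g : Q → ℝ} (hg : SmoothAt B (fun z => g (ϖ z)) m) :
    SmoothAt B' g (ϖ m) := by
  obtain ⟨s, h1, h2, h3⟩ := exists_local_section hϖ hs
  have h4 : SmoothAt B (fun z => g (ϖ z)) (s (ϖ m)) := by rw [h2]; exact hg
  refine (ContMDiffAt.comp (ϖ m) h4 h1).congr_of_eventuallyEq ?_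
  filter_upwards [h3] with q hq
  simp [hq]

end Submersion

/-! ### A single reduction: basic sections and their descent. -/

section SingleReduction

variable {B : Type*} [NormedAddCommGroup B] [NormedSpace ℝ B] [FiniteDimensional ℝ B]
  {M : Type*} [TopologicalSpace M] [T2Space M] [ChartedSpace B M] [IsManifold 𝓘(ℝ, B) ∞ M]
  {F : Type*} [NormedAddCommGroup F] [NormedSpace ℝ F] [FiniteDimensional ℝ F]
  {V : M → Type*} [TopologicalSpace (TotalSpace F V)]
  [∀ x, AddCommGroup (V x)] [∀ x, Module ℝ (V x)] [∀ x, TopologicalSpace (V x)]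
  [FiberBundle F V] [VectorBundle ℝ F V] [ContMDiffVectorBundle ∞ F V 𝓘(ℝ, B)]

/-- A family of sections whose values span the fibre contains sections which form a basis at the
point. -/
lemma exists_frame_of_span {S : Set (Sec B F V)} {x : M}
    (hS : ∀ a : V x, a ∈ Submodule.span ℝ {b | ∃ s ∈ S, s x = b}) :
    ∃ e : Fin (Module.finrank ℝ F) → Sec B F V, (∀ i, e i ∈ S) ∧
      LinearIndependent ℝ fun i => e i x := by
  have : FiniteDimensional ℝ (V x) := finiteDimensional_fiber F x
  obtain ⟨b, hb, hspan, hli⟩ := exists_linearIndependent ℝ {b | ∃ s ∈ S, s x = b}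
  have htop : ⊤ ≤ Submodule.span ℝ (range (Subtype.val : b → V x)) := by
    rw [Subtype.range_coe, hspan]
    exact fun a _ => hS a
  let bas : Module.Basis b ℝ (V x) := Module.Basis.mk hli htop
  have hfin : Finite b := Module.Finite.finite_basis bas
  have := Fintype.ofFinite b
  have hcard : Fintype.card b = Module.finrank ℝ F := by
    rw [← Module.finrank_eq_card_basis bas, finrank_fiber (F := F) x]
  let ε : Fin (Module.finrank ℝ F) ≃ b := (Fintype.equivFinOfCardEq hcard).symm
  choose e he using fun i => hb (ε i).2
  refine ⟨e, fun i => (he i).1, ?_⟩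
  simp only [fun i => (he i).2]
  exact hli.comp ε ε.injective

namespace CourantAlgebroid

variable (C : CourantAlgebroid B F V)

lemma pairing_nondeg (x : M) : (C.pairing x).Nondegenerate := by
  constructor
  · intro a ha
    exact C.pairing_ext fun c => by simpa using ha c
  · intro a ha
    exact C.pairing_ext fun c => by rw [C.pairing_symm]; simpa using ha c

lemma perp_eq (K : ∀ x, Submodule ℝ (V x)) (x : M) :
    C.perp K x = LinearMap.BilinForm.orthogonal (C.pairing x) (K x) := rfl

lemma finrank_perp (K : ∀ x, Submodule ℝ (V x)) (x : M) :
    Module.finrank ℝ (C.perp K x) + Module.finrank ℝ (K x) = Module.finrank ℝ (V x) := by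
  have : FiniteDimensional ℝ (V x) := finiteDimensional_fiber F x
  have h := LinearMap.BilinForm.finrank_orthogonal (C.pairing_nondeg x) (K x)
  rw [perp_eq, h]
  exact Nat.sub_add_cancel (Submodule.finrank_le _)

lemma perp_perp (K : ∀ x, Submodule ℝ (V x)) (x : M) : C.perp (C.perp K) x = K x := by
  have : FiniteDimensional ℝ (V x) := finiteDimensional_fiber F x
  exact LinearMap.BilinForm.orthogonal_orthogonal (C.pairing_nondeg x)
    (fun a b h => by rw [C.pairing_symm]; exact h) (K x)

end CourantAlgebroid

variable {B₁ : Type*} [NormedAddCommGroup B₁] [NormedSpace ℝ B₁] [FiniteDimensional ℝ B₁]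
  {Q₁ : Type*} [TopologicalSpace Q₁] [T2Space Q₁] [ChartedSpace B₁ Q₁] [IsManifold 𝓘(ℝ, B₁) ∞ Q₁]
  {F₁ : Type*} [NormedAddCommGroup F₁] [NormedSpace ℝ F₁] [FiniteDimensional ℝ F₁]
  {V₁ : Q₁ → Type*} [TopologicalSpace (TotalSpace F₁ V₁)]
  [∀ x, AddCommGroup (V₁ x)] [∀ x, Module ℝ (V₁ x)] [∀ x, TopologicalSpace (V₁ x)]
  [FiberBundle F₁ V₁] [VectorBundle ℝ F₁ V₁] [ContMDiffVectorBundle ∞ F₁ V₁ 𝓘(ℝ, B₁)]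

/-- `a` lies in `K^⊥` and is mapped to `b` by the quotient map. -/
def NatRel {C : CourantAlgebroid B F V} {K : ∀ x, Submodule ℝ (V x)} {ϖ : M → Q₁}
    (nat : ∀ m, C.perp K m →ₗ[ℝ] V₁ (ϖ m)) (m : M) (a : V m) (b : V₁ (ϖ m)) : Prop :=
  ∃ h : a ∈ C.perp K m, nat m ⟨a, h⟩ = b

/-- The section `e` lies in `K^⊥` and descends to the section `e₁`. -/
def SecRel {C : CourantAlgebroid B F V} {K : ∀ x, Submodule ℝ (V x)} {ϖ : M → Q₁}
    (nat : ∀ m, C.perp K m →ₗ[ℝ] V₁ (ϖ m)) (e : Sec B F V) (e₁ : Sec B₁ F₁ V₁) : Prop :=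
  ∀ m, NatRel nat m (e m) (e₁ (ϖ m))

variable {C : CourantAlgebroid B F V} {K : ∀ x, Submodule ℝ (V x)} {ϖ : M → Q₁}
  {C₁ : CourantAlgebroid B₁ F₁ V₁} {nat : ∀ m, C.perp K m →ₗ[ℝ] V₁ (ϖ m)}

namespace NatRel

variable {m : M} {a a' : V m} {b b' : V₁ (ϖ m)}

lemma add (h : NatRel nat m a b) (h' : NatRel nat m a' b') : NatRel nat m (a + a') (b + b') := by
  obtain ⟨h1, rfl⟩ := h
  obtain ⟨h2, rfl⟩ := h'
  exact ⟨Submodule.add_mem _ h1 h2, map_add (nat m) ⟨a, h1⟩ ⟨a', h2⟩⟩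

lemma smul (c : ℝ) (h : NatRel nat m a b) : NatRel nat m (c • a) (c • b) := by
  obtain ⟨h1, rfl⟩ := h
  exact ⟨Submodule.smul_mem _ c h1, map_smul (nat m) c ⟨a, h1⟩⟩

lemma neg (h : NatRel nat m a b) : NatRel nat m (-a) (-b) := by
  simpa using h.smul (-1)

lemma sub (h : NatRel nat m a b) (h' : NatRel nat m a' b') : NatRel nat m (a - a') (b - b') := by
  simpa [sub_eq_add_neg] using h.add h'.neg

lemma zero : NatRel nat m 0 0 := ⟨Submodule.zero_mem _, map_zero (nat m)⟩

end NatRel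

namespace IsReduction

lemma natRel_of_mem (hr : IsReduction C K ϖ C₁ nat) {m : M} {a : V m} (h : a ∈ K m) : NatRel nat m a 0 :=
  ⟨hr.isotropic m h, (hr.nat_ker m ⟨a, _⟩).2 h⟩

lemma mem_of_natRel (hr : IsReduction C K ϖ C₁ nat) {m : M} {a : V m} (h : NatRel nat m a 0) : a ∈ K m :=
  (hr.nat_ker m ⟨a, h.1⟩).1 h.2

lemma exists_natRel (hr : IsReduction C K ϖ C₁ nat) {m : M} (b : V₁ (ϖ m)) : ∃ a, NatRel nat m a b := by
  obtain ⟨⟨a, h⟩, rfl⟩ := hr.nat_surjective m b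
  exact ⟨a, h, rfl⟩

lemma pairing_eq (hr : IsReduction C K ϖ C₁ nat) {m : M} {a a' : V m} {b b' : V₁ (ϖ m)} (h : NatRel nat m a b)
    (h' : NatRel nat m a' b') : C₁.pairing (ϖ m) b b' = C.pairing m a a' := by
  obtain ⟨h1, rfl⟩ := h
  obtain ⟨h2, rfl⟩ := h'
  exact hr.nat_pairing m _ _

lemma anchor_eq (hr : IsReduction C K ϖ C₁ nat) {m : M} {a : V m} {b : V₁ (ϖ m)} (h : NatRel nat m a b) :
    C₁.anchor (ϖ m) b = dMap B B₁ ϖ m (C.anchor m a) := by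
  obtain ⟨h1, rfl⟩ := h
  exact hr.nat_anchor m _

/-- Derivatives of functions pulled back from the quotient. -/
lemma dirDeriv_comp_proj (hr : IsReduction C K ϖ C₁ nat) {m : M} {a : V m} {b : V₁ (ϖ m)} (h : NatRel nat m a b) {f : Q₁ → ℝ}
    (hf : SmoothAt B₁ f (ϖ m)) :
    dirDeriv B (fun y => f (ϖ y)) m (C.anchor m a) = dirDeriv B₁ f (ϖ m) (C₁.anchor (ϖ m) b) := by
  rw [hr.anchor_eq h]
  exact dirDeriv_comp hf.mdifferentiableAt ((hr.smooth_proj m).mdifferentiableAt (by simp)) _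

/-- Basic sections span K^⊥ at each point, and (K^⊥)^⊥ = K because the pairing is nondegenerate and
the fibres are finite-dimensional. -/
lemma mem_of_pairing_basic (hr : IsReduction C K ϖ C₁ nat) {m : M} {a : V m}
    (h : ∀ e, IsBasic C K e → C.pairing m a (e m) = 0) : a ∈ K m := by
  rw [← C.perp_perp K m]
  intro b hb
  have : Submodule.span ℝ {b | ∃ e, IsBasic C K e ∧ e m = b} ≤ LinearMap.ker (C.pairing m a) := by
    rw [Submodule.span_le]
    rintro _ ⟨e, he, rfl⟩
    exact h e he
  rw [C.pairing_symm]
  exact this (hr.enough_basic m b hb)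

/-- For a basic section e the function ⟨k, e⟩ vanishes and ⟦k', e⟧ stays in K, so invariance makes
⟦k', k⟧ orthogonal to e. In particular K is involutive. -/
lemma isBasic_of_isSecOf (hr : IsReduction C K ϖ C₁ nat) {k : Sec B F V} (hk : IsSecOf K k) : IsBasic C K k := by
  refine ⟨fun m => hr.isotropic m (hk m), fun k' hk' m => hr.mem_of_pairing_basic fun e he => ?_⟩
  have h1 := C.invariance k' k e m
  have h2 : (fun y => C.pairing y (k y) (e y)) = fun _ => 0 := by
    funext y
    exact he.1 y (k y) (hk y)
  have h3 : C.pairing m (k m) (C.bracket k' e m) = 0 :=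
    hr.isotropic m (he.2 k' hk' m) (k m) (hk m)
  rw [h2, dirDeriv_const, h3, add_zero] at h1
  exact h1.symm

lemma bracket_isSecOf {k e : Sec B F V} (hk : IsSecOf K k) (he : IsBasic C K e) :
    IsSecOf K (C.bracket e k) := by
  rw [C.bracket_swap_of_orthogonal (a := k) (b := e) fun y => he.1 y (k y) (hk y)]
  exact fun m => Submodule.neg_mem _ (he.2 k hk m)

/-- Membership in K^⊥ comes from invariance of the pairing, and stability under brackets with K from
the Jacobi identity. -/
lemma isBasic_bracket (hr : IsReduction C K ϖ C₁ nat) {e e' : Sec B F V} (he : IsBasic C K e) (he' : IsBasic C K e') :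
    IsBasic C K (C.bracket e e') := by
  refine ⟨fun m k hk => ?_, fun k hk => ?_⟩
  · obtain ⟨s, hs, rfl⟩ := hr.subbundle.2 m k hk
    have h1 := C.invariance e s e' m
    have h2 : (fun y => C.pairing y (s y) (e' y)) = fun _ => 0 := by
      funext y
      exact he'.1 y (s y) (hs y)
    have h3 : C.pairing m (C.bracket e s m) (e' m) = 0 :=
      he'.1 m _ (bracket_isSecOf hs he m)
    rw [h2, dirDeriv_const, h3, zero_add] at h1
    exact h1.symm
  · rw [C.jacobi]
    intro m
    exact Submodule.add_mem _ (he'.2 _ (he.2 k hk) m) (bracket_isSecOf (he'.2 k hk) he m)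

lemma exists_secRel (hr : IsReduction C K ϖ C₁ nat) (e₁ : Sec B₁ F₁ V₁) : ∃ e, SecRel nat e e₁ := by
  obtain ⟨e, he, h⟩ := hr.lift e₁
  exact ⟨e, fun m => ⟨he.1 m, h m _⟩⟩

lemma exists_descent (hr : IsReduction C K ϖ C₁ nat) {e : Sec B F V} (he : IsBasic C K e) : ∃ e₁ : Sec B₁ F₁ V₁, SecRel nat e e₁ := by
  obtain ⟨e₁, h⟩ := hr.descend e he
  exact ⟨e₁, fun m => ⟨he.1 m, h m _⟩⟩

/-- Sections of `K^⊥` which descend to the quotient are basic. -/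
lemma isBasic_of_secRel (hr : IsReduction C K ϖ C₁ nat) {e : Sec B F V} {e₁ : Sec B₁ F₁ V₁} (h : SecRel nat e e₁) :
    IsBasic C K e := by
  obtain ⟨e', he', h'⟩ := hr.lift e₁
  have hk : IsBasic C K (e - e') := hr.isBasic_of_isSecOf fun m => hr.mem_of_natRel <| by
    simpa using (h m).sub ⟨he'.1 m, h' m _⟩
  refine ⟨fun m => (h m).1, fun k hk' m => ?_⟩
  have h1 := Submodule.add_mem _ (hk.2 k hk' m) (he'.2 k hk' m)
  have h2 : C.bracket k e = C.bracket k (e - e') + C.bracket k e' := by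
    rw [← map_add, sub_add_cancel]
  rw [h2]
  exact h1

lemma secRel_bracket (hr : IsReduction C K ϖ C₁ nat) {e e' : Sec B F V} {e₁ e₁' : Sec B₁ F₁ V₁} (h : SecRel nat e e₁)
    (h' : SecRel nat e' e₁') : SecRel nat (C.bracket e e') (C₁.bracket e₁ e₁') := by
  have he := hr.isBasic_of_secRel h
  have he' := hr.isBasic_of_secRel h'
  exact fun m => ⟨(hr.isBasic_bracket he he').1 m,
    hr.nat_bracket e e' e₁ e₁' he he' (fun m _ => (h m).2) (fun m _ => (h' m).2) m _⟩

end IsReduction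

end SingleReduction

/-! ### The T-duality relation as a family of isometries. -/

section TDual

variable {B : Type*} [NormedAddCommGroup B] [NormedSpace ℝ B] [FiniteDimensional ℝ B]
  {M : Type*} [TopologicalSpace M] [T2Space M] [ChartedSpace B M] [IsManifold 𝓘(ℝ, B) ∞ M]
  {F : Type*} [NormedAddCommGroup F] [NormedSpace ℝ F] [FiniteDimensional ℝ F]
  {V : M → Type*} [TopologicalSpace (TotalSpace F V)]
  [∀ x, AddCommGroup (V x)] [∀ x, Module ℝ (V x)] [∀ x, TopologicalSpace (V x)]
  [FiberBundle F V] [VectorBundle ℝ F V] [ContMDiffVectorBundle ∞ F V 𝓘(ℝ, B)]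
  {B₁ : Type*} [NormedAddCommGroup B₁] [NormedSpace ℝ B₁] [FiniteDimensional ℝ B₁]
  {Q₁ : Type*} [TopologicalSpace Q₁] [T2Space Q₁] [ChartedSpace B₁ Q₁] [IsManifold 𝓘(ℝ, B₁) ∞ Q₁]
  {F₁ : Type*} [NormedAddCommGroup F₁] [NormedSpace ℝ F₁] [FiniteDimensional ℝ F₁]
  {V₁ : Q₁ → Type*} [TopologicalSpace (TotalSpace F₁ V₁)]
  [∀ x, AddCommGroup (V₁ x)] [∀ x, Module ℝ (V₁ x)] [∀ x, TopologicalSpace (V₁ x)]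
  [FiberBundle F₁ V₁] [VectorBundle ℝ F₁ V₁] [ContMDiffVectorBundle ∞ F₁ V₁ 𝓘(ℝ, B₁)]
  {B₂ : Type*} [NormedAddCommGroup B₂] [NormedSpace ℝ B₂] [FiniteDimensional ℝ B₂]
  {Q₂ : Type*} [TopologicalSpace Q₂] [T2Space Q₂] [ChartedSpace B₂ Q₂] [IsManifold 𝓘(ℝ, B₂) ∞ Q₂]
  {F₂ : Type*} [NormedAddCommGroup F₂] [NormedSpace ℝ F₂] [FiniteDimensional ℝ F₂]
  {V₂ : Q₂ → Type*} [TopologicalSpace (TotalSpace F₂ V₂)]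
  [∀ x, AddCommGroup (V₂ x)] [∀ x, Module ℝ (V₂ x)] [∀ x, TopologicalSpace (V₂ x)]
  [FiberBundle F₂ V₂] [VectorBundle ℝ F₂ V₂] [ContMDiffVectorBundle ∞ F₂ V₂ 𝓘(ℝ, B₂)]
  {C : CourantAlgebroid B F V} {C₁ : CourantAlgebroid B₁ F₁ V₁} {C₂ : CourantAlgebroid B₂ F₂ V₂}
  {K₁ K₂ : ∀ x, Submodule ℝ (V x)} {ϖ₁ : M → Q₁} {ϖ₂ : M → Q₂}
  {nat₁ : ∀ m, C.perp K₁ m →ₗ[ℝ] V₁ (ϖ₁ m)} {nat₂ : ∀ m, C.perp K₂ m →ₗ[ℝ] V₂ (ϖ₂ m)}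

/-- Two reductions of the same Courant algebroid by transversal isotropic subbundles of equal rank,
whose T-duality relation is linear. -/
structure IsTDualPair (C₁ : CourantAlgebroid B₁ F₁ V₁) (C₂ : CourantAlgebroid B₂ F₂ V₂)
    (nat₁ : ∀ m, C.perp K₁ m →ₗ[ℝ] V₁ (ϖ₁ m)) (nat₂ : ∀ m, C.perp K₂ m →ₗ[ℝ] V₂ (ϖ₂ m)) :
    Prop where
  red₁ : IsReduction C K₁ ϖ₁ C₁ nat₁
  red₂ : IsReduction C K₂ ϖ₂ C₂ nat₂
  rank : ∀ m, Module.finrank ℝ (K₁ m) = Module.finrank ℝ (K₂ m)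
  trans₁ : ∀ m, ∀ a ∈ K₁ m, a ∈ C.perp K₂ m → a = 0
  trans₂ : ∀ m, ∀ a ∈ K₂ m, a ∈ C.perp K₁ m → a = 0
  linear : ∀ (q₁ : Q₁) (q₂ : Q₂) (a a' : V₁ q₁) (b b' : V₂ q₂),
      TDualRel nat₁ nat₂ q₁ q₂ a b → TDualRel nat₁ nat₂ q₁ q₂ a' b' →
        TDualRel nat₁ nat₂ q₁ q₂ (a + a') (b + b')

/-- Sections of the reduced bundles which are related by the T-duality relation. -/
def RelSec (nat₁ : ∀ m, C.perp K₁ m →ₗ[ℝ] V₁ (ϖ₁ m)) (nat₂ : ∀ m, C.perp K₂ m →ₗ[ℝ] V₂ (ϖ₂ m))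
    (e₁ : Sec B₁ F₁ V₁) (e₂ : Sec B₂ F₂ V₂) : Prop :=
  ∀ m, TDualRel nat₁ nat₂ (ϖ₁ m) (ϖ₂ m) (e₁ (ϖ₁ m)) (e₂ (ϖ₂ m))

namespace TDualRel

variable {q₁ : Q₁} {q₂ : Q₂} {a : V₁ q₁} {b : V₂ q₂}

lemma symm (h : TDualRel nat₁ nat₂ q₁ q₂ a b) : TDualRel nat₂ nat₁ q₂ q₁ b a := by
  cases h with
  | mk m e h₁ h₂ => exact mk m e h₂ h₁

lemma smul (c : ℝ) (h : TDualRel nat₁ nat₂ q₁ q₂ a b) :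
    TDualRel nat₁ nat₂ q₁ q₂ (c • a) (c • b) := by
  cases h with
  | mk m e h₁ h₂ =>
    have := mk (nat₁ := nat₁) (nat₂ := nat₂) m (c • e) (Submodule.smul_mem _ c h₁)
      (Submodule.smul_mem _ c h₂)
    rw [← map_smul, ← map_smul]
    exact this

lemma of_natRel {m : M} {w : V m} {a : V₁ (ϖ₁ m)} {b : V₂ (ϖ₂ m)} (h₁ : NatRel nat₁ m w a)
    (h₂ : NatRel nat₂ m w b) : TDualRel nat₁ nat₂ (ϖ₁ m) (ϖ₂ m) a b := by
  obtain ⟨h1, rfl⟩ := h₁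
  obtain ⟨h2, rfl⟩ := h₂
  exact mk m w h1 h2

end TDualRel

/-- A subspace of dimension `dim K₂` which meets the orthogonal complement of `K₂` trivially is
transversal to it. -/
lemma exists_sub_mem_perp (m : M) (hrank : Module.finrank ℝ (K₁ m) = Module.finrank ℝ (K₂ m))
    (h : ∀ a ∈ K₁ m, a ∈ C.perp K₂ m → a = 0) (a : V m) : ∃ k ∈ K₁ m, a - k ∈ C.perp K₂ m := by
  have : FiniteDimensional ℝ (V m) := finiteDimensional_fiber F m
  have hinf : K₁ m ⊓ C.perp K₂ m = ⊥ := by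
    rw [eq_bot_iff]
    rintro b ⟨h1, h2⟩
    exact h b h1 h2
  have h1 := Submodule.finrank_sup_add_finrank_inf_eq (K₁ m) (C.perp K₂ m)
  have h2 := C.finrank_perp K₂ m
  rw [hinf, finrank_bot] at h1
  have h3 : K₁ m ⊔ C.perp K₂ m = ⊤ := Submodule.eq_top_of_finrank_eq (by omega)
  have h4 : a ∈ K₁ m ⊔ C.perp K₂ m := h3 ▸ Submodule.mem_top
  obtain ⟨k, hk, p, hp, rfl⟩ := Submodule.mem_sup.1 h4
  exact ⟨k, hk, by simpa using hp⟩

/-- An arbitrary vector is the sum of one in K₁ and one in K₂^⊥, and `a` is orthogonal to both; thus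
transversality is symmetric in K₁ and K₂. -/
lemma eq_zero_of_mem_perp (m : M) (hrank : Module.finrank ℝ (K₁ m) = Module.finrank ℝ (K₂ m))
    (h : ∀ a ∈ K₁ m, a ∈ C.perp K₂ m → a = 0) {a : V m} (ha : a ∈ K₂ m) (ha' : a ∈ C.perp K₁ m) :
    a = 0 := by
  refine C.pairing_ext fun c => ?_
  obtain ⟨k, hk, hck⟩ := exists_sub_mem_perp m hrank h c
  have h1 := hck a ha
  have h2 := ha' k hk
  rw [C.pairing_symm] at h2
  rw [map_sub, h2, sub_zero] at h1
  simpa using h1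

namespace IsTDualPair

lemma of_transversal (hred₁ : IsReduction C K₁ ϖ₁ C₁ nat₁) (hred₂ : IsReduction C K₂ ϖ₂ C₂ nat₂)
    (hrank : ∀ m, Module.finrank ℝ (K₁ m) = Module.finrank ℝ (K₂ m))
    (hlinear : ∀ (q₁ : Q₁) (q₂ : Q₂) (a a' : V₁ q₁) (b b' : V₂ q₂),
      TDualRel nat₁ nat₂ q₁ q₂ a b → TDualRel nat₁ nat₂ q₁ q₂ a' b' →
        TDualRel nat₁ nat₂ q₁ q₂ (a + a') (b + b'))
    (hK : ∀ m, K₁ m ⊓ K₂ m = ⊥) (hKperp : ∀ m, C.perp K₂ m ⊓ K₁ m ≤ K₂ m) :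
    IsTDualPair C₁ C₂ nat₁ nat₂ := by
  have ht : ∀ m, ∀ a ∈ K₁ m, a ∈ C.perp K₂ m → a = 0 := fun m a h1 h2 => by
    have h3 : a ∈ K₁ m ⊓ K₂ m := ⟨h1, hKperp m ⟨h2, h1⟩⟩
    rw [hK m] at h3
    exact h3
  exact ⟨hred₁, hred₂, hrank, ht, fun m a h1 h2 => eq_zero_of_mem_perp m (hrank m) (ht m) h1 h2,
    hlinear⟩

lemma symm (h : IsTDualPair C₁ C₂ nat₁ nat₂) : IsTDualPair C₂ C₁ nat₂ nat₁ :=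
  ⟨h.red₂, h.red₁, fun m => (h.rank m).symm, h.trans₂, h.trans₁,
    fun q₁ q₂ a a' b b' h1 h2 => (h.linear q₂ q₁ b b' a a' h1.symm h2.symm).symm⟩

variable {q₁ : Q₁} {q₂ : Q₂}

/-- The vector of E which realises the pair lies in K₁ ∩ K₂^⊥ as soon as its first component is
zero. -/
lemma eq_zero_right (h : IsTDualPair C₁ C₂ nat₁ nat₂) {a : V₁ q₁} {b : V₂ q₂}
    (hab : TDualRel nat₁ nat₂ q₁ q₂ a b) (ha : a = 0) : b = 0 := by
  cases hab with
  | mk m e h₁ h₂ =>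
    have h1 : e = 0 := h.trans₁ m e ((h.red₁.nat_ker m ⟨e, h₁⟩).1 ha) h₂
    subst h1
    exact map_zero (nat₂ m)

/-- Two pairs over the same point of C may be realised at different points of M, so their difference
lies in R only by the linearity assumption. -/
lemma unique_right (h : IsTDualPair C₁ C₂ nat₁ nat₂) {a : V₁ q₁} {b b' : V₂ q₂}
    (hab : TDualRel nat₁ nat₂ q₁ q₂ a b) (hab' : TDualRel nat₁ nat₂ q₁ q₂ a b') : b = b' := by
  have h1 := h.linear _ _ _ _ _ _ hab (hab'.smul (-1))
  have h2 := h.eq_zero_right h1 (by simp)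
  simpa [← sub_eq_add_neg, sub_eq_zero] using h2

lemma unique_left (h : IsTDualPair C₁ C₂ nat₁ nat₂) {a a' : V₁ q₁} {b : V₂ q₂}
    (hab : TDualRel nat₁ nat₂ q₁ q₂ a b) (hab' : TDualRel nat₁ nat₂ q₁ q₂ a' b) : a = a' :=
  h.symm.unique_right hab.symm hab'.symm

/-- Vectors of the first reduced bundle lift to `K₁^⊥ ∩ K₂^⊥`. -/
lemma exists_natRel (h : IsTDualPair C₁ C₂ nat₁ nat₂) {m : M} (a : V₁ (ϖ₁ m)) :
    ∃ (w : V m) (b : V₂ (ϖ₂ m)), NatRel nat₁ m w a ∧ NatRel nat₂ m w b := by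
  obtain ⟨w, hw⟩ := h.red₁.exists_natRel a
  obtain ⟨k, hk, hwk⟩ := exists_sub_mem_perp m (h.rank m) (h.trans₁ m) w
  exact ⟨w - k, nat₂ m ⟨w - k, hwk⟩, by simpa using hw.sub (h.red₁.natRel_of_mem hk), hwk, rfl⟩

/-- The relation over a point of `M` comes from vectors at that point. -/
lemma exists_lift (h : IsTDualPair C₁ C₂ nat₁ nat₂) {m : M} {a : V₁ (ϖ₁ m)} {b : V₂ (ϖ₂ m)}
    (hab : TDualRel nat₁ nat₂ (ϖ₁ m) (ϖ₂ m) a b) :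
    ∃ w : V m, NatRel nat₁ m w a ∧ NatRel nat₂ m w b := by
  obtain ⟨w, b', h1, h2⟩ := h.exists_natRel a
  -- Some vector at `m` lifts `a`, and the second component which it produces must be `b` by
  -- uniqueness, even if (a, b) was first realised at another point of M.
  have := h.unique_right hab (TDualRel.of_natRel h1 h2)
  subst this
  exact ⟨w, h1, h2⟩

lemma exists_right (h : IsTDualPair C₁ C₂ nat₁ nat₂) (m : M) (a : V₁ (ϖ₁ m)) :
    ∃ b, TDualRel nat₁ nat₂ (ϖ₁ m) (ϖ₂ m) a b := by
  obtain ⟨w, b, h1, h2⟩ := h.exists_natRel a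
  exact ⟨b, TDualRel.of_natRel h1 h2⟩

lemma natRel_right (h : IsTDualPair C₁ C₂ nat₁ nat₂) {m : M} {w : V m} {a : V₁ (ϖ₁ m)}
    {b : V₂ (ϖ₂ m)} (hab : TDualRel nat₁ nat₂ (ϖ₁ m) (ϖ₂ m) a b) (h1 : NatRel nat₁ m w a)
    (h2 : w ∈ C.perp K₂ m) : NatRel nat₂ m w b := by
  have h3 : NatRel nat₂ m w (nat₂ m ⟨w, h2⟩) := ⟨h2, rfl⟩
  rwa [h.unique_right hab (TDualRel.of_natRel h1 h3)]

lemma pairing_eq (h : IsTDualPair C₁ C₂ nat₁ nat₂) {m : M} {a a' : V₁ (ϖ₁ m)} {b b' : V₂ (ϖ₂ m)}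
    (hab : TDualRel nat₁ nat₂ (ϖ₁ m) (ϖ₂ m) a b) (hab' : TDualRel nat₁ nat₂ (ϖ₁ m) (ϖ₂ m) a' b') :
    C₁.pairing (ϖ₁ m) a a' = C₂.pairing (ϖ₂ m) b b' := by
  obtain ⟨w, h1, h2⟩ := h.exists_lift hab
  obtain ⟨w', h1', h2'⟩ := h.exists_lift hab'
  rw [h.red₁.pairing_eq h1 h1', h.red₂.pairing_eq h2 h2']

/-- Derivatives along related vectors of functions with the same pull-back to `M` agree. -/
lemma dirDeriv_eq (h : IsTDualPair C₁ C₂ nat₁ nat₂) {m : M} {a : V₁ (ϖ₁ m)} {b : V₂ (ϖ₂ m)}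
    (hab : TDualRel nat₁ nat₂ (ϖ₁ m) (ϖ₂ m) a b) {f₁ : Q₁ → ℝ} {f₂ : Q₂ → ℝ}
    (hf₁ : SmoothAt B₁ f₁ (ϖ₁ m)) (hf₂ : SmoothAt B₂ f₂ (ϖ₂ m))
    (hf : ∀ᶠ y in 𝓝 m, f₁ (ϖ₁ y) = f₂ (ϖ₂ y)) :
    dirDeriv B₁ f₁ (ϖ₁ m) (C₁.anchor (ϖ₁ m) a) = dirDeriv B₂ f₂ (ϖ₂ m) (C₂.anchor (ϖ₂ m) b) := by
  obtain ⟨w, h1, h2⟩ := h.exists_lift hab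
  rw [← h.red₁.dirDeriv_comp_proj h1 hf₁, ← h.red₂.dirDeriv_comp_proj h2 hf₂]
  exact dirDeriv_congr hf _

/-- The transfer isometry between the fibres of the reduced bundles over a point of `M`. -/
lemma exists_transfer (h : IsTDualPair C₁ C₂ nat₁ nat₂) (m : M) :
    ∃ φ : V₁ (ϖ₁ m) ≃ₗ[ℝ] V₂ (ϖ₂ m), ∀ a b,
      TDualRel nat₁ nat₂ (ϖ₁ m) (ϖ₂ m) a b ↔ φ a = b := by
  choose φ hφ using h.exists_right m
  choose φ' hφ' using h.symm.exists_right m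
  refine ⟨{ toFun := φ, invFun := φ', map_add' := fun a a' => ?_, map_smul' := fun c a => ?_,
            left_inv := fun a => ?_, right_inv := fun b => ?_ }, fun a b => ⟨fun hab => ?_, ?_⟩⟩
  · exact h.unique_right (hφ _) (h.linear _ _ _ _ _ _ (hφ a) (hφ a'))
  · exact h.unique_right (hφ _) ((hφ a).smul c)
  · exact h.unique_left (hφ' _).symm (hφ a)
  · exact h.unique_right (hφ _) (hφ' b).symm
  · exact h.unique_right (hφ a) hab
  · rintro rfl
    exact hφ a

/-- The `K₁`-component of a section in the decomposition `E = K₁ ⊕ K₂^⊥` is smooth. -/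
lemma exists_sec_sub_mem_perp (h : IsTDualPair C₁ C₂ nat₁ nat₂) (s : Sec B F V) :
    ∃ k : Sec B F V, IsSecOf K₁ k ∧ IsSecOf (C.perp K₂) (s - k) := by
  classical
  choose k hk hsk using fun m => exists_sub_mem_perp m (h.rank m) (h.trans₁ m) (s m)
  have huniq : ∀ m (k' : V m), k' ∈ K₁ m → s m - k' ∈ C.perp K₂ m → k m = k' := by
    intro m k' h1 h2
    refine sub_eq_zero.1 (h.trans₁ m _ (Submodule.sub_mem _ (hk m) h1) ?_)
    have := Submodule.sub_mem _ h2 (hsk m)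
    simpa using this
  have hsm : ∀ m, SmoothSecAt B F k m := by
    intro m
    -- A frame near `m` is chosen each of whose members is a section of K₁ or of K₂^⊥. The
    -- K₁-component of `s` is then the partial sum over the members in K₁, with smooth coefficients.
    obtain ⟨e, he, hli⟩ := exists_frame_of_span (B := B) (F := F) (V := V) (x := m)
      (S := {s | IsSecOf K₁ s ∨ IsSecOf (C.perp K₂) s}) (by
        intro a
        obtain ⟨k, hk, hak⟩ := exists_sub_mem_perp m (h.rank m) (h.trans₁ m) a
        have h1 : k ∈ Submodule.span ℝ
            {b : V m | ∃ s ∈ {s : Sec B F V | IsSecOf K₁ s ∨ IsSecOf (C.perp K₂) s}, s m = b} := by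
          obtain ⟨t, ht, rfl⟩ := h.red₁.subbundle.2 m k hk
          exact Submodule.subset_span ⟨t, Or.inl ht, rfl⟩
        have h2 := h.red₂.enough_basic m _ hak
        have h3 := Submodule.span_mono (R := ℝ)
          (t := {b : V m | ∃ s ∈ {s : Sec B F V | IsSecOf K₁ s ∨ IsSecOf (C.perp K₂) s}, s m = b})
          (by rintro _ ⟨t, ht, rfl⟩; exact ⟨t, Or.inr ht.1, rfl⟩) h2
        simpa using Submodule.add_mem _ h3 h1)
    obtain ⟨f, hf⟩ := exists_coeff e hli (by simp) s
    let S : Finset (Fin (Module.finrank ℝ F)) := Finset.univ.filter fun i => IsSecOf K₁ (e i)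
    have hsum : SmoothSecAt B F (fun y => ∑ i ∈ S, f i y • e i y) m :=
      SmoothSecAt.sum fun i _ => SmoothSecAt.smul ((f i).smoothAt m) ((e i).smoothSecAt m)
    refine hsum.congr ?_
    filter_upwards [hf] with y hy
    refine huniq y _ (Submodule.sum_mem _ fun i hi =>
      Submodule.smul_mem _ _ ((Finset.mem_filter.1 hi).2 y)) ?_
    have h4 : s y - ∑ i ∈ S, f i y • e i y =
        ∑ i ∈ Finset.univ.filter (fun i => ¬ IsSecOf K₁ (e i)), f i y • e i y := by
      rw [hy, ← Finset.sum_filter_add_sum_filter_not Finset.univ (fun i => IsSecOf K₁ (e i))]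
      simp [S]
    rw [h4]
    refine Submodule.sum_mem _ fun i hi => Submodule.smul_mem _ _ ?_
    exact (he i).resolve_left (Finset.mem_filter.1 hi).2 y
  exact ⟨⟨k, hsm⟩, hk, hsk⟩

/-- Every section of the first reduced bundle lifts to a section of `K₁^⊥ ∩ K₂^⊥`. -/
lemma exists_secRel (h : IsTDualPair C₁ C₂ nat₁ nat₂) (e₁ : Sec B₁ F₁ V₁) :
    ∃ e : Sec B F V, SecRel nat₁ e e₁ ∧ IsSecOf (C.perp K₂) e := by
  obtain ⟨s, hs⟩ := h.red₁.exists_secRel e₁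
  obtain ⟨k, hk, hsk⟩ := h.exists_sec_sub_mem_perp s
  exact ⟨s - k, fun m => by simpa using (hs m).sub (h.red₁.natRel_of_mem (hk m)), hsk⟩

end IsTDualPair

namespace RelSec

variable {e₁ e₁' : Sec B₁ F₁ V₁} {e₂ e₂' : Sec B₂ F₂ V₂}

lemma exists_secRel (hr : RelSec nat₁ nat₂ e₁ e₂) (h : IsTDualPair C₁ C₂ nat₁ nat₂) :
    ∃ e : Sec B F V, SecRel nat₁ e e₁ ∧ SecRel nat₂ e e₂ := by
  obtain ⟨e, h1, h2⟩ := h.exists_secRel e₁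
  exact ⟨e, h1, fun m => h.natRel_right (hr m) (h1 m) (h2 m)⟩

lemma of_secRel {e : Sec B F V} (h₁ : SecRel nat₁ e e₁) (h₂ : SecRel nat₂ e e₂) :
    RelSec nat₁ nat₂ e₁ e₂ := fun m => TDualRel.of_natRel (h₁ m) (h₂ m)

/-- Each related pair has a common lift to M which descends to both quotients. The bracket of two
such lifts descends to the bracket on either side. -/
lemma bracket (hr : RelSec nat₁ nat₂ e₁ e₂) (hr' : RelSec nat₁ nat₂ e₁' e₂')
    (h : IsTDualPair C₁ C₂ nat₁ nat₂) :
    RelSec nat₁ nat₂ (C₁.bracket e₁ e₁') (C₂.bracket e₂ e₂') := by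
  obtain ⟨e, h1, h2⟩ := hr.exists_secRel h
  obtain ⟨e', h1', h2'⟩ := hr'.exists_secRel h
  exact of_secRel (h.red₁.secRel_bracket h1 h1') (h.red₂.secRel_bracket h2 h2')

lemma add (hr : RelSec nat₁ nat₂ e₁ e₂) (hr' : RelSec nat₁ nat₂ e₁' e₂')
    (h : IsTDualPair C₁ C₂ nat₁ nat₂) : RelSec nat₁ nat₂ (e₁ + e₁') (e₂ + e₂') :=
  fun m => h.linear _ _ _ _ _ _ (hr m) (hr' m)

lemma smul (c : ℝ) (hr : RelSec nat₁ nat₂ e₁ e₂) : RelSec nat₁ nat₂ (c • e₁) (c • e₂) :=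
  fun m => (hr m).smul c

lemma funSmul (hr : RelSec nat₁ nat₂ e₁ e₂) {f₁ : SmoothFun B₁ Q₁} {f₂ : SmoothFun B₂ Q₂}
    (hf : ∀ m, f₁ (ϖ₁ m) = f₂ (ϖ₂ m)) : RelSec nat₁ nat₂ (funSmul f₁ e₁) (funSmul f₂ e₂) := by
  intro m
  rw [funSmul_apply, funSmul_apply, hf m]
  exact (hr m).smul _

lemma sub (hr : RelSec nat₁ nat₂ e₁ e₂) (hr' : RelSec nat₁ nat₂ e₁' e₂')
    (h : IsTDualPair C₁ C₂ nat₁ nat₂) : RelSec nat₁ nat₂ (e₁ - e₁') (e₂ - e₂') := by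
  simpa [sub_eq_add_neg] using hr.add (hr'.smul (-1)) h

end RelSec

end TDual

/-! ### Gluing local sections over an open set. -/

section OpenSections

variable {B : Type*} [NormedAddCommGroup B] [NormedSpace ℝ B] [FiniteDimensional ℝ B]
  {M : Type*} [TopologicalSpace M] [T2Space M] [ChartedSpace B M] [IsManifold 𝓘(ℝ, B) ∞ M]
  {F : Type*} [NormedAddCommGroup F] [NormedSpace ℝ F]
  {V : M → Type*} [TopologicalSpace (TotalSpace F V)]
  [∀ x, AddCommGroup (V x)] [∀ x, Module ℝ (V x)] [∀ x, TopologicalSpace (V x)]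
  [FiberBundle F V] [VectorBundle ℝ F V]

/-- Local smooth sections over an open set with values in convex subsets of the fibres can be glued
to a section over the open set. -/
lemma exists_smoothSecAt_of_local [SecondCountableTopology M] (Ω : TopologicalSpace.Opens M)
    (t : ∀ x, Set (V x)) (ht : ∀ x, Convex ℝ (t x))
    (hloc : ∀ x ∈ Ω, ∃ s : ∀ y, V y, ∀ᶠ y in 𝓝 x, SmoothSecAt B F s y ∧ s y ∈ t y) :
    ∃ s : ∀ y, V y, ∀ x ∈ Ω, SmoothSecAt B F s x ∧ s x ∈ t x := by
  classical
  have : LocallyCompactSpace Ω := ChartedSpace.locallyCompactSpace B Ω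
  choose s hs using fun x : Ω => hloc x x.2
  let W : Ω → Set M := fun j => interior {y | SmoothSecAt B F (s j) y ∧ s j y ∈ t y}
  obtain ⟨ρ, hρ⟩ : ∃ ρ : SmoothPartitionOfUnity Ω 𝓘(ℝ, B) Ω univ,
      ρ.IsSubordinate fun j => Subtype.val ⁻¹' W j :=
    SmoothPartitionOfUnity.exists_isSubordinate 𝓘(ℝ, B) isClosed_univ _
      (fun j => isOpen_interior.preimage continuous_subtype_val)
      (fun x _ => mem_iUnion.2 ⟨x, mem_interior_iff_mem_nhds.2 (hs x)⟩)
  -- The partition of unity lives on Ω as a manifold in its own right. Its members are extended by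
  -- zero without any claim of smoothness at the boundary, and only points of Ω are used.
  let r : Ω → M → ℝ := fun j y => if h : y ∈ Ω then ρ j ⟨y, h⟩ else 0
  have hr : ∀ j (x : Ω), r j x = ρ j x := fun j x => by simp [r]
  have hev : ∀ (x : Ω) (p : M → Prop), (∀ᶠ y : Ω in 𝓝 x, p y) → ∀ᶠ y in 𝓝 (x : M), p y := by
    intro x p hp
    rw [← Ω.isOpen.isOpenEmbedding_subtypeVal.map_nhds_eq x]
    exact hp
  have hrs : ∀ j (x : Ω), SmoothAt B (r j) x := by
    intro j x
    refine contMDiffAt_subtype_iff.1 ?_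
    simp only [hr]
    exact (ρ j).contMDiff x
  have hterm : ∀ j (x : Ω), SmoothSecAt B F (fun y => r j y • s j y) x := by
    intro j x
    by_cases hx : x ∈ tsupport (ρ j)
    · exact SmoothSecAt.smul (hrs j x) (interior_subset (hρ j hx)).1
    · have h0 : ∀ᶠ y : Ω in 𝓝 x, r j y = 0 := by
        filter_upwards [notMem_tsupport_iff_eventuallyEq.1 hx] with y hy
        rw [hr]; exact hy
      have h1 : SmoothSecAt B F (fun y => (0 : V y)) (x : M) :=
        (0 : Sec B F V).smoothSecAt x
      refine h1.congr ?_
      filter_upwards [hev x (fun y => r j y = 0) h0] with y hy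
      simp [hy]
  refine ⟨fun y => ∑ᶠ j, r j y • s j y, fun x hx => ⟨?_, ?_⟩⟩
  · obtain ⟨N, hN, hfin⟩ := ρ.locallyFinite ⟨x, hx⟩
    have hsum : SmoothSecAt B F (fun y => ∑ j ∈ hfin.toFinset, r j y • s j y) x :=
      SmoothSecAt.sum fun j _ => hterm j ⟨x, hx⟩
    refine hsum.congr ?_
    refine hev ⟨x, hx⟩ _ ?_
    filter_upwards [hN] with y hy
    refine finsum_eq_sum_of_support_subset _ fun j hj => ?_
    rw [Set.Finite.coe_toFinset]
    refine ⟨y, ?_, hy⟩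
    have : r j y ≠ 0 := left_ne_zero_of_smul hj
    rwa [hr] at this
  · have hx' : ∀ j, r j x = ρ j ⟨x, hx⟩ := fun j => hr j ⟨x, hx⟩
    refine (ht x).finsum_mem (fun j => ?_) ?_ (fun j hj => ?_)
    · rw [hx']; exact ρ.nonneg j _
    · simp only [hx']
      exact ρ.sum_eq_one (mem_univ _)
    · rw [hx'] at hj
      exact (interior_subset (hρ j (subset_tsupport _ hj))).2

end OpenSections

/-! ### The adjoint action of a splitting and invariant data. -/

section Adjoint

variable {B : Type*} [NormedAddCommGroup B] [NormedSpace ℝ B] [FiniteDimensional ℝ B]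
  {M : Type*} [TopologicalSpace M] [T2Space M] [ChartedSpace B M] [IsManifold 𝓘(ℝ, B) ∞ M]
  {F : Type*} [NormedAddCommGroup F] [NormedSpace ℝ F] [FiniteDimensional ℝ F]
  {V : M → Type*} [TopologicalSpace (TotalSpace F V)]
  [∀ x, AddCommGroup (V x)] [∀ x, Module ℝ (V x)] [∀ x, TopologicalSpace (V x)]
  [FiberBundle F V] [VectorBundle ℝ F V] [ContMDiffVectorBundle ∞ F V 𝓘(ℝ, B)]
  {C : CourantAlgebroid B F V}

namespace CourantAlgebroid

end CourantAlgebroid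

namespace Splitting

variable (σ : Splitting C)

lemma ad_apply (a e : Sec B F V) (x : M) : σ.ad a e x = C.bracket a e x -
    C.rhoStar x (C.pairing x (C.bracket a (σ.sigmaRho e) x) ∘ₗ σ.toFun x) := rfl

@[simp] lemma sigmaRho_apply (e : Sec B F V) (x : M) :
    σ.sigmaRho e x = σ.toFun x (C.anchor x (e x)) := rfl

lemma sigmaRho_add (e e' : Sec B F V) : σ.sigmaRho (e + e') = σ.sigmaRho e + σ.sigmaRho e' := by
  ext x; simp

lemma sigmaRho_smul (c : ℝ) (e : Sec B F V) : σ.sigmaRho (c • e) = c • σ.sigmaRho e := by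
  ext x; simp

lemma pairing_ad (a b : Sec B F V) {x : M} (c : V x) :
    C.pairing x (σ.ad a b x) c = C.pairing x (C.bracket a b x) c -
      C.pairing x (C.bracket a (σ.sigmaRho b) x) (σ.toFun x (C.anchor x c)) := by
  rw [ad_apply]; simp

lemma ad_add_left (a a' e : Sec B F V) (x : M) :
    σ.ad (a + a') e x = σ.ad a e x + σ.ad a' e x := by
  refine C.pairing_ext fun c => ?_
  simp only [pairing_ad, map_add, LinearMap.add_apply, sec_add_apply]
  ring

lemma ad_smul_left (r : ℝ) (a e : Sec B F V) (x : M) : σ.ad (r • a) e x = r • σ.ad a e x := by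
  refine C.pairing_ext fun c => ?_
  simp only [pairing_ad, map_smul, LinearMap.smul_apply, sec_smul_apply, smul_eq_mul]
  ring

lemma ad_sum_left {ι : Type*} (S : Finset ι) (a : ι → Sec B F V) (e : Sec B F V) (x : M) :
    σ.ad (∑ i ∈ S, a i) e x = ∑ i ∈ S, σ.ad (a i) e x := by
  classical
  induction S using Finset.induction_on with
  | empty =>
    have := σ.ad_smul_left 0 0 e x
    simpa using this
  | insert i S hi ih => rw [Finset.sum_insert hi, Finset.sum_insert hi, ad_add_left, ih]

lemma ad_add_right (a e e' : Sec B F V) (x : M) :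
    σ.ad a (e + e') x = σ.ad a e x + σ.ad a e' x := by
  refine C.pairing_ext fun c => ?_
  simp only [pairing_ad, sigmaRho_add, map_add, LinearMap.add_apply, sec_add_apply]
  ring

lemma ad_smul_right (r : ℝ) (a e : Sec B F V) (x : M) : σ.ad a (r • e) x = r • σ.ad a e x := by
  refine C.pairing_ext fun c => ?_
  simp only [pairing_ad, sigmaRho_smul, map_smul, LinearMap.smul_apply, sec_smul_apply, smul_eq_mul]
  ring

/-- The `σ`-adjoint action is compatible with the pairing. -/
lemma dirDeriv_pairing_eq_ad (a b c : Sec B F V) (x : M) :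
    dirDeriv B (fun y => C.pairing y (b y) (c y)) x (C.anchor x (a x)) =
      C.pairing x (σ.ad a b x) (c x) + C.pairing x (b x) (σ.ad a c x) := by
  have h1 := C.invariance a b c x
  -- The two correction terms of the adjoint action add up to the derivative of ⟨σ(ρ b), σ(ρ c)⟩,
  -- which is zero because the splitting is isotropic.
  have h2 := C.invariance a (σ.sigmaRho b) (σ.sigmaRho c) x
  simp only [sigmaRho_apply, σ.isotropic, dirDeriv_const] at h2
  rw [h1, C.pairing_symm x (b x) (σ.ad a c x), pairing_ad, pairing_ad,
    C.pairing_symm x (C.bracket a c x)]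
  rw [C.pairing_symm x (σ.toFun x (C.anchor x (b x)))] at h2
  linarith

end Splitting

section LocalInvariance

variable {σ : Splitting C} {ι : Type*} {U : ι → Set M} {r : ι → ℕ}
  {X : ∀ i, Fin (r i) → ∀ x : M, TSp B x}

/-- Locally invariant metrics map locally invariant sections to locally invariant sections. -/
lemma IsLocInvSec.map_metric {τ : GenMetric C} (hτ : IsLocInvMetric σ U X τ) {e : Sec B F V}
    (h : IsLocInvSec σ U X e) : IsLocInvSec σ U X (τ.map e) := by
  intro i k x hx a ha
  have hp : τ.MemPlus (σ.ad a (τ.plus e) x) :=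
    hτ i k x hx a _ ha (Eventually.of_forall fun y => τ.memPlus_plus e y)
  have hm : τ.MemMinus (σ.ad a (τ.minus e) x) := by
    have h1 : ∀ v : Sec B F V, C.pairing x (τ.plus v x) (σ.ad a (τ.minus e) x) = 0 := by
      intro v
      have h2 := σ.dirDeriv_pairing_eq_ad a (τ.plus v) (τ.minus e) x
      have h3 : (fun y => C.pairing y (τ.plus v y) (τ.minus e y)) = fun _ => 0 := by
        funext y
        exact τ.pairing_eq_zero (τ.memPlus_plus v y) (τ.memMinus_minus e y)
      have h4 : τ.MemPlus (σ.ad a (τ.plus v) x) :=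
        hτ i k x hx a _ ha (Eventually.of_forall fun y => τ.memPlus_plus v y)
      rw [h3, dirDeriv_const, τ.pairing_eq_zero h4 (τ.memMinus_minus e x), zero_add] at h2
      exact h2.symm
    refine C.pairing_ext_sec fun v => ?_
    have h5 := h1 v
    rw [τ.plus_apply, C.pairing_symm] at h5
    have h6 := τ.symm x (σ.ad a (τ.minus e) x) (v x)
    have h7 := C.pairing_symm x (v x) (τ.toFun x (σ.ad a (τ.minus e) x))
    simp only [map_smul, map_add, smul_eq_mul, map_neg, LinearMap.neg_apply] at h5 ⊢
    linarith
  have hsum : σ.ad a (τ.plus e) x + σ.ad a (τ.minus e) x = 0 := by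
    rw [← σ.ad_add_right, τ.plus_add_minus, h i k x hx a ha]
  have hmap : τ.map e = τ.plus e + (-1 : ℝ) • τ.minus e := by
    ext y
    simp only [τ.map_apply, sec_add_apply, sec_smul_apply, τ.plus_apply, τ.minus_apply]
    module
  have h8 : τ.toFun x (σ.ad a (τ.plus e) x + σ.ad a (τ.minus e) x) = 0 := by rw [hsum, map_zero]
  rw [map_add, hp, hm] at h8
  rw [hmap, σ.ad_add_right, σ.ad_smul_right]
  simpa using h8

/-- The divergence of a locally invariant section is constant along the local generators. -/
lemma IsLocCompatDiv.dirDeriv_eq_zero (hU : ∀ i, IsOpen (U i))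
    (hX : ∀ i k, SmoothVFOn B (X i k) (U i)) {dv : Divergence C} (hd : IsLocCompatDiv σ U X dv)
    {e : Sec B F V} (h : IsLocInvSec σ U X e) {i : ι} (k : Fin (r i)) {x : M} (hx : x ∈ U i) :
    dirDeriv B (dv.toFun e) x (X i k x) = 0 := by
  obtain ⟨X', hX'⟩ := exists_sec_eventuallyEq (B := B) (F := B) (s := X i k) (x := x) (by
    filter_upwards [(hU i).mem_nhds hx] with y hy
    exact (hX i k y hy).contMDiffAt ((hU i).mem_nhds hy))
  let a : Sec B F V := ⟨fun y => σ.toFun y (X' y), σ.smooth _ X'.contMDiff.contMDiffOn⟩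
  have ha : ∀ᶠ y in 𝓝 x, a y = σ.toFun y (X i k y) := by
    filter_upwards [hX'] with y hy
    exact congrArg (σ.toFun y) hy
  -- The zero section represents the adjoint action on `e` near `x`, so compatibility equates the
  -- derivative with the divergence of zero.
  have := hd i k x hx a e 0 ha (by
    filter_upwards [ha.eventually_nhds, (hU i).mem_nhds hx] with y hy hyU
    exact (h i k y hyU a hy).symm)
  rw [this]
  simp

end LocalInvariance

end Adjoint

/-! ### Lifting vector fields of D₁ to sections of ρ(K₂). -/

section Lifts

variable {B : Type*} [NormedAddCommGroup B] [NormedSpace ℝ B] [FiniteDimensional ℝ B]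
  {M : Type*} [TopologicalSpace M] [T2Space M] [ChartedSpace B M] [IsManifold 𝓘(ℝ, B) ∞ M]
  {F : Type*} [NormedAddCommGroup F] [NormedSpace ℝ F] [FiniteDimensional ℝ F]
  {V : M → Type*} [TopologicalSpace (TotalSpace F V)]
  [∀ x, AddCommGroup (V x)] [∀ x, Module ℝ (V x)] [∀ x, TopologicalSpace (V x)]
  [FiberBundle F V] [VectorBundle ℝ F V] [ContMDiffVectorBundle ∞ F V 𝓘(ℝ, B)]
  {B₁ : Type*} [NormedAddCommGroup B₁] [NormedSpace ℝ B₁] [FiniteDimensional ℝ B₁]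
  {Q₁ : Type*} [TopologicalSpace Q₁] [T2Space Q₁] [ChartedSpace B₁ Q₁] [IsManifold 𝓘(ℝ, B₁) ∞ Q₁]
  {F₁ : Type*} [NormedAddCommGroup F₁] [NormedSpace ℝ F₁] [FiniteDimensional ℝ F₁]
  {V₁ : Q₁ → Type*} [TopologicalSpace (TotalSpace F₁ V₁)]
  [∀ x, AddCommGroup (V₁ x)] [∀ x, Module ℝ (V₁ x)] [∀ x, TopologicalSpace (V₁ x)]
  [FiberBundle F₁ V₁] [VectorBundle ℝ F₁ V₁] [ContMDiffVectorBundle ∞ F₁ V₁ 𝓘(ℝ, B₁)]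
  {B₂ : Type*} [NormedAddCommGroup B₂] [NormedSpace ℝ B₂] [FiniteDimensional ℝ B₂]
  {Q₂ : Type*} [TopologicalSpace Q₂] [T2Space Q₂] [ChartedSpace B₂ Q₂] [IsManifold 𝓘(ℝ, B₂) ∞ Q₂]
  {F₂ : Type*} [NormedAddCommGroup F₂] [NormedSpace ℝ F₂] [FiniteDimensional ℝ F₂]
  {V₂ : Q₂ → Type*} [TopologicalSpace (TotalSpace F₂ V₂)]
  [∀ x, AddCommGroup (V₂ x)] [∀ x, Module ℝ (V₂ x)] [∀ x, TopologicalSpace (V₂ x)]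
  [FiberBundle F₂ V₂] [VectorBundle ℝ F₂ V₂] [ContMDiffVectorBundle ∞ F₂ V₂ 𝓘(ℝ, B₂)]
  {C : CourantAlgebroid B F V} {C₁ : CourantAlgebroid B₁ F₁ V₁} {C₂ : CourantAlgebroid B₂ F₂ V₂}
  {K₁ K₂ : ∀ x, Submodule ℝ (V x)} {ϖ₁ : M → Q₁} {ϖ₂ : M → Q₂}
  {nat₁ : ∀ m, C.perp K₁ m →ₗ[ℝ] V₁ (ϖ₁ m)} {nat₂ : ∀ m, C.perp K₂ m →ₗ[ℝ] V₂ (ϖ₂ m)}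

lemma finiteDimensional_tangent (x : M) : FiniteDimensional ℝ (TSp B x) :=
  inferInstanceAs (FiniteDimensional ℝ B)

lemma IsReduction.finrank_anchorImage {K : ∀ x, Submodule ℝ (V x)}
    {nat : ∀ m, C.perp K m →ₗ[ℝ] V₁ (ϖ₁ m)} (h : IsReduction C K ϖ₁ C₁ nat) (m : M) :
    Module.finrank ℝ B₁ + Module.finrank ℝ (C.anchorImage K m) = Module.finrank ℝ B := by
  have : FiniteDimensional ℝ (TSp B m) := finiteDimensional_tangent m
  have h1 := LinearMap.finrank_range_add_finrank_ker (dMap B B₁ ϖ₁ m)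
  rw [LinearMap.range_eq_top.2 (h.submersion m), finrank_top, h.ker_proj m] at h1
  exact h1

/-- The image of a splitting, as a smooth section. -/
def Splitting.sec (σ : Splitting C) (Y : Sec B B (TangentSpace 𝓘(ℝ, B) : M → Type _)) :
    Sec B F V :=
  ⟨fun x => σ.toFun x (Y x), σ.smooth _ Y.contMDiff.contMDiffOn⟩

@[simp] lemma Splitting.sec_apply (σ : Splitting C)
    (Y : Sec B B (TangentSpace 𝓘(ℝ, B) : M → Type _)) (x : M) : σ.sec Y x = σ.toFun x (Y x) := rfl

/-- The anchor of a section, as a vector field. -/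
def CourantAlgebroid.anchorSec (C : CourantAlgebroid B F V) (e : Sec B F V) :
    Sec B B (TangentSpace 𝓘(ℝ, B) : M → Type _) :=
  ⟨fun x => C.anchor x (e x), contMDiffOn_univ.1 (C.anchor_smooth e)⟩

@[simp] lemma CourantAlgebroid.anchorSec_apply (C : CourantAlgebroid B F V) (e : Sec B F V)
    (x : M) : C.anchorSec e x = C.anchor x (e x) := rfl

/-- Near a point, a section of a sum `ρ(K₁) + ρ(K₂)` of constant rank is the sum of smooth sections
of the summands. The second one vanishes at the point if the section lies in `ρ(K₁)` there. -/
lemma exists_local_decomposition {N : ℕ} (hs₁ : IsSubbundle B F K₁) (hs₂ : IsSubbundle B F K₂)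
    (hN : ∀ y, Module.finrank ℝ (C.anchorImage K₁ y ⊔ C.anchorImage K₂ y :
      Submodule ℝ (TSp B y)) = N) {m : M}
    {Z : Sec B B (TangentSpace 𝓘(ℝ, B) : M → Type _)}
    (hZ : ∀ᶠ y in 𝓝 m, Z y ∈ C.anchorImage K₁ y ⊔ C.anchorImage K₂ y)
    (hZm : Z m ∈ C.anchorImage K₁ m) :
    ∃ Y : ∀ y : M, TSp B y, (∀ᶠ y in 𝓝 m, SmoothSecAt B B Y y ∧ Y y ∈ C.anchorImage K₂ y ∧
      Z y - Y y ∈ C.anchorImage K₁ y) ∧ Y m = 0 := by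
  classical
  have hfd : ∀ y : M, FiniteDimensional ℝ (TSp B y) := fun y => finiteDimensional_tangent y
  set T₁ := C.anchorImage K₁ m with hT₁
  set T₂ := C.anchorImage K₂ m with hT₂
  -- A basis of T₁ is extended to a basis of T₁ + T₂ by vectors of T₁ ∪ T₂. Each basis vector is
  -- then extended along K₁ if it lies in T₁ and along K₂ otherwise. Constant rank makes the
  -- extensions a frame of the sum near `m`.
  obtain ⟨s, hs, hspan, hli⟩ := exists_linearIndependent ℝ (T₁ : Set (TSp B m))
  obtain ⟨b, hb, hsb, hbspan, hbli⟩ := exists_linearIndepOn_id_extension hli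
    (hs.trans (subset_union_left (t := (T₂ : Set (TSp B m)))))
  have hbli' : LinearIndependent ℝ (fun v : b => (v : TSp B m)) := hbli
  have hfin : Finite b := hbli'.finite
  have := Fintype.ofFinite b
  have hk : ∀ v : b, ∃ k : Sec B F V, ((v : TSp B m) ∈ T₁ → IsSecOf K₁ k) ∧
      ((v : TSp B m) ∉ T₁ → IsSecOf K₂ k) ∧ C.anchor m (k m) = v := by
    rintro ⟨v, hv⟩
    by_cases h1 : v ∈ T₁
    · obtain ⟨a, ha, rfl⟩ := h1
      obtain ⟨k, hk, rfl⟩ := hs₁.2 m a ha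
      exact ⟨k, fun _ => hk, fun h => absurd ⟨_, ha, rfl⟩ h, rfl⟩
    · obtain ⟨a, ha, rfl⟩ := (hb hv).resolve_left h1
      obtain ⟨k, hk, rfl⟩ := hs₂.2 m a ha
      exact ⟨k, fun h => absurd h h1, fun _ => hk, rfl⟩
  choose k hk₁ hk₂ hkm using hk
  have hmem : ∀ v y, C.anchorSec (k v) y ∈ C.anchorImage K₁ y ⊔ C.anchorImage K₂ y := by
    intro v y
    by_cases h1 : (v : TSp B m) ∈ T₁
    · exact Submodule.mem_sup_left ⟨_, hk₁ v h1 y, rfl⟩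
    · exact Submodule.mem_sup_right ⟨_, hk₂ v h1 y, rfl⟩
  have hlim : LinearIndependent ℝ fun v => C.anchorSec (k v) m := by
    simp only [CourantAlgebroid.anchorSec_apply, hkm]
    exact hbli'
  have hsup : Submodule.span ℝ b = T₁ ⊔ T₂ := by
    refine le_antisymm (Submodule.span_le.2 fun v hv => ?_) (sup_le ?_ ?_)
    · exact (hb hv).elim (fun h => Submodule.mem_sup_left h) fun h => Submodule.mem_sup_right h
    · exact fun v hv => hbspan (Or.inl hv)
    · exact fun v hv => hbspan (Or.inr hv)
  have hcard : Fintype.card b = N := by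
    rw [← hN m, ← finrank_span_eq_card hbli', Subtype.range_coe, hsup]
  have hliev := eventually_linearIndependent (B := B) (F := B)
    (e := fun v y => C.anchorSec (k v) y) (fun v => (C.anchorSec (k v)).smoothSecAt m) hlim
  have hexp : ∀ᶠ y in 𝓝 m, ∃ g : b → ℝ, Z y = ∑ v, g v • C.anchorSec (k v) y := by
    filter_upwards [hliev, hZ] with y hy hZy
    have h1 : Submodule.span ℝ (range fun v => C.anchorSec (k v) y) =
        C.anchorImage K₁ y ⊔ C.anchorImage K₂ y := by
      refine Submodule.eq_of_le_of_finrank_eq (Submodule.span_le.2 ?_) ?_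
      · rintro _ ⟨v, rfl⟩
        exact hmem v y
      · rw [finrank_span_eq_card hy, hN y, hcard]
    rw [← h1, Submodule.mem_span_range_iff_exists_fun] at hZy
    obtain ⟨g, hg⟩ := hZy
    exact ⟨g, hg.symm⟩
  let g : b → M → ℝ := fun v y =>
    if h : ∃ g : b → ℝ, Z y = ∑ v, g v • C.anchorSec (k v) y then h.choose v else 0
  have hg : ∀ᶠ y in 𝓝 m, Z y = ∑ v, g v y • C.anchorSec (k v) y := by
    filter_upwards [hexp] with y hy
    simp only [g, dif_pos hy]
    exact hy.choose_spec
  have hgs : ∀ᶠ y in 𝓝 m, ∀ v, SmoothAt B (g v) y := by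
    filter_upwards [hliev, hg.eventually_nhds] with y hy hgy v
    exact smoothAt_coeff (B := B) (F := B) (e := fun v y => C.anchorSec (k v) y)
      (fun v => (C.anchorSec (k v)).smoothSecAt y) hy (Z.smoothSecAt y) hgy v
  let S : Finset b := Finset.univ.filter fun v => (v : TSp B m) ∉ T₁
  let S' : Finset b := Finset.univ.filter fun v => ¬ (v : TSp B m) ∉ T₁
  have hsplit : ∀ᶠ y in 𝓝 m, Z y - ∑ v ∈ S, g v y • C.anchorSec (k v) y =
      ∑ v ∈ S', g v y • C.anchorSec (k v) y := by
    filter_upwards [hg] with y hy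
    rw [hy, ← Finset.sum_filter_add_sum_filter_not Finset.univ
      (fun v : b => (v : TSp B m) ∉ T₁)]
    simp [S, S']
  have hS' : ∀ y, ∑ v ∈ S', g v y • C.anchorSec (k v) y ∈ C.anchorImage K₁ y := fun y =>
    Submodule.sum_mem _ fun v hv => Submodule.smul_mem _ _
      ⟨_, hk₁ v (not_not.1 (Finset.mem_filter.1 hv).2) y, rfl⟩
  refine ⟨fun y => ∑ v ∈ S, g v y • C.anchorSec (k v) y, ?_, ?_⟩
  · filter_upwards [hgs, hsplit] with y h1 h2
    refine ⟨SmoothSecAt.sum fun v _ => SmoothSecAt.smul (h1 v)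
      ((C.anchorSec (k v)).smoothSecAt y), Submodule.sum_mem _ fun v hv =>
      Submodule.smul_mem _ _ ⟨_, hk₂ v (Finset.mem_filter.1 hv).2 y, rfl⟩, ?_⟩
    rw [h2]
    exact hS' y
  -- At `m` the K₂-part `w` lies in T₁, since both the value of `Z` and its K₁-part do. It is also a
  -- combination of the basis vectors outside T₁, so independence makes it zero.
  · set w := ∑ v ∈ S, g v m • C.anchorSec (k v) m with hw
    have h1 : w ∈ T₁ := by
      have h2 := hS' m
      rw [← hsplit.self_of_nhds] at h2
      have := Submodule.sub_mem _ hZm h2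
      rwa [sub_sub_cancel] at this
    have h3 : T₁ = Submodule.span ℝ s := by rw [hspan, Submodule.span_eq]
    have h4 : w ∈ Submodule.span ℝ (b \ T₁) := by
      refine Submodule.sum_mem _ fun v hv => Submodule.smul_mem _ _ (Submodule.subset_span ?_)
      rw [CourantAlgebroid.anchorSec_apply, hkm]
      exact ⟨v.2, (Finset.mem_filter.1 hv).2⟩
    have h5 : Disjoint (Submodule.span ℝ s) (Submodule.span ℝ (b \ T₁)) := by
      have h6 := hbli'.disjoint_span_image (s := Subtype.val ⁻¹' s) (t := Subtype.val ⁻¹' (b \ T₁))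
        (Set.disjoint_left.2 fun v h1 h2 => h2.2 (hs h1))
      rwa [Subtype.image_preimage_coe, Subtype.image_preimage_coe,
        inter_eq_right.2 hsb, inter_eq_right.2 sdiff_subset] at h6
    rw [h3] at h1
    exact (Submodule.disjoint_def.1 h5) w h1 h4

/-- Vector fields in the image of `ρ(K₂)` lift locally to sections of `ρ(K₂)` with prescribed value
at a point. -/
lemma IsTDualPair.exists_local_lift (h : IsTDualPair C₁ C₂ nat₁ nat₂) {d : ℕ}
    (hleaves : ∀ m, Module.finrank ℝ
      (C.anchorImage K₁ m ⊓ C.anchorImage K₂ m : Submodule ℝ (TSp B m)) = d)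
    {D₁ : ∀ q : Q₁, Submodule ℝ (TSp B₁ q)}
    (hD₁ : ∀ m, D₁ (ϖ₁ m) = (C.anchorImage K₂ m).map (dMap B B₁ ϖ₁ m)) (σ : Splitting C₁)
    {X : ∀ q : Q₁, TSp B₁ q} {m : M}
    (hX : ∀ᶠ q in 𝓝 (ϖ₁ m), SmoothSecAt B₁ B₁ X q ∧ X q ∈ D₁ q) {v : TSp B m}
    (hv : v ∈ C.anchorImage K₂ m) (hvX : dMap B B₁ ϖ₁ m v = X (ϖ₁ m)) :
    ∃ Y : ∀ y : M, TSp B y, (∀ᶠ y in 𝓝 m, SmoothSecAt B B Y y ∧ Y y ∈ C.anchorImage K₂ y ∧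
      dMap B B₁ ϖ₁ y (Y y) = X (ϖ₁ y)) ∧ Y m = v := by
  have hfd : ∀ y : M, FiniteDimensional ℝ (TSp B y) := fun y => finiteDimensional_tangent y
  obtain ⟨X', hX'⟩ := exists_sec_eventuallyEq (hX.mono fun q hq => hq.1)
  obtain ⟨e, he⟩ := h.red₁.exists_secRel (σ.sec X')
  obtain ⟨a, ha, rfl⟩ := hv
  obtain ⟨k, hk, rfl⟩ := h.red₂.subbundle.2 m a ha
  have hcont := (h.red₁.smooth_proj m).continuousAt
  have hdX : ∀ᶠ y in 𝓝 m, dMap B B₁ ϖ₁ y (C.anchor y (e y)) = X (ϖ₁ y) := by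
    filter_upwards [hcont.eventually hX'] with y hy
    rw [← h.red₁.anchor_eq (he y), Splitting.sec_apply, σ.right_inverse, hy]
  have hker : ∀ y w, dMap B B₁ ϖ₁ y w = 0 → w ∈ C.anchorImage K₁ y := fun y w hw => by
    rw [← h.red₁.ker_proj y]; exact hw
  have hker' : ∀ y, ∀ w ∈ C.anchorImage K₁ y, dMap B B₁ ϖ₁ y w = 0 := fun y w hw => by
    rw [← h.red₁.ker_proj y] at hw; exact hw
  -- The field ρ(e) projects to `X`, and ρ(k) is a section of ρ(K₂) with the prescribed value at
  -- `m`. Their difference lies in ρ(K₁) + ρ(K₂) near `m`, and in ρ(K₁) at `m`. Adding its K₂-part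
  -- to ρ(k) corrects the projection without changing the value at `m`.
  let Z := C.anchorSec (e - k)
  have hZ : ∀ y, Z y = C.anchor y (e y) - C.anchor y (k y) := fun y => by simp [Z]
  -- The number `N` is the rank of the sum: each ρ(Kᵢ) is the kernel of dϖᵢ and has dimension dim M
  -- - dim Qᵢ, and the intersection has constant dimension `d`.
  obtain ⟨Y, hY, hYm⟩ := exists_local_decomposition (C := C) (m := m) (Z := Z)
    (N := Module.finrank ℝ B - Module.finrank ℝ B₁ + (Module.finrank ℝ B - Module.finrank ℝ B₂) - d)
    h.red₁.subbundle h.red₂.subbundle (fun y => by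
      have h1 := Submodule.finrank_sup_add_finrank_inf_eq (C.anchorImage K₁ y) (C.anchorImage K₂ y)
      have h2 := h.red₁.finrank_anchorImage y
      have h3 := h.red₂.finrank_anchorImage y
      rw [hleaves y] at h1
      omega) (by
      filter_upwards [hdX, hcont.eventually hX] with y hy hy'
      have h1 := hy'.2
      rw [hD₁ y] at h1
      obtain ⟨w, hw, hw'⟩ := h1
      have h2 : C.anchor y (e y) - w ∈ C.anchorImage K₁ y := hker y _ (by rw [map_sub, hy, hw', sub_self])
      have h3 : w - C.anchor y (k y) ∈ C.anchorImage K₂ y := Submodule.sub_mem _ hw ⟨_, hk y, rfl⟩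
      have h4 := Submodule.add_mem_sup h2 h3
      rwa [sub_add_sub_cancel, ← hZ] at h4) (by
      refine hker m _ ?_
      rw [hZ, map_sub, hdX.self_of_nhds, hvX, sub_self])
  refine ⟨fun y => C.anchor y (k y) + Y y, ?_, by simp [hYm]⟩
  filter_upwards [hY, hdX] with y hy hy'
  refine ⟨((C.anchorSec k).smoothSecAt y).add hy.1, Submodule.add_mem _ ⟨_, hk y, rfl⟩ hy.2.1, ?_⟩
  have h1 := hker' y _ hy.2.2
  rw [hZ, map_sub, map_sub, hy'] at h1
  rw [map_add]
  rw [sub_sub, sub_eq_zero] at h1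
  exact h1.symm

/-- The lift of a vector field over an open set to a section of `ρ(K₂)` with prescribed value at a
point. -/
lemma IsTDualPair.exists_lift_on [SecondCountableTopology M] (h : IsTDualPair C₁ C₂ nat₁ nat₂)
    {d : ℕ} (hleaves : ∀ m, Module.finrank ℝ
      (C.anchorImage K₁ m ⊓ C.anchorImage K₂ m : Submodule ℝ (TSp B m)) = d)
    {D₁ : ∀ q : Q₁, Submodule ℝ (TSp B₁ q)}
    (hD₁ : ∀ m, D₁ (ϖ₁ m) = (C.anchorImage K₂ m).map (dMap B B₁ ϖ₁ m)) (σ : Splitting C₁)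
    {U : Set Q₁} (hU : IsOpen U) {X : ∀ q : Q₁, TSp B₁ q}
    (hX : ∀ q ∈ U, SmoothSecAt B₁ B₁ X q ∧ X q ∈ D₁ q) {m : M} {v : TSp B m}
    (hv : v ∈ C.anchorImage K₂ m) (hvX : dMap B B₁ ϖ₁ m v = X (ϖ₁ m)) (hm : ϖ₁ m ∈ U) :
    ∃ Y : ∀ y : M, TSp B y, (∀ y, ϖ₁ y ∈ U → SmoothSecAt B B Y y ∧ Y y ∈ C.anchorImage K₂ y ∧
      dMap B B₁ ϖ₁ y (Y y) = X (ϖ₁ y)) ∧ Y m = v := by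
  -- Both lifting conditions are affine in the vector, so the admissible sets are convex and local
  -- lifts can be averaged. The last clause imposes the prescribed value at `m`; near any other
  -- point, which has a neighbourhood avoiding `m`, it is vacuous.
  let t : ∀ y : M, Set (TSp B y) := fun y => {w | w ∈ C.anchorImage K₂ y ∧
    dMap B B₁ ϖ₁ y w = X (ϖ₁ y) ∧ ∀ h : m = y, w = h ▸ v}
  have ht : ∀ y, Convex ℝ (t y) := by
    rintro y w ⟨h1, h2, h3⟩ w' ⟨h1', h2', h3'⟩ a b ha hb hab
    refine ⟨Submodule.add_mem _ (Submodule.smul_mem _ _ h1) (Submodule.smul_mem _ _ h1'), ?_, ?_⟩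
    · rw [map_add, map_smul, map_smul, h2, h2', ← add_smul, hab, one_smul]
    · rintro rfl
      rw [h3 rfl, h3' rfl, ← add_smul, hab, one_smul]
  obtain ⟨Y, hY⟩ := exists_smoothSecAt_of_local (B := B) (F := B)
    ⟨ϖ₁ ⁻¹' U, hU.preimage h.red₁.smooth_proj.continuous⟩ t ht (by
      intro y hy
      have hXy : ∀ᶠ q in 𝓝 (ϖ₁ y), SmoothSecAt B₁ B₁ X q ∧ X q ∈ D₁ q := by
        filter_upwards [hU.mem_nhds hy] with q hq using hX q hq
      by_cases hym : m = y
      · subst hym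
        obtain ⟨Y, h1, h2⟩ := h.exists_local_lift hleaves hD₁ σ hXy hv hvX
        refine ⟨Y, h1.mono fun z hz => ⟨hz.1, hz.2.1, hz.2.2, ?_⟩⟩
        rintro rfl
        exact h2
      · have h3 := hXy.self_of_nhds.2
        rw [hD₁ y] at h3
        obtain ⟨w, hw, hw'⟩ := h3
        obtain ⟨Y, h1, h2⟩ := h.exists_local_lift hleaves hD₁ σ hXy hw hw'
        refine ⟨Y, ?_⟩
        filter_upwards [h1, isOpen_ne.mem_nhds (Ne.symm hym)] with z hz hzm
        exact ⟨hz.1, hz.2.1, hz.2.2, fun h => absurd h.symm hzm⟩)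
  exact ⟨Y, fun y hy => ⟨(hY y hy).1, (hY y hy).2.1, (hY y hy).2.2.1⟩, (hY m hm).2.2.2 rfl⟩

end Lifts

/-! ### Descent of invariant sections and functions to the second quotient. -/

section Invariance

variable {B : Type*} [NormedAddCommGroup B] [NormedSpace ℝ B] [FiniteDimensional ℝ B]
  {M : Type*} [TopologicalSpace M] [T2Space M] [ChartedSpace B M] [IsManifold 𝓘(ℝ, B) ∞ M]
  {F : Type*} [NormedAddCommGroup F] [NormedSpace ℝ F] [FiniteDimensional ℝ F]
  {V : M → Type*} [TopologicalSpace (TotalSpace F V)]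
  [∀ x, AddCommGroup (V x)] [∀ x, Module ℝ (V x)] [∀ x, TopologicalSpace (V x)]
  [FiberBundle F V] [VectorBundle ℝ F V] [ContMDiffVectorBundle ∞ F V 𝓘(ℝ, B)]
  {B₁ : Type*} [NormedAddCommGroup B₁] [NormedSpace ℝ B₁] [FiniteDimensional ℝ B₁]
  {Q₁ : Type*} [TopologicalSpace Q₁] [T2Space Q₁] [ChartedSpace B₁ Q₁] [IsManifold 𝓘(ℝ, B₁) ∞ Q₁]
  {F₁ : Type*} [NormedAddCommGroup F₁] [NormedSpace ℝ F₁] [FiniteDimensional ℝ F₁]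
  {V₁ : Q₁ → Type*} [TopologicalSpace (TotalSpace F₁ V₁)]
  [∀ x, AddCommGroup (V₁ x)] [∀ x, Module ℝ (V₁ x)] [∀ x, TopologicalSpace (V₁ x)]
  [FiberBundle F₁ V₁] [VectorBundle ℝ F₁ V₁] [ContMDiffVectorBundle ∞ F₁ V₁ 𝓘(ℝ, B₁)]
  {B₂ : Type*} [NormedAddCommGroup B₂] [NormedSpace ℝ B₂] [FiniteDimensional ℝ B₂]
  {Q₂ : Type*} [TopologicalSpace Q₂] [T2Space Q₂] [ChartedSpace B₂ Q₂] [IsManifold 𝓘(ℝ, B₂) ∞ Q₂]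
  {F₂ : Type*} [NormedAddCommGroup F₂] [NormedSpace ℝ F₂] [FiniteDimensional ℝ F₂]
  {V₂ : Q₂ → Type*} [TopologicalSpace (TotalSpace F₂ V₂)]
  [∀ x, AddCommGroup (V₂ x)] [∀ x, Module ℝ (V₂ x)] [∀ x, TopologicalSpace (V₂ x)]
  [FiberBundle F₂ V₂] [VectorBundle ℝ F₂ V₂] [ContMDiffVectorBundle ∞ F₂ V₂ 𝓘(ℝ, B₂)]
  {C : CourantAlgebroid B F V} {C₁ : CourantAlgebroid B₁ F₁ V₁} {C₂ : CourantAlgebroid B₂ F₂ V₂}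
  {K₁ K₂ : ∀ x, Submodule ℝ (V x)} {ϖ₁ : M → Q₁} {ϖ₂ : M → Q₂}
  {nat₁ : ∀ m, C.perp K₁ m →ₗ[ℝ] V₁ (ϖ₁ m)} {nat₂ : ∀ m, C.perp K₂ m →ₗ[ℝ] V₂ (ϖ₂ m)}

section OneReduction

variable {K : ∀ x, Submodule ℝ (V x)} {nat : ∀ m, C.perp K m →ₗ[ℝ] V₁ (ϖ₁ m)}

/-- A form pulled back from the quotient kills ker dϖ = ρ(K), so its image under `rhoStar` is
orthogonal to K; pairing with lifts identifies what it descends to. -/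
lemma IsReduction.natRel_rhoStar (hr : IsReduction C K ϖ₁ C₁ nat) {m : M}
    {α : TSp B m →ₗ[ℝ] ℝ} {β : TSp B₁ (ϖ₁ m) →ₗ[ℝ] ℝ}
    (h : ∀ v, α v = β (dMap B B₁ ϖ₁ m v)) : NatRel nat m (C.rhoStar m α) (C₁.rhoStar (ϖ₁ m) β) := by
  have h1 : C.rhoStar m α ∈ C.perp K m := by
    intro k hk
    have h2 : C.anchor m k ∈ LinearMap.ker (dMap B B₁ ϖ₁ m) := by
      rw [hr.ker_proj m]; exact ⟨k, hk, rfl⟩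
    rw [C.pairing_symm, C.pairing_rhoStar, h, LinearMap.mem_ker.1 h2, map_zero]
  have h3 : NatRel nat m (C.rhoStar m α) (nat m ⟨_, h1⟩) := ⟨h1, rfl⟩
  have h4 : nat m ⟨_, h1⟩ = C₁.rhoStar (ϖ₁ m) β := by
    refine C₁.pairing_ext fun b => ?_
    obtain ⟨a, ha⟩ := hr.exists_natRel b
    rw [hr.pairing_eq h3 ha, C.pairing_rhoStar, C₁.pairing_rhoStar, h, hr.anchor_eq ha]
  rwa [h4] at h3

/-- The adjoint action of an adapted splitting descends to the one of the induced splitting. -/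
lemma IsReduction.natRel_ad (hr : IsReduction C K ϖ₁ C₁ nat) {σ : Splitting C}
    {σred : Splitting C₁} (hσ : ∀ m v, σ.toFun m v ∈ C.perp K m)
    (hσred : IsInducedSplitting nat σ σred) {a e : Sec B F V} {a₁ e₁ : Sec B₁ F₁ V₁}
    (ha : SecRel nat a a₁) (he : SecRel nat e e₁) (m : M) :
    NatRel nat m (σ.ad a e m) (σred.ad a₁ e₁ (ϖ₁ m)) := by
  have hs : ∀ m v, NatRel nat m (σ.toFun m v) (σred.toFun (ϖ₁ m) (dMap B B₁ ϖ₁ m v)) :=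
    fun m v => ⟨hσ m v, (hσred m v _).symm⟩
  have h1 : SecRel nat (σ.sigmaRho e) (σred.sigmaRho e₁) := by
    intro y
    rw [σ.sigmaRho_apply, σred.sigmaRho_apply, hr.anchor_eq (he y)]
    exact hs y _
  refine (hr.secRel_bracket ha he m).sub (hr.natRel_rhoStar fun v => ?_)
  exact (hr.pairing_eq (hr.secRel_bracket ha h1 m) (hs m v)).symm

/-- For an exact Courant algebroid, an adapted splitting maps `ρ(K)` to `K`. -/
lemma Splitting.apply_anchor_of_mem (hC : C.IsExact)
    {σ : Splitting C} (hσ : ∀ m v, σ.toFun m v ∈ C.perp K m) {m : M} {k : V m} (hk : k ∈ K m) :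
    σ.toFun m (C.anchor m k) = k := by
  have h1 : C.anchor m (k - σ.toFun m (C.anchor m k)) = 0 := by
    rw [map_sub, σ.right_inverse, sub_self]
  obtain ⟨α, hα⟩ := ((hC m).2.2 _).1 h1
  -- By exactness k - σ(ρ(k)) comes from a form α. Its values α(v) are pairings with σ(v), which
  -- vanish because σ is isotropic with values in K^⊥.
  have h2 : α = 0 := by
    ext v
    have h3 := C.pairing_rhoStar α (σ.toFun m v)
    rw [hα, σ.right_inverse, map_sub, LinearMap.sub_apply, σ.isotropic, hσ m v k hk] at h3
    simpa using h3.symm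
  have h4 : C.rhoStar m α = 0 := C.pairing_ext fun c => by simp [h2]
  rw [h4] at hα
  exact (sub_eq_zero.1 hα.symm).symm

end OneReduction

namespace IsTDualPair

/-- Every vector in `K₁^⊥ ∩ K₂^⊥` extends to a section. -/
lemma exists_sec_perp (h : IsTDualPair C₁ C₂ nat₁ nat₂) {m : M} {w : V m}
    (hw₁ : w ∈ C.perp K₁ m) (hw₂ : w ∈ C.perp K₂ m) :
    ∃ s : Sec B F V, IsSecOf (C.perp K₁) s ∧ IsSecOf (C.perp K₂) s ∧ s m = w := by
  obtain ⟨s₁, hs₁⟩ := exists_sec_apply_eq (B := B₁) (F := F₁) (nat₁ m ⟨w, hw₁⟩)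
  obtain ⟨s, hs, hs'⟩ := h.exists_secRel s₁
  refine ⟨s, fun y => (hs y).1, hs', sub_eq_zero.1 (h.trans₁ m _ ?_ (Submodule.sub_mem _ (hs' m) hw₂))⟩
  refine h.red₁.mem_of_natRel ?_
  have h1 := (hs m).sub (⟨hw₁, rfl⟩ : NatRel nat₁ m w _)
  rwa [hs₁, sub_self] at h1

/-- A section of `K₁^⊥ ∩ K₂^⊥` is `K₂`-basic if every element of `K₂` at every point is the value of
a section of `K₂` whose bracket with it is in `K₁` at the point. -/
lemma isBasic_right (h : IsTDualPair C₁ C₂ nat₁ nat₂) {e : Sec B F V}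
    (he₂ : IsSecOf (C.perp K₂) e)
    (hb : ∀ m, ∀ k ∈ K₂ m, ∃ s : Sec B F V, IsSecOf K₂ s ∧ s m = k ∧ C.bracket s e m ∈ K₁ m) :
    IsBasic C K₂ e := by
  refine ⟨he₂, fun k hk m => ?_⟩
  -- Since `e` is orthogonal to K₂, the pairing is moved to ⟨k, ⟦e, w⟧⟩, where `k` is not
  -- differentiated. Only its value at `m` matters, so it may be exchanged for the section supplied
  -- by `hb`.
  have hswap : ∀ k : Sec B F V, IsSecOf K₂ k → ∀ w : Sec B F V, IsSecOf (C.perp K₂) w →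
      C.pairing m (C.bracket k e m) (w m) = C.pairing m (k m) (C.bracket e w m) := by
    intro k hk w hw
    have h1 := C.invariance e k w m
    have h2 : (fun y => C.pairing y (k y) (w y)) = fun _ => 0 := by
      funext y; exact hw y _ (hk y)
    rw [h2, dirDeriv_const,
      C.bracket_swap_of_orthogonal (a := k) (b := e) fun y => he₂ y _ (hk y)] at h1
    have h3 : (-C.bracket k e) m = -(C.bracket k e m) := rfl
    rw [h3, map_neg, LinearMap.neg_apply] at h1
    linarith
  rw [← C.perp_perp K₂ m]
  intro b hb'
  rw [C.pairing_symm]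
  -- K₂^⊥ splits into K₂ and K₁^⊥ ∩ K₂^⊥. The first part is harmless because K₂ is isotropic and
  -- involutive, so only the second has to be tested.
  obtain ⟨k', hk', hw⟩ := exists_sub_mem_perp m (h.rank m).symm (h.trans₂ m) b
  have hw' : b - k' ∈ C.perp K₂ m := Submodule.sub_mem _ hb' (h.red₂.isotropic m hk')
  have h1 : C.pairing m (C.bracket k e m) k' = 0 := by
    obtain ⟨s, hs, rfl⟩ := h.red₂.subbundle.2 m k' hk'
    have h2 := C.invariance k e s m
    have h3 : (fun y => C.pairing y (e y) (s y)) = fun _ => 0 := by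
      funext y; rw [C.pairing_symm]; exact he₂ y _ (hs y)
    have h4 : C.pairing m (e m) (C.bracket k s m) = 0 := by
      rw [C.pairing_symm]
      exact he₂ m _ ((h.red₂.isBasic_of_isSecOf hs).2 k hk m)
    rw [h3, dirDeriv_const, h4, add_zero] at h2
    exact h2.symm
  have h2 : C.pairing m (C.bracket k e m) (b - k') = 0 := by
    obtain ⟨w, hw1, hw2, hwm⟩ := h.exists_sec_perp hw hw'
    obtain ⟨s, hs, hsm, hse⟩ := hb m (k m) (hk m)
    rw [← hwm, hswap k hk w hw2, ← hsm, ← hswap s hs w hw2]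
    exact hw1 m _ hse
  have h3 := congrArg₂ (· + ·) h1 h2
  simpa using h3

variable [SecondCountableTopology M] {D₁ : ∀ q : Q₁, Submodule ℝ (TSp B₁ q)}
  {ι : Type*} {U : ι → Set Q₁} {r : ι → ℕ} {X : ∀ i, Fin (r i) → ∀ q : Q₁, TSp B₁ q}
  {σ₁ σ₂ : Splitting C} {σred : Splitting C₁}

/-- Locally invariant sections of the first reduced bundle are related to sections of the second
one. -/
lemma exists_relSec (h : IsTDualPair C₁ C₂ nat₁ nat₂) (hC : C.IsExact) {d : ℕ}
    (hleaves : ∀ m, Module.finrank ℝ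
      (C.anchorImage K₁ m ⊓ C.anchorImage K₂ m : Submodule ℝ (TSp B m)) = d)
    (hD₁ : ∀ m, D₁ (ϖ₁ m) = (C.anchorImage K₂ m).map (dMap B B₁ ϖ₁ m))
    (hU : ∀ i, IsOpen (U i)) (hcover : ⋃ i, U i = univ)
    (hXsmooth : ∀ i k, SmoothVFOn B₁ (X i k) (U i))
    (hXspan : ∀ i, ∀ q ∈ U i, Submodule.span ℝ (range fun k => X i k q) = D₁ q)
    (hσ₁ : IsAdapted B₁ σ₁ K₁ ϖ₁) (hσ₂ : IsAdapted B₂ σ₂ K₂ ϖ₂)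
    (hcompat : IsLocCompatible B₁ σ₁ σ₂ K₂ ϖ₁ U X) (hσred : IsInducedSplitting nat₁ σ₁ σred)
    {e₁ : Sec B₁ F₁ V₁} (he₁ : IsLocInvSec σred U X e₁) : ∃ e₂ : Sec B₂ F₂ V₂, RelSec nat₁ nat₂ e₁ e₂ := by
  obtain ⟨e, he, heperp⟩ := h.exists_secRel e₁
  suffices hb : IsBasic C K₂ e by
    obtain ⟨e₂, he₂⟩ := h.red₂.exists_descent hb
    exact ⟨e₂, RelSec.of_secRel he he₂⟩
  refine h.isBasic_right heperp fun m k hk => ?_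
  obtain ⟨i, hi⟩ : ∃ i, ϖ₁ m ∈ U i := mem_iUnion.1 (hcover ▸ mem_univ (ϖ₁ m))
  have hXs : ∀ k, ∀ q ∈ U i, SmoothSecAt B₁ B₁ (X i k) q := fun k q hq =>
    (hXsmooth i k q hq).contMDiffAt ((hU i).mem_nhds hq)
  have hkD : dMap B B₁ ϖ₁ m (C.anchor m k) ∈ D₁ (ϖ₁ m) := by
    rw [hD₁ m]
    exact ⟨_, ⟨k, hk, rfl⟩, rfl⟩
  rw [← hXspan i _ hi, Submodule.mem_span_range_iff_exists_fun] at hkD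
  obtain ⟨c, hc⟩ := hkD
  -- The coefficients are frozen at their values at the point: local compatibility concerns real
  -- combinations of the generators, and only the value of ρ(k) at `m` has to be matched.
  let Xc : ∀ q : Q₁, TSp B₁ q := fun q => ∑ k, c k • X i k q
  obtain ⟨Y, hY, hYm⟩ := h.exists_lift_on hleaves hD₁ σred (hU i) (X := Xc) (m := m)
    (v := C.anchor m k) (fun q hq => ⟨SmoothSecAt.sum fun k _ =>
        SmoothSecAt.smul smoothAt_const (hXs k q hq), by
      rw [← hXspan i q hq]
      exact Submodule.sum_mem _ fun k _ => Submodule.smul_mem _ _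
        (Submodule.subset_span ⟨k, rfl⟩)⟩) ⟨k, hk, rfl⟩ hc.symm hi
  obtain ⟨ψ, hψ1, hψU⟩ := exists_bump (B := B₁) ((hU i).mem_nhds hi)
  have hψ0 : ∀ q, q ∉ U i → ψ q = 0 := fun q hq =>
    image_eq_zero_of_notMem_tsupport fun hq' => hq (hψU hq')
  have hψs : ContMDiff 𝓘(ℝ, B) 𝓘(ℝ, ℝ) ∞ fun y => ψ (ϖ₁ y) :=
    ψ.contMDiff.comp h.red₁.smooth_proj
  have hΩ : IsOpen (ϖ₁ ⁻¹' U i) := (hU i).preimage h.red₁.smooth_proj.continuous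
  have hts : tsupport (fun y => ψ (ϖ₁ y)) ⊆ ϖ₁ ⁻¹' U i := by
    refine Subset.trans (closure_minimal (t := ϖ₁ ⁻¹' tsupport ψ) ?_
      ((isClosed_tsupport ψ).preimage h.red₁.smooth_proj.continuous)) fun y hy => hψU hy
    intro y hy
    exact subset_tsupport _ hy
  -- The lift and the generators exist only over `U i`. A bump function pulled back from the base
  -- makes them global without changing the germs at `m` and at ϖ₁(m).
  let Y' : Sec B B (TangentSpace 𝓘(ℝ, B) : M → Type _) :=
    ⟨fun y => ψ (ϖ₁ y) • Y y, ContMDiffOn.smul_section_of_tsupport hψs.contMDiffOn hΩ hts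
      fun y hy => (hY y hy).1.contMDiffWithinAt⟩
  let Xk : Fin (r i) → Sec B₁ B₁ (TangentSpace 𝓘(ℝ, B₁) : Q₁ → Type _) := fun k =>
    ⟨fun q => ψ q • X i k q, ContMDiffOn.smul_section_of_tsupport ψ.contMDiff.contMDiffOn (hU i)
      hψU fun q hq => (hXs k q hq).contMDiffWithinAt⟩
  have hY' : ∀ y, Y' y = ψ (ϖ₁ y) • Y y := fun y => rfl
  have hXk : ∀ k q, Xk k q = ψ q • X i k q := fun k q => rfl
  have hYX : ∀ y, dMap B B₁ ϖ₁ y (Y' y) = ∑ k, c k • Xk k (ϖ₁ y) := by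
    intro y
    by_cases hy : ϖ₁ y ∈ U i
    · simp only [hY', map_smul, (hY y hy).2.2, Xc, hXk, Finset.smul_sum]
      exact Finset.sum_congr rfl fun k _ => smul_comm _ _ _
    · simp [hY', hXk, hψ0 _ hy]
  have hYK : ∀ y, Y' y ∈ C.anchorImage K₂ y := by
    intro y
    by_cases hy : ϖ₁ y ∈ U i
    · exact Submodule.smul_mem _ _ (hY y hy).2.1
    · rw [hY', hψ0 _ hy, zero_smul]
      exact Submodule.zero_mem _
  have hYev : ∀ᶠ y in 𝓝 m, Y' y = Y y := by
    filter_upwards [(h.red₁.smooth_proj m).continuousAt.eventually hψ1] with y hy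
    rw [hY', hy, one_smul]
  have hmem : IsSecOf K₂ (σ₂.sec Y') := by
    intro y
    obtain ⟨k', hk', hk''⟩ := hYK y
    rw [Splitting.sec_apply, ← hk'', Splitting.apply_anchor_of_mem hC hσ₂.mem_perp hk']
    exact hk'
  -- An adapted splitting is inverse to the anchor on K₂, so σ₂ applied to ρ(k) gives back `k`.
  have hval : σ₂.sec Y' m = k := by
    rw [Splitting.sec_apply, hYev.self_of_nhds, hYm,
      Splitting.apply_anchor_of_mem hC hσ₂.mem_perp hk]
  refine ⟨σ₂.sec Y', hmem, hval, ?_⟩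
  have hbr : C.bracket (σ₂.sec Y') e m = σ₁.ad (σ₁.sec Y') e m :=
    hcompat i Y (fun y hy => (hY y hy).1.contMDiffWithinAt) (fun y hy => (hY y hy).2.1)
      ⟨c, fun y hy => (hY y hy).2.2⟩ m hi _ _ e
      (hYev.mono fun y hy => by rw [Splitting.sec_apply, hy])
      (hYev.mono fun y hy => by rw [Splitting.sec_apply, hy])
  rw [hbr]
  let a₁ : Sec B₁ F₁ V₁ := ∑ k, c k • σred.sec (Xk k)
  have ha₁ : SecRel nat₁ (σ₁.sec Y') a₁ := by
    intro y
    refine ⟨hσ₁.mem_perp y _, ?_⟩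
    have h1 := hσred y (Y' y) (hσ₁.mem_perp y _)
    rw [hYX y] at h1
    refine h1.symm.trans ?_
    simp [a₁]
  have hnat := h.red₁.natRel_ad hσ₁.mem_perp hσred ha₁ he m
  -- The invariance of `e₁` enters here. The bracket therefore descends to zero in the first
  -- reduction, that is, it lies in K₁ at `m`.
  have hzero : σred.ad a₁ e₁ (ϖ₁ m) = 0 := by
    rw [σred.ad_sum_left]
    refine Finset.sum_eq_zero fun k _ => ?_
    rw [σred.ad_smul_left, he₁ i k (ϖ₁ m) hi (σred.sec (Xk k)) ?_, smul_zero]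
    filter_upwards [hψ1] with q hq
    rw [Splitting.sec_apply, hXk, hq, one_smul]
  rw [hzero] at hnat
  exact h.red₁.mem_of_natRel hnat

/-- Functions which are constant along the local generators descend to the second quotient. -/
lemma exists_related_fun (h : IsTDualPair C₁ C₂ nat₁ nat₂)
    (hD₁ : ∀ m, D₁ (ϖ₁ m) = (C.anchorImage K₂ m).map (dMap B B₁ ϖ₁ m))
    (hcover : ⋃ i, U i = univ)
    (hXspan : ∀ i, ∀ q ∈ U i, Submodule.span ℝ (range fun k => X i k q) = D₁ q)
    {f : SmoothFun B₁ Q₁} (hf : ∀ i k, ∀ q ∈ U i, dirDeriv B₁ f q (X i k q) = 0) :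
    ∃ g : SmoothFun B₂ Q₂, ∀ m, f (ϖ₁ m) = g (ϖ₂ m) := by
  have hsm : ∀ m, SmoothAt B (fun y => f (ϖ₁ y)) m := fun m =>
    (f.contMDiff.comp h.red₁.smooth_proj) m
  -- Vectors tangent to the fibres of ϖ₂ lie in ρ(K₂) and project into D₁, along which `f` has zero
  -- derivative. Connectedness of the fibres then makes the pull-back constant on them.
  have hconst : ∀ {m m' : M}, ϖ₂ m = ϖ₂ m' → f (ϖ₁ m) = f (ϖ₁ m') := fun {m m'} =>
    eq_on_fiber h.red₂.smooth_proj h.red₂.submersion h.red₂.connected_leaves hsm fun m v hv => by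
      have hv' : v ∈ C.anchorImage K₂ m := by rw [← h.red₂.ker_proj m]; exact hv
      obtain ⟨i, hi⟩ : ∃ i, ϖ₁ m ∈ U i := mem_iUnion.1 (hcover ▸ mem_univ (ϖ₁ m))
      have h1 : dMap B B₁ ϖ₁ m v ∈ Submodule.span ℝ (range fun k => X i k (ϖ₁ m)) := by
        rw [hXspan i _ hi, hD₁ m]
        exact ⟨v, hv', rfl⟩
      rw [dirDeriv_comp (f.smoothAt _).mdifferentiableAt
        ((h.red₁.smooth_proj m).mdifferentiableAt (by simp))]
      have h2 : Submodule.span ℝ (range fun k => X i k (ϖ₁ m)) ≤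
          LinearMap.ker (dForm B₁ f (ϖ₁ m)) := by
        rw [Submodule.span_le]
        rintro _ ⟨k, rfl⟩
        exact hf i k _ hi
      exact h2 h1
  have hg : ∀ m, f (ϖ₁ (Function.surjInv h.red₂.surjective_proj (ϖ₂ m))) = f (ϖ₁ m) := fun m =>
    hconst (Function.surjInv_eq h.red₂.surjective_proj (ϖ₂ m))
  refine ⟨⟨fun q => f (ϖ₁ (Function.surjInv h.red₂.surjective_proj q)), fun q => ?_⟩,
    fun m => (hg m).symm⟩
  obtain ⟨m, rfl⟩ := h.red₂.surjective_proj q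
  refine smoothAt_of_comp h.red₂.smooth_proj (h.red₂.submersion m)
    (g := fun q => f (ϖ₁ (Function.surjInv h.red₂.surjective_proj q))) ?_
  simp only [hg]
  exact hsm m

end IsTDualPair

end Invariance

/-! ### Divergences with prescribed values on spanning sections. -/

section PrescribedDivergence

variable {B : Type*} [NormedAddCommGroup B] [NormedSpace ℝ B] [FiniteDimensional ℝ B]
  {M : Type*} [TopologicalSpace M] [T2Space M] [ChartedSpace B M] [IsManifold 𝓘(ℝ, B) ∞ M]
  {F : Type*} [NormedAddCommGroup F] [NormedSpace ℝ F] [FiniteDimensional ℝ F]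
  {V : M → Type*} [TopologicalSpace (TotalSpace F V)]
  [∀ x, AddCommGroup (V x)] [∀ x, Module ℝ (V x)] [∀ x, TopologicalSpace (V x)]
  [FiberBundle F V] [VectorBundle ℝ F V] [ContMDiffVectorBundle ∞ F V 𝓘(ℝ, B)]
  {C : CourantAlgebroid B F V}

variable (C) in
/-- The divergence at `x` of the section with coefficients `f` with respect to the frame `b`, if the
members of the frame have divergences `g`. -/
def frameDiv {ι : Type*} [Fintype ι] (b : ι → Sec B F V) (g f : ι → SmoothFun B M) (x : M) : ℝ :=
  ∑ j, (f j x * g j x + dirDeriv B (f j) x (C.anchor x (b j x)))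

lemma smoothAt_frameDiv {ι : Type*} [Fintype ι] (b : ι → Sec B F V) (g f : ι → SmoothFun B M)
    (x : M) : SmoothAt B (frameDiv C b g f) x :=
  SmoothAt.sum fun j _ => (((f j).smoothAt x).mul ((g j).smoothAt x)).add
    ((C.lieFun (b j) (f j)).smoothAt x)

/-- The coefficients with respect to a frame are unique near a point. -/
lemma eventually_coeff_eq {ι : Type*} [Fintype ι] {b : ι → Sec B F V} {x : M}
    (hli : LinearIndependent ℝ fun j => b j x) {f f' : ι → M → ℝ}
    (h : ∀ᶠ y in 𝓝 x, ∑ j, f j y • b j y = ∑ j, f' j y • b j y) :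
    ∀ᶠ y in 𝓝 x, ∀ j, f j y = f' j y := by
  have hev := eventually_linearIndependent (B := B) (F := F) (e := fun j y => b j y)
    (fun j => (b j).smoothSecAt x) hli
  filter_upwards [hev, h] with y hy h1 j
  have h2 : ∑ j, (f j y - f' j y) • b j y = 0 := by
    simp only [sub_smul, Finset.sum_sub_distrib, h1, sub_self]
  exact sub_eq_zero.1 (Fintype.linearIndependent_iff.1 hy _ h2 j)

/-- The coefficients change by f_j = ∑ f'_i G_ij. In the derivative of this product the terms
differentiating `G` are absorbed by the consistency of the prescribed values `g'`, and the others
are the derivatives of f' along the new frame. -/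
lemma frameDiv_change {ι κ : Type*} [Fintype ι] [Fintype κ] {b : ι → Sec B F V}
    {b' : κ → Sec B F V} {g : ι → SmoothFun B M} {g' : κ → SmoothFun B M} {x : M}
    (hli : LinearIndependent ℝ fun j => b j x) {G : κ → ι → SmoothFun B M}
    (hG : ∀ i, ∀ᶠ y in 𝓝 x, b' i y = ∑ j, G i j y • b j y)
    (hg : ∀ i, g' i x = frameDiv C b g (G i) x) {f : ι → SmoothFun B M} {f' : κ → SmoothFun B M}
    (hf : ∀ᶠ y in 𝓝 x, ∑ j, f j y • b j y = ∑ i, f' i y • b' i y) :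
    frameDiv C b g f x = frameDiv C b' g' f' x := by
  have h1 : ∀ᶠ y in 𝓝 x, ∀ j, f j y = ∑ i, f' i y * G i j y := by
    refine eventually_coeff_eq hli ?_
    filter_upwards [hf, eventually_all.2 hG] with y h1 h2
    rw [h1]
    simp only [h2, Finset.smul_sum, Finset.sum_smul, mul_smul]
    exact Finset.sum_comm
  have h2 : ∀ j, f j x = ∑ i, f' i x * G i j x := h1.self_of_nhds
  have h3 : ∀ j v, dirDeriv B (f j) x v =
      ∑ i, (f' i x * dirDeriv B (G i j) x v + G i j x * dirDeriv B (f' i) x v) := by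
    intro j v
    rw [dirDeriv_congr (g := fun y => ∑ i, f' i y * G i j y) (h1.mono fun y hy => hy j),
      dirDeriv_sum _ fun i _ => ((f' i).smoothAt x).mul ((G i j).smoothAt x)]
    exact Finset.sum_congr rfl fun i _ => dirDeriv_mul ((f' i).smoothAt x) ((G i j).smoothAt x) v
  have h4 : ∀ i, dirDeriv B (f' i) x (C.anchor x (b' i x)) =
      ∑ j, G i j x * dirDeriv B (f' i) x (C.anchor x (b j x)) := by
    intro i
    rw [(hG i).self_of_nhds, map_sum, dirDeriv_sum_vec]
    simp only [map_smul, dirDeriv_smul_vec]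
  unfold frameDiv at hg ⊢
  simp only [hg, h4, h2, h3, Finset.sum_mul, Finset.mul_sum, ← Finset.sum_add_distrib]
  rw [Finset.sum_comm]
  exact Finset.sum_congr rfl fun i _ => Finset.sum_congr rfl fun j _ => by ring

/-- A divergence is determined by its values on sections which span the bundle; these can be
prescribed subject to the Leibniz rule. -/
lemma exists_divergence_of_prescribed (P : Set (Sec B F V × SmoothFun B M))
    (hspan : ∀ x, ∀ a : V x, a ∈ Submodule.span ℝ {b | ∃ s ∈ Prod.fst '' P, s x = b})
    (hcons : ∀ (x : M) (b : Fin (Module.finrank ℝ F) → Sec B F V)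
      (g f : Fin (Module.finrank ℝ F) → SmoothFun B M) (e : Sec B F V) (g₀ : SmoothFun B M),
      (∀ j, (b j, g j) ∈ P) → (e, g₀) ∈ P → LinearIndependent ℝ (fun j => b j x) →
      (∀ᶠ y in 𝓝 x, e y = ∑ j, f j y • b j y) → g₀ x = frameDiv C b g f x) :
    ∃ dv : Divergence C, ∀ p ∈ P, dv.toFun p.1 = p.2 := by
  have hframe : ∀ x, ∃ (b : Fin (Module.finrank ℝ F) → Sec B F V)
      (g : Fin (Module.finrank ℝ F) → SmoothFun B M), (∀ j, (b j, g j) ∈ P) ∧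
      LinearIndependent ℝ fun j => b j x := by
    intro x
    obtain ⟨b, hb, hli⟩ := exists_frame_of_span (hspan x)
    choose p hp hpb using hb
    refine ⟨b, fun j => (p j).2, fun j => ?_, hli⟩
    rw [← hpb j]
    exact hp j
  choose b g hP hli using hframe
  choose f hf using fun (e : Sec B F V) x => exists_coeff (b x) (hli x) (by simp) e
  let D : Sec B F V → M → ℝ := fun e x => frameDiv C (b x) (g x) (f e x) x
  -- The value does not depend on the admissible frame. Hence the frame chosen at `x` also computes
  -- the values at nearby points, which gives smoothness.
  have hD : ∀ (e : Sec B F V) (x : M) (b' : Fin (Module.finrank ℝ F) → Sec B F V)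
      (g' f' : Fin (Module.finrank ℝ F) → SmoothFun B M), (∀ j, (b' j, g' j) ∈ P) →
      (∀ᶠ y in 𝓝 x, e y = ∑ j, f' j y • b' j y) → D e x = frameDiv C b' g' f' x := by
    intro e x b' g' f' hP' hf'
    choose G hG using fun i => exists_coeff (b x) (hli x) (by simp) (b' i)
    refine frameDiv_change (hli x) hG (fun i => hcons x _ _ _ _ _ (hP x) (hP' i) (hli x) (hG i)) ?_
    filter_upwards [hf e x, hf'] with y h1 h2
    rw [← h1, ← h2]
  have hDs : ∀ e x, SmoothAt B (D e) x := by
    intro e x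
    refine ContMDiffAt.congr_of_eventuallyEq (smoothAt_frameDiv (C := C) (b x) (g x) (f e x) x) ?_
    filter_upwards [(hf e x).eventually_nhds] with y hy
    exact hD e y _ _ _ (hP x) hy
  have hadd : ∀ e e' x, D (e + e') x = D e x + D e' x := by
    intro e e' x
    rw [hD (e + e') x (b x) (g x) (fun j => f e x j + f e' x j) (hP x) (by
      filter_upwards [hf e x, hf e' x] with y h1 h2
      rw [sec_add_apply, h1, h2, ← Finset.sum_add_distrib]
      exact Finset.sum_congr rfl fun j _ => (add_smul _ _ _).symm)]
    simp only [D, frameDiv, ← Finset.sum_add_distrib]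
    refine Finset.sum_congr rfl fun j _ => ?_
    have h1 := dirDeriv_add ((f e x j).smoothAt x) ((f e' x j).smoothAt x)
      (C.anchor x (b x j x))
    have h2 : (f e x j + f e' x j : SmoothFun B M) x = f e x j x + f e' x j x := rfl
    have h3 : ((f e x j + f e' x j : SmoothFun B M) : M → ℝ) = fun y => f e x j y + f e' x j y := rfl
    rw [h2, h3, h1]
    ring
  have hleib : ∀ (h : SmoothFun B M) e x,
      D (funSmul h e) x = h x * D e x + dirDeriv B h x (C.anchor x (e x)) := by
    intro h e x
    rw [hD (funSmul h e) x (b x) (g x) (fun j => h * f e x j) (hP x) (by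
      filter_upwards [hf e x] with y h1
      rw [funSmul_apply, h1, Finset.smul_sum]
      exact Finset.sum_congr rfl fun j _ => (mul_smul _ _ _).symm)]
    have h4 : dirDeriv B h x (C.anchor x (e x)) =
        ∑ j, f e x j x * dirDeriv B h x (C.anchor x (b x j x)) := by
      rw [(hf e x).self_of_nhds, map_sum, dirDeriv_sum_vec]
      simp only [map_smul, dirDeriv_smul_vec]
    rw [h4]
    simp only [D, frameDiv, Finset.mul_sum, ← Finset.sum_add_distrib]
    refine Finset.sum_congr rfl fun j _ => ?_
    have h1 := dirDeriv_mul (h.smoothAt x) ((f e x j).smoothAt x) (C.anchor x (b x j x))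
    have h2 : (h * f e x j : SmoothFun B M) x = h x * f e x j x := rfl
    have h3 : ((h * f e x j : SmoothFun B M) : M → ℝ) = fun y => h y * f e x j y := rfl
    rw [h2, h3, h1]
    ring
  refine ⟨⟨{ toFun := fun e => ⟨D e, hDs e⟩, map_add' := fun e e' => ?_,
             map_smul' := fun c e => ?_ }, hleib⟩, ?_⟩
  · ext x; exact hadd e e' x
  · ext x
    have h1 := hleib (ContMDiffMap.const c) e x
    have h2 : funSmul (ContMDiffMap.const c : SmoothFun B M) e = c • e := rfl
    have h3 : ((ContMDiffMap.const c : SmoothFun B M) : M → ℝ) = fun _ => c := rfl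
    rw [h2, h3, dirDeriv_const, add_zero] at h1
    exact h1
  · rintro ⟨e, g₀⟩ hp
    ext x
    exact (hcons x _ _ _ _ _ (hP x) hp (hli x) (hf e x)).symm

end PrescribedDivergence

/-! ### Existence and uniqueness of the dual metric and divergence. -/

section Dual

variable {B : Type*} [NormedAddCommGroup B] [NormedSpace ℝ B] [FiniteDimensional ℝ B]
  {M : Type*} [TopologicalSpace M] [T2Space M] [ChartedSpace B M] [IsManifold 𝓘(ℝ, B) ∞ M]
  {F : Type*} [NormedAddCommGroup F] [NormedSpace ℝ F] [FiniteDimensional ℝ F]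
  {V : M → Type*} [TopologicalSpace (TotalSpace F V)]
  [∀ x, AddCommGroup (V x)] [∀ x, Module ℝ (V x)] [∀ x, TopologicalSpace (V x)]
  [FiberBundle F V] [VectorBundle ℝ F V] [ContMDiffVectorBundle ∞ F V 𝓘(ℝ, B)]
  {B₁ : Type*} [NormedAddCommGroup B₁] [NormedSpace ℝ B₁] [FiniteDimensional ℝ B₁]
  {Q₁ : Type*} [TopologicalSpace Q₁] [T2Space Q₁] [ChartedSpace B₁ Q₁] [IsManifold 𝓘(ℝ, B₁) ∞ Q₁]
  {F₁ : Type*} [NormedAddCommGroup F₁] [NormedSpace ℝ F₁] [FiniteDimensional ℝ F₁]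
  {V₁ : Q₁ → Type*} [TopologicalSpace (TotalSpace F₁ V₁)]
  [∀ x, AddCommGroup (V₁ x)] [∀ x, Module ℝ (V₁ x)] [∀ x, TopologicalSpace (V₁ x)]
  [FiberBundle F₁ V₁] [VectorBundle ℝ F₁ V₁] [ContMDiffVectorBundle ∞ F₁ V₁ 𝓘(ℝ, B₁)]
  {B₂ : Type*} [NormedAddCommGroup B₂] [NormedSpace ℝ B₂] [FiniteDimensional ℝ B₂]
  {Q₂ : Type*} [TopologicalSpace Q₂] [T2Space Q₂] [ChartedSpace B₂ Q₂] [IsManifold 𝓘(ℝ, B₂) ∞ Q₂]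
  {F₂ : Type*} [NormedAddCommGroup F₂] [NormedSpace ℝ F₂] [FiniteDimensional ℝ F₂]
  {V₂ : Q₂ → Type*} [TopologicalSpace (TotalSpace F₂ V₂)]
  [∀ x, AddCommGroup (V₂ x)] [∀ x, Module ℝ (V₂ x)] [∀ x, TopologicalSpace (V₂ x)]
  [FiberBundle F₂ V₂] [VectorBundle ℝ F₂ V₂] [ContMDiffVectorBundle ∞ F₂ V₂ 𝓘(ℝ, B₂)]
  {C : CourantAlgebroid B F V} {C₁ : CourantAlgebroid B₁ F₁ V₁} {C₂ : CourantAlgebroid B₂ F₂ V₂}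
  {K₁ K₂ : ∀ x, Submodule ℝ (V x)} {ϖ₁ : M → Q₁} {ϖ₂ : M → Q₂}
  {nat₁ : ∀ m, C.perp K₁ m →ₗ[ℝ] V₁ (ϖ₁ m)} {nat₂ : ∀ m, C.perp K₂ m →ₗ[ℝ] V₂ (ϖ₂ m)}

variable (B₂ F₂) in
/-- A set of sections of the first reduced bundle which spans it and whose members are related to
sections of the second reduced bundle. -/
structure IsSpanningRel (nat₁ : ∀ m, C.perp K₁ m →ₗ[ℝ] V₁ (ϖ₁ m))
    (nat₂ : ∀ m, C.perp K₂ m →ₗ[ℝ] V₂ (ϖ₂ m)) (S : Set (Sec B₁ F₁ V₁)) : Prop where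
  span : ∀ q, ∀ a : V₁ q, a ∈ Submodule.span ℝ {b | ∃ s ∈ S, s q = b}
  rel : ∀ e₁ ∈ S, ∃ e₂ : Sec B₂ F₂ V₂, RelSec nat₁ nat₂ e₁ e₂

namespace IsTDualPair

lemma finrank_eq (h : IsTDualPair C₁ C₂ nat₁ nat₂) (m : M) :
    Module.finrank ℝ F₁ = Module.finrank ℝ F₂ := by
  obtain ⟨φ, -⟩ := h.exists_transfer m
  rw [← finrank_fiber (F := F₁) (V := V₁) (ϖ₁ m), φ.finrank_eq, finrank_fiber (F := F₂) (V := V₂) (ϖ₂ m)]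

lemma linearIndependent_iff (h : IsTDualPair C₁ C₂ nat₁ nat₂) {κ : Type*} {b₁ : κ → Sec B₁ F₁ V₁}
    {b₂ : κ → Sec B₂ F₂ V₂} (hb : ∀ i, RelSec nat₁ nat₂ (b₁ i) (b₂ i)) (m : M) :
    LinearIndependent ℝ (fun i => b₁ i (ϖ₁ m)) ↔ LinearIndependent ℝ (fun i => b₂ i (ϖ₂ m)) := by
  obtain ⟨φ, hφ⟩ := h.exists_transfer m
  have h1 : (fun i => b₂ i (ϖ₂ m)) = φ.toLinearMap ∘ fun i => b₁ i (ϖ₁ m) := by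
    funext i
    exact ((hφ _ _).1 (hb i m)).symm
  rw [h1]
  exact (φ.toLinearMap.linearIndependent_iff (LinearEquiv.ker φ)).symm

lemma exists_frame (h : IsTDualPair C₁ C₂ nat₁ nat₂) {S : Set (Sec B₁ F₁ V₁)}
    (hS : IsSpanningRel B₂ F₂ nat₁ nat₂ S) (m : M) :
    ∃ (b₁ : Fin (Module.finrank ℝ F₁) → Sec B₁ F₁ V₁)
      (b₂ : Fin (Module.finrank ℝ F₁) → Sec B₂ F₂ V₂), (∀ i, b₁ i ∈ S) ∧
      (∀ i, RelSec nat₁ nat₂ (b₁ i) (b₂ i)) ∧ (LinearIndependent ℝ fun i => b₁ i (ϖ₁ m)) ∧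
      LinearIndependent ℝ fun i => b₂ i (ϖ₂ m) := by
  obtain ⟨b₁, hb, hli⟩ := exists_frame_of_span (hS.span (ϖ₁ m))
  choose b₂ hb₂ using fun i => hS.rel (b₁ i) (hb i)
  exact ⟨b₁, b₂, hb, hb₂, hli, (h.linearIndependent_iff hb₂ m).1 hli⟩

/-- Coefficients of related sections with respect to related frames are related. -/
lemma coeff_related (h : IsTDualPair C₁ C₂ nat₁ nat₂) {κ : Type*} [Fintype κ]
    {b₁ : κ → Sec B₁ F₁ V₁} {b₂ : κ → Sec B₂ F₂ V₂} (hb : ∀ i, RelSec nat₁ nat₂ (b₁ i) (b₂ i))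
    {m : M} (hli : LinearIndependent ℝ fun i => b₁ i (ϖ₁ m)) {e₁ : Sec B₁ F₁ V₁}
    {e₂ : Sec B₂ F₂ V₂} (he : RelSec nat₁ nat₂ e₁ e₂) {f₁ : κ → SmoothFun B₁ Q₁}
    {f₂ : κ → SmoothFun B₂ Q₂} (hf₁ : ∀ᶠ y in 𝓝 (ϖ₁ m), e₁ y = ∑ i, f₁ i y • b₁ i y)
    (hf₂ : ∀ᶠ y in 𝓝 (ϖ₂ m), e₂ y = ∑ i, f₂ i y • b₂ i y) :
    ∀ᶠ y in 𝓝 m, ∀ i, f₁ i (ϖ₁ y) = f₂ i (ϖ₂ y) := by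
  have hev := eventually_linearIndependent (B := B₁) (F := F₁) (e := fun i y => b₁ i y)
    (fun i => (b₁ i).smoothSecAt _) hli
  have hc₁ := (h.red₁.smooth_proj m).continuousAt
  have hc₂ := (h.red₂.smooth_proj m).continuousAt
  filter_upwards [hc₁.eventually hev, hc₁.eventually hf₁, hc₂.eventually hf₂] with y h1 h2 h3 i
  obtain ⟨φ, hφ⟩ := h.exists_transfer y
  have h4 : φ (e₁ (ϖ₁ y)) = e₂ (ϖ₂ y) := (hφ _ _).1 (he y)
  have h5 : ∀ i, φ (b₁ i (ϖ₁ y)) = b₂ i (ϖ₂ y) := fun i => (hφ _ _).1 (hb i y)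
  have h6 : φ (∑ i, (f₁ i (ϖ₁ y) - f₂ i (ϖ₂ y)) • b₁ i (ϖ₁ y)) = 0 := by
    simp only [sub_smul, Finset.sum_sub_distrib, map_sub]
    rw [← h2, h4, h3, map_sum]
    simp only [map_smul, h5, sub_self]
  have h7 := (map_eq_zero_iff φ φ.injective).1 h6
  exact sub_eq_zero.1 (Fintype.linearIndependent_iff.1 h1 _ h7 i)

/-- The divergence of a related section in terms of a related frame. -/
lemma div_eq_frameDiv (h : IsTDualPair C₁ C₂ nat₁ nat₂) {κ : Type*} [Fintype κ]
    {b₁ : κ → Sec B₁ F₁ V₁} {b₂ : κ → Sec B₂ F₂ V₂} (hb : ∀ i, RelSec nat₁ nat₂ (b₁ i) (b₂ i))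
    {m : M} (hli : LinearIndependent ℝ fun i => b₁ i (ϖ₁ m))
    (hcard : Fintype.card κ = Module.finrank ℝ F₁) {e₁ : Sec B₁ F₁ V₁}
    {e₂ : Sec B₂ F₂ V₂} (he : RelSec nat₁ nat₂ e₁ e₂) {f₂ g : κ → SmoothFun B₂ Q₂}
    (hf₂ : ∀ᶠ y in 𝓝 (ϖ₂ m), e₂ y = ∑ i, f₂ i y • b₂ i y) {dv₁ : Divergence C₁}
    (hg : ∀ i, dv₁.toFun (b₁ i) (ϖ₁ m) = g i (ϖ₂ m)) :
    dv₁.toFun e₁ (ϖ₁ m) = frameDiv C₂ b₂ g f₂ (ϖ₂ m) := by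
  obtain ⟨f₁, hf₁⟩ := exists_coeff b₁ hli hcard e₁
  have hf := h.coeff_related hb hli he hf₁ hf₂
  rw [dv₁.apply_of_eq_sum hf₁, frameDiv]
  refine Finset.sum_congr rfl fun i _ => ?_
  rw [hg, hf.self_of_nhds i, h.dirDeriv_eq (hb i m) ((f₁ i).smoothAt _) ((f₂ i).smoothAt _)
    (hf.mono fun y hy => hy i)]

variable {τ₁ : GenMetric C₁} {τ₂ : GenMetric C₂} {dv₁ : Divergence C₁} {dv₂ : Divergence C₂}

/-- The T-duality relation is a generalised isometry if and only if it is compatible with the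
generalised metrics. -/
lemma isGenIsometry_iff (h : IsTDualPair C₁ C₂ nat₁ nat₂) :
    IsGenIsometry (TDualRel nat₁ nat₂) τ₁ τ₂ ↔ ∀ (q₁ : Q₁) (q₂ : Q₂) (a : V₁ q₁) (b : V₂ q₂),
      TDualRel nat₁ nat₂ q₁ q₂ a b →
        TDualRel nat₁ nat₂ q₁ q₂ (τ₁.toFun q₁ a) (τ₂.toFun q₂ b) := by
  constructor
  · intro H q₁ q₂ a b hab
    obtain ⟨ap, am, bp, bm, ⟨hp, hp1, hp2⟩, ⟨hm, hm1, hm2⟩, rfl, rfl⟩ := (H q₁ q₂ a b).1 hab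
    rw [map_add, map_add, hp1, hp2, hm1, hm2, ← neg_one_smul ℝ am, ← neg_one_smul ℝ bm]
    exact h.linear _ _ _ _ _ _ hp (hm.smul (-1))
  · intro H q₁ q₂ a b
    constructor
    · intro hab
      have h1 := H _ _ _ _ hab
      refine ⟨_, _, _, _, ⟨(h.linear _ _ _ _ _ _ hab h1).smul (1 / 2), τ₁.memPlus_half a,
        τ₂.memPlus_half b⟩, ⟨(h.linear _ _ _ _ _ _ hab (h1.smul (-1))).smul (1 / 2), ?_, ?_⟩, ?_, ?_⟩
      · rw [neg_one_smul, ← sub_eq_add_neg]; exact τ₁.memMinus_half a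
      · rw [neg_one_smul, ← sub_eq_add_neg]; exact τ₂.memMinus_half b
      · module
      · module
    · rintro ⟨ap, am, bp, bm, ⟨hp, -, -⟩, ⟨hm, -, -⟩, rfl, rfl⟩
      exact h.linear _ _ _ _ _ _ hp hm

/-- Existence of the T-dual generalised metric. -/
lemma exists_dual_metric (h : IsTDualPair C₁ C₂ nat₁ nat₂) {S : Set (Sec B₁ F₁ V₁)}
    (hS : IsSpanningRel B₂ F₂ nat₁ nat₂ S) (τ₁ : GenMetric C₁) (hτ : ∀ e ∈ S, τ₁.map e ∈ S) :
    ∃ τ₂ : GenMetric C₂, IsGenIsometry (TDualRel nat₁ nat₂) τ₁ τ₂ := by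
  have hL : ∀ q : Q₂, ∃ L : V₂ q →ₗ[ℝ] V₂ q, ∀ e₁ ∈ S, ∀ e₂ e₂' : Sec B₂ F₂ V₂,
      RelSec nat₁ nat₂ e₁ e₂ → RelSec nat₁ nat₂ (τ₁.map e₁) e₂' → L (e₂ q) = e₂' q := by
    intro q
    obtain ⟨m, rfl⟩ := h.red₂.surjective_proj q
    obtain ⟨φ, hφ⟩ := h.exists_transfer m
    -- The metric is transported with the isometry at one chosen point `m` over `q`. Its values on
    -- sections related to members of `S` do not refer to that choice, so the transport agrees with
    -- the one at any other point of the fibre.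
    refine ⟨φ.toLinearMap ∘ₗ τ₁.toFun (ϖ₁ m) ∘ₗ φ.symm.toLinearMap, ?_⟩
    intro e₁ _ e₂ e₂' he he'
    have h1 := (hφ _ _).1 (he m)
    have h2 := (hφ _ _).1 (he' m)
    simpa [← h1] using h2
  choose L hL using hL
  have htrans : ∀ (q₁ : Q₁) (q₂ : Q₂) (a : V₁ q₁) (b : V₂ q₂), TDualRel nat₁ nat₂ q₁ q₂ a b →
      TDualRel nat₁ nat₂ q₁ q₂ (τ₁.toFun q₁ a) (L q₂ b) := by
    intro q₁ q₂ a b hab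
    obtain ⟨m, w, hw₁, hw₂⟩ := hab
    obtain ⟨φ, hφ⟩ := h.exists_transfer m
    have hab := TDualRel.mk (nat₁ := nat₁) (nat₂ := nat₂) m w hw₁ hw₂
    rw [hφ] at hab ⊢
    rw [← hab]
    have h1 : Submodule.span ℝ {b : V₁ (ϖ₁ m) | ∃ s ∈ S, s (ϖ₁ m) = b} ≤
        LinearMap.eqLocus (φ.toLinearMap ∘ₗ τ₁.toFun (ϖ₁ m)) (L (ϖ₂ m) ∘ₗ φ.toLinearMap) := by
      rw [Submodule.span_le]
      rintro _ ⟨e₁, he₁, rfl⟩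
      obtain ⟨e₂, he₂⟩ := hS.rel e₁ he₁
      obtain ⟨e₂', he₂'⟩ := hS.rel _ (hτ e₁ he₁)
      have h2 : φ (e₁ (ϖ₁ m)) = _ := (hφ _ _).1 (he₂ m)
      have h3 : φ (τ₁.toFun _ (e₁ (ϖ₁ m))) = _ := (hφ _ _).1 (he₂' m)
      change φ (τ₁.toFun _ (e₁ (ϖ₁ m))) = L (ϖ₂ m) (φ (e₁ (ϖ₁ m)))
      rw [h2, h3, hL _ e₁ he₁ e₂ e₂' he₂ he₂']
    exact h1 (hS.span _ _)
  have hpair : ∀ q (b b' : V₂ q), ∃ (q₁ : Q₁) (a a' : V₁ q₁),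
      C₂.pairing q b (L q b') = C₁.pairing q₁ a (τ₁.toFun q₁ a') ∧
      TDualRel nat₁ nat₂ q₁ q a b ∧ TDualRel nat₁ nat₂ q₁ q a' b' ∧
      C₂.pairing q b' (L q b) = C₁.pairing q₁ a' (τ₁.toFun q₁ a) := by
    intro q b b'
    obtain ⟨m, rfl⟩ := h.red₂.surjective_proj q
    obtain ⟨a, ha⟩ := h.symm.exists_right m b
    obtain ⟨a', ha'⟩ := h.symm.exists_right m b'
    exact ⟨_, a, a', (h.pairing_eq ha.symm (htrans _ _ _ _ ha'.symm)).symm, ha.symm, ha'.symm,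
      (h.pairing_eq ha'.symm (htrans _ _ _ _ ha.symm)).symm⟩
  refine ⟨⟨L, fun s q => ?_, fun q b => ?_, fun q b b' => ?_, fun q b hb => ?_⟩,
    h.isGenIsometry_iff.2 htrans⟩
  · obtain ⟨m, rfl⟩ := h.red₂.surjective_proj q
    obtain ⟨b₁, b₂, hbS, hb, -, hli⟩ := h.exists_frame hS m
    -- The set `S` is stable under the metric, so in a related frame the transported map sends
    -- smooth sections to smooth sections.
    choose b₂' hb₂' using fun i => hS.rel _ (hτ _ (hbS i))
    obtain ⟨f, hf⟩ := exists_coeff b₂ hli (by simp [h.finrank_eq m]) s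
    have hsum : SmoothSecAt B₂ F₂ (fun y => ∑ i, f i y • b₂' i y) (ϖ₂ m) :=
      SmoothSecAt.sum fun i _ => SmoothSecAt.smul ((f i).smoothAt _) ((b₂' i).smoothSecAt _)
    refine hsum.congr ?_
    filter_upwards [hf] with y hy
    rw [hy, map_sum]
    refine Finset.sum_congr rfl fun i _ => ?_
    rw [map_smul, hL y _ (hbS i) _ _ (hb i) (hb₂' i)]
  · obtain ⟨m, rfl⟩ := h.red₂.surjective_proj q
    obtain ⟨a, ha⟩ := h.symm.exists_right m b
    have h1 := htrans _ _ _ _ (htrans _ _ _ _ ha.symm)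
    rw [τ₁.involutive] at h1
    exact h.unique_right h1 ha.symm
  · obtain ⟨q₁, a, a', h1, -, -, h2⟩ := hpair q b b'
    rw [h1, h2, τ₁.symm]
  · obtain ⟨q₁, a, a', h1, h2, h3, -⟩ := hpair q b b
    rw [h1, h.unique_left h3 h2]
    refine τ₁.posDef _ _ fun ha => hb ?_
    exact h.eq_zero_right h2 ha

/-- Existence of the T-dual divergence. -/
lemma exists_dual_div (h : IsTDualPair C₁ C₂ nat₁ nat₂) {S : Set (Sec B₁ F₁ V₁)}
    (hS : IsSpanningRel B₂ F₂ nat₁ nat₂ S) (dv₁ : Divergence C₁)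
    (hdv : ∀ e ∈ S, ∃ g : SmoothFun B₂ Q₂, ∀ m, dv₁.toFun e (ϖ₁ m) = g (ϖ₂ m)) :
    ∃ dv₂ : Divergence C₂, IsRelatedDiv ϖ₁ ϖ₂ (TDualRel nat₁ nat₂) dv₁ dv₂ := by
  -- The prescribed data are the sections related to members of `S`, each with the descended
  -- divergence. Consistency with the Leibniz rule is inherited from `dv₁`, because coefficients in
  -- related frames have equal pull-backs to M.
  let P : Set (Sec B₂ F₂ V₂ × SmoothFun B₂ Q₂) := {p | ∃ e₁ ∈ S, RelSec nat₁ nat₂ e₁ p.1 ∧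
    ∀ m, dv₁.toFun e₁ (ϖ₁ m) = p.2 (ϖ₂ m)}
  obtain ⟨dv₂, hdv₂⟩ := exists_divergence_of_prescribed (C := C₂) P (by
    intro q b
    obtain ⟨m, rfl⟩ := h.red₂.surjective_proj q
    obtain ⟨b₁, b₂, hbS, hb, -, hli⟩ := h.exists_frame hS m
    have hfd : FiniteDimensional ℝ (V₂ (ϖ₂ m)) := finiteDimensional_fiber F₂ _
    have htop : Submodule.span ℝ (range fun i => b₂ i (ϖ₂ m)) = ⊤ :=
      hli.span_eq_top_of_card_eq_finrank' (by
        rw [finrank_fiber (F := F₂), ← h.finrank_eq m]; simp)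
    have h1 : b ∈ Submodule.span ℝ (range fun i => b₂ i (ϖ₂ m)) := htop ▸ Submodule.mem_top
    refine Submodule.span_mono ?_ h1
    rintro _ ⟨i, rfl⟩
    obtain ⟨g, hg⟩ := hdv _ (hbS i)
    exact ⟨b₂ i, ⟨(b₂ i, g), ⟨b₁ i, hbS i, hb i, hg⟩, rfl⟩, rfl⟩) (by
    intro q b g f e g₀ hb he hli hf
    obtain ⟨m, rfl⟩ := h.red₂.surjective_proj q
    choose b₁ hb₁ hrel hg using hb
    obtain ⟨e₁, -, he₁, hg₀⟩ := he
    rw [← hg₀ m]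
    exact h.div_eq_frameDiv hrel ((h.linearIndependent_iff hrel m).2 hli)
      (by simp [h.finrank_eq m]) he₁ hf fun i => hg i m)
  refine ⟨dv₂, fun e₁ e₂ he m => ?_⟩
  obtain ⟨b₁, b₂, hbS, hb, hli₁, hli⟩ := h.exists_frame hS m
  obtain ⟨f, hf⟩ := exists_coeff b₂ hli (by simp [h.finrank_eq m]) e₂
  rw [h.div_eq_frameDiv hb hli₁ (by simp) he hf (g := fun i => dv₂.toFun (b₂ i)) ?_,
    dv₂.apply_of_eq_sum hf, frameDiv]
  intro i
  obtain ⟨g, hg⟩ := hdv _ (hbS i)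
  rw [hg m]
  exact (DFunLike.congr_fun (hdv₂ (b₂ i, g) ⟨b₁ i, hbS i, hb i, hg⟩) (ϖ₂ m)).symm

lemma dual_metric_unique (h : IsTDualPair C₁ C₂ nat₁ nat₂) {τ₂' : GenMetric C₂}
    (hτ : IsGenIsometry (TDualRel nat₁ nat₂) τ₁ τ₂)
    (hτ' : IsGenIsometry (TDualRel nat₁ nat₂) τ₁ τ₂') : τ₂' = τ₂ := by
  refine GenMetric.ext_toFun fun q b => ?_
  obtain ⟨m, rfl⟩ := h.red₂.surjective_proj q
  obtain ⟨a, ha⟩ := h.symm.exists_right m b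
  exact h.unique_right (h.isGenIsometry_iff.1 hτ' _ _ _ _ ha.symm)
    (h.isGenIsometry_iff.1 hτ _ _ _ _ ha.symm)

/-- Near each point there is a frame of related sections, on which both candidates are forced; the
Leibniz rule determines all other values. -/
lemma dual_div_unique (h : IsTDualPair C₁ C₂ nat₁ nat₂) {S : Set (Sec B₁ F₁ V₁)}
    (hS : IsSpanningRel B₂ F₂ nat₁ nat₂ S) {dv₂' : Divergence C₂}
    (hdv : IsRelatedDiv ϖ₁ ϖ₂ (TDualRel nat₁ nat₂) dv₁ dv₂)
    (hdv' : IsRelatedDiv ϖ₁ ϖ₂ (TDualRel nat₁ nat₂) dv₁ dv₂') : dv₂' = dv₂ := by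
  ext e q
  obtain ⟨m, rfl⟩ := h.red₂.surjective_proj q
  obtain ⟨b₁, b₂, hbS, hb, -, hli⟩ := h.exists_frame hS m
  obtain ⟨f, hf⟩ := exists_coeff b₂ hli (by simp [h.finrank_eq m]) e
  rw [dv₂.apply_of_eq_sum hf, dv₂'.apply_of_eq_sum hf]
  refine Finset.sum_congr rfl fun i _ => ?_
  rw [← hdv _ _ (hb i) m, ← hdv' _ _ (hb i) m]

end IsTDualPair

end Dual

/-! ### A Gram-Schmidt process within a restricted class of sections. -/

section GramSchmidt

variable {B : Type*} [NormedAddCommGroup B] [NormedSpace ℝ B] [FiniteDimensional ℝ B]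
  {M : Type*} [TopologicalSpace M] [T2Space M] [ChartedSpace B M] [IsManifold 𝓘(ℝ, B) ∞ M]
  {F : Type*} [NormedAddCommGroup F] [NormedSpace ℝ F] [FiniteDimensional ℝ F]
  {V : M → Type*} [TopologicalSpace (TotalSpace F V)]
  [∀ x, AddCommGroup (V x)] [∀ x, Module ℝ (V x)] [∀ x, TopologicalSpace (V x)]
  [FiberBundle F V] [VectorBundle ℝ F V] [ContMDiffVectorBundle ∞ F V 𝓘(ℝ, B)]
  {C : CourantAlgebroid B F V}

/-- A smooth function of one variable which is the reciprocal of the square root of `ε s` near a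
point. -/
lemma exists_smooth_rsqrt {ε s₀ : ℝ} (h : 0 < ε * s₀) :
    ∃ k : SmoothFun ℝ ℝ, ∀ᶠ s in 𝓝 s₀, 0 < ε * s ∧ k s = (√(ε * s))⁻¹ := by
  have hev : ∀ᶠ s in 𝓝 s₀, 0 < ε * s :=
    (continuous_const.mul continuous_id).continuousAt.eventually (lt_mem_nhds h)
  obtain ⟨k, hk⟩ := exists_smoothFun_eventuallyEq (B := ℝ) (f := fun s => (√(ε * s))⁻¹) (x := s₀) (by
    filter_upwards [hev] with s hs
    refine ContDiffAt.contMDiffAt ?_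
    refine ContDiffAt.inv ?_ (Real.sqrt_pos.2 hs).ne'
    exact ContDiffAt.sqrt (by fun_prop) hs.ne')
  exact ⟨k, hev.and hk⟩

/-- The Gram-Schmidt process within a space of sections which is closed under multiplication by
smooth functions of the pairings of its elements. -/
lemma exists_orthonormal {𝒮 : Submodule ℝ (Sec B F V)} {𝒜 : Set (SmoothFun B M)}
    (hsmul : ∀ f ∈ 𝒜, ∀ s ∈ 𝒮, funSmul f s ∈ 𝒮) (hpair : ∀ s ∈ 𝒮, ∀ t ∈ 𝒮, C.pairFun s t ∈ 𝒜)
    (hcomp : ∀ (k : SmoothFun ℝ ℝ), ∀ f ∈ 𝒜, (k.comp f : SmoothFun B M) ∈ 𝒜) {ε : ℝ}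
    (hε : ε * ε = 1) {x : M} (hpos : ∀ s ∈ 𝒮, s x ≠ 0 → 0 < ε * C.pairing x (s x) (s x))
    (p : ℕ) (u : Fin p → Sec B F V) (hu : ∀ i, u i ∈ 𝒮)
    (hli : LinearIndependent ℝ fun i => u i x) :
    ∃ e : Fin p → Sec B F V, (∀ i, e i ∈ 𝒮) ∧
      (∀ᶠ y in 𝓝 x, ∀ a b, C.pairing y (e a y) (e b y) = if a = b then ε else 0) ∧
      ∀ i, e i x ∈ Submodule.span ℝ (range fun j => u j x) := by
  induction p with
  | zero => exact ⟨u, hu, Eventually.of_forall fun y a => a.elim0, fun i => i.elim0⟩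
  | succ p ih =>
    obtain ⟨hli', hlast⟩ := linearIndependent_finSucc'.1 hli
    obtain ⟨e, he, hort, hspan⟩ := ih (fun i => u i.castSucc) (fun i => hu _) hli'
    have hle : Submodule.span ℝ (range fun j : Fin p => u j.castSucc x) ≤
        Submodule.span ℝ (range fun j => u j x) :=
      Submodule.span_mono (by rintro _ ⟨j, rfl⟩; exact ⟨j.castSucc, rfl⟩)
    set t := u (Fin.last p) with ht
    -- The factor `ε` appears because the members already found have square `ε` instead of 1; with
    -- ε² = 1 the subtraction gives orthogonality for either sign.
    set v : Sec B F V := t - ∑ a, ε • funSmul (C.pairFun t (e a)) (e a) with hv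
    have hvS : v ∈ 𝒮 := Submodule.sub_mem _ (hu _) (Submodule.sum_mem _ fun a _ =>
      Submodule.smul_mem _ _ (hsmul _ (hpair _ (hu _) _ (he a)) _ (he a)))
    have hvy : ∀ y, v y = t y - ∑ a, ε • C.pairing y (t y) (e a y) • e a y := by
      intro y
      simp [hv]
    have hsum : ∑ a, ε • C.pairing x (t x) (e a x) • e a x ∈
        Submodule.span ℝ (range fun j : Fin p => u j.castSucc x) :=
      Submodule.sum_mem _ fun a _ => Submodule.smul_mem _ _ (Submodule.smul_mem _ _ (hspan a))
    have hvx : v x ≠ 0 := by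
      intro h0
      rw [hvy, sub_eq_zero] at h0
      refine hlast ?_
      rw [h0]
      exact hsum
    have hvort : ∀ᶠ y in 𝓝 x, ∀ b, C.pairing y (v y) (e b y) = 0 := by
      filter_upwards [hort] with y hy b
      rw [hvy]
      simp only [map_sub, map_sum, map_smul, LinearMap.sub_apply, LinearMap.sum_apply,
        LinearMap.smul_apply, hy, smul_eq_mul, mul_ite, mul_zero, Finset.sum_ite_eq',
        Finset.mem_univ, if_true]
      linear_combination (-(C.pairing y (t y) (e b y))) * hε
    -- The normalising function is a globally smooth `k` composed with ⟨v, v⟩, so it stays in `𝒜`.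
    -- It is the reciprocal square root only near the value at `x`, which suffices for a condition
    -- on germs.
    obtain ⟨k, hk⟩ := exists_smooth_rsqrt (hpos v hvS hvx)
    set w : Sec B F V := funSmul (k.comp (C.pairFun v v)) v with hw
    have hwy : ∀ y, w y = k (C.pairing y (v y) (v y)) • v y := fun y => rfl
    have hwS : w ∈ 𝒮 := hsmul _ (hcomp k _ (hpair _ hvS _ hvS)) _ hvS
    have hww : ∀ᶠ y in 𝓝 x, C.pairing y (w y) (w y) = ε := by
      have hc := (C.smoothAt_pairing v v x).continuousAt
      filter_upwards [hc.eventually hk] with y hy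
      obtain ⟨h1, h2⟩ := hy
      rw [hwy]
      simp only [map_smul, LinearMap.smul_apply, smul_eq_mul, h2]
      have h3 := Real.mul_self_sqrt h1.le
      have h4 := (Real.sqrt_pos.2 h1).ne'
      field_simp
      rw [sq, h3]
      linear_combination (-(C.pairing y (v y) (v y))) * hε
    refine ⟨Fin.snoc (α := fun _ => Sec B F V) e w, fun i => ?_, ?_, fun i => ?_⟩
    · refine Fin.lastCases ?_ (fun j => ?_) i
      · rw [Fin.snoc_last]; exact hwS
      · rw [Fin.snoc_castSucc]; exact he j
    · filter_upwards [hort, hvort, hww] with y h1 h2 h3 a b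
      have h4 : ∀ b, C.pairing y (w y) (e b y) = 0 := fun b => by
        rw [hwy, map_smul, LinearMap.smul_apply, h2, smul_zero]
      refine Fin.lastCases ?_ (fun a => ?_) a
      · refine Fin.lastCases ?_ (fun b => ?_) b
        · rw [Fin.snoc_last, h3, if_pos rfl]
        · rw [Fin.snoc_last, Fin.snoc_castSucc, h4, if_neg (Fin.castSucc_lt_last b).ne']
      · refine Fin.lastCases ?_ (fun b => ?_) b
        · rw [Fin.snoc_last, Fin.snoc_castSucc, C.pairing_symm, h4,
            if_neg (Fin.castSucc_lt_last a).ne]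
        · rw [Fin.snoc_castSucc, Fin.snoc_castSucc, h1]
          simp
    · refine Fin.lastCases ?_ (fun j => ?_) i
      · rw [Fin.snoc_last, hwy, hvy]
        exact Submodule.smul_mem _ _ (Submodule.sub_mem _ (Submodule.subset_span ⟨_, rfl⟩)
          (hle hsum))
      · rw [Fin.snoc_castSucc]
        exact hle (hspan j)

namespace GenMetric

variable (τ : GenMetric C)

/-- The ranks of `V⁺` and `V⁻` add up to the rank of the bundle. -/
lemma finrank_plus_add_finrank_minus (x : M) :
    Module.finrank ℝ (LinearMap.ker (τ.toFun x - LinearMap.id)) +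
      Module.finrank ℝ (LinearMap.ker (τ.toFun x + LinearMap.id)) = Module.finrank ℝ F := by
  have : FiniteDimensional ℝ (V x) := finiteDimensional_fiber F x
  rw [← finrank_fiber (F := F) (V := V) x]
  refine Submodule.finrank_add_eq_of_isCompl ⟨?_, ?_⟩
  · rw [Submodule.disjoint_def]
    intro a h1 h2
    rw [LinearMap.mem_ker, LinearMap.sub_apply, sub_eq_zero] at h1
    rw [LinearMap.mem_ker, LinearMap.add_apply, h1] at h2
    have h3 : (2 : ℝ) • a = 0 := by rw [two_smul]; exact h2
    exact (smul_eq_zero.1 h3).resolve_left two_ne_zero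
  · rw [codisjoint_iff, eq_top_iff]
    intro a _
    have h1 : a = (1 / 2 : ℝ) • (a + τ.toFun x a) + (1 / 2 : ℝ) • (a - τ.toFun x a) := by module
    rw [h1]
    refine Submodule.add_mem_sup ?_ ?_
    · rw [LinearMap.mem_ker, LinearMap.sub_apply, sub_eq_zero]
      exact τ.memPlus_half a
    · rw [LinearMap.mem_ker, LinearMap.add_apply]
      have := τ.memMinus_half a
      rw [MemMinus] at this
      rw [this]
      simp

lemma pairing_pos_of_memPlus {x : M} {a : V x} (h : τ.MemPlus a) (ha : a ≠ 0) :
    0 < C.pairing x a a := by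
  have := τ.posDef x a ha
  rwa [h] at this

lemma pairing_neg_of_memMinus {x : M} {a : V x} (h : τ.MemMinus a) (ha : a ≠ 0) :
    C.pairing x a a < 0 := by
  have := τ.posDef x a ha
  rw [h, map_neg] at this
  linarith

end GenMetric

end GramSchmidt

/-! ### Equality of the curvatures of T-dual data. -/

section Curvature

variable {B : Type*} [NormedAddCommGroup B] [NormedSpace ℝ B] [FiniteDimensional ℝ B]
  {M : Type*} [TopologicalSpace M] [T2Space M] [ChartedSpace B M] [IsManifold 𝓘(ℝ, B) ∞ M]
  {F : Type*} [NormedAddCommGroup F] [NormedSpace ℝ F] [FiniteDimensional ℝ F]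
  {V : M → Type*} [TopologicalSpace (TotalSpace F V)]
  [∀ x, AddCommGroup (V x)] [∀ x, Module ℝ (V x)] [∀ x, TopologicalSpace (V x)]
  [FiberBundle F V] [VectorBundle ℝ F V] [ContMDiffVectorBundle ∞ F V 𝓘(ℝ, B)]
  {B₁ : Type*} [NormedAddCommGroup B₁] [NormedSpace ℝ B₁] [FiniteDimensional ℝ B₁]
  {Q₁ : Type*} [TopologicalSpace Q₁] [T2Space Q₁] [ChartedSpace B₁ Q₁] [IsManifold 𝓘(ℝ, B₁) ∞ Q₁]
  {F₁ : Type*} [NormedAddCommGroup F₁] [NormedSpace ℝ F₁] [FiniteDimensional ℝ F₁]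
  {V₁ : Q₁ → Type*} [TopologicalSpace (TotalSpace F₁ V₁)]
  [∀ x, AddCommGroup (V₁ x)] [∀ x, Module ℝ (V₁ x)] [∀ x, TopologicalSpace (V₁ x)]
  [FiberBundle F₁ V₁] [VectorBundle ℝ F₁ V₁] [ContMDiffVectorBundle ∞ F₁ V₁ 𝓘(ℝ, B₁)]
  {B₂ : Type*} [NormedAddCommGroup B₂] [NormedSpace ℝ B₂] [FiniteDimensional ℝ B₂]
  {Q₂ : Type*} [TopologicalSpace Q₂] [T2Space Q₂] [ChartedSpace B₂ Q₂] [IsManifold 𝓘(ℝ, B₂) ∞ Q₂]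
  {F₂ : Type*} [NormedAddCommGroup F₂] [NormedSpace ℝ F₂] [FiniteDimensional ℝ F₂]
  {V₂ : Q₂ → Type*} [TopologicalSpace (TotalSpace F₂ V₂)]
  [∀ x, AddCommGroup (V₂ x)] [∀ x, Module ℝ (V₂ x)] [∀ x, TopologicalSpace (V₂ x)]
  [FiberBundle F₂ V₂] [VectorBundle ℝ F₂ V₂] [ContMDiffVectorBundle ∞ F₂ V₂ 𝓘(ℝ, B₂)]
  {C : CourantAlgebroid B F V} {C₁ : CourantAlgebroid B₁ F₁ V₁} {C₂ : CourantAlgebroid B₂ F₂ V₂}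
  {K₁ K₂ : ∀ x, Submodule ℝ (V x)} {ϖ₁ : M → Q₁} {ϖ₂ : M → Q₂}
  {nat₁ : ∀ m, C.perp K₁ m →ₗ[ℝ] V₁ (ϖ₁ m)} {nat₂ : ∀ m, C.perp K₂ m →ₗ[ℝ] V₂ (ϖ₂ m)}
  {τ₁ : GenMetric C₁} {τ₂ : GenMetric C₂} {dv₁ : Divergence C₁} {dv₂ : Divergence C₂}

section Related

variable {e₁ e₁' : Sec B₁ F₁ V₁} {e₂ e₂' : Sec B₂ F₂ V₂}

namespace RelSec

lemma map (hr : RelSec nat₁ nat₂ e₁ e₂) (h : IsTDualPair C₁ C₂ nat₁ nat₂)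
    (hτ : IsGenIsometry (TDualRel nat₁ nat₂) τ₁ τ₂) : RelSec nat₁ nat₂ (τ₁.map e₁) (τ₂.map e₂) :=
  fun m => h.isGenIsometry_iff.1 hτ _ _ _ _ (hr m)

lemma plus (hr : RelSec nat₁ nat₂ e₁ e₂) (h : IsTDualPair C₁ C₂ nat₁ nat₂)
    (hτ : IsGenIsometry (TDualRel nat₁ nat₂) τ₁ τ₂) :
    RelSec nat₁ nat₂ (τ₁.plus e₁) (τ₂.plus e₂) := (hr.add (hr.map h hτ) h).smul _

lemma minus (hr : RelSec nat₁ nat₂ e₁ e₂) (h : IsTDualPair C₁ C₂ nat₁ nat₂)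
    (hτ : IsGenIsometry (TDualRel nat₁ nat₂) τ₁ τ₂) :
    RelSec nat₁ nat₂ (τ₁.minus e₁) (τ₂.minus e₂) := (hr.sub (hr.map h hτ) h).smul _

lemma memPlus_right (hr : RelSec nat₁ nat₂ e₁ e₂) (h : IsTDualPair C₁ C₂ nat₁ nat₂)
    (hτ : IsGenIsometry (TDualRel nat₁ nat₂) τ₁ τ₂) (h₁ : ∀ q, τ₁.MemPlus (e₁ q)) (q : Q₂) :
    τ₂.MemPlus (e₂ q) := by
  obtain ⟨m, rfl⟩ := h.red₂.surjective_proj q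
  have h1 := hr.map h hτ m
  rw [τ₁.map_apply, h₁] at h1
  exact h.unique_right h1 (hr m)

lemma memMinus_right (hr : RelSec nat₁ nat₂ e₁ e₂) (h : IsTDualPair C₁ C₂ nat₁ nat₂)
    (hτ : IsGenIsometry (TDualRel nat₁ nat₂) τ₁ τ₂) (h₁ : ∀ q, τ₁.MemMinus (e₁ q)) (q : Q₂) :
    τ₂.MemMinus (e₂ q) := by
  obtain ⟨m, rfl⟩ := h.red₂.surjective_proj q
  have h1 := hr.map h hτ m
  rw [τ₁.map_apply, h₁] at h1
  have h2 := (hr m).smul (-1)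
  rw [neg_one_smul, neg_one_smul] at h2
  exact h.unique_right h1 h2

lemma div_eventuallyEq (hr : RelSec nat₁ nat₂ e₁ e₂)
    (hdv : IsRelatedDiv ϖ₁ ϖ₂ (TDualRel nat₁ nat₂) dv₁ dv₂) (m : M) :
    ∀ᶠ y in 𝓝 m, dv₁.toFun e₁ (ϖ₁ y) = dv₂.toFun e₂ (ϖ₂ y) :=
  Eventually.of_forall fun y => hdv e₁ e₂ hr y

end RelSec

end Related

namespace IsTDualPair

/-- Every vector is the value of a section which is related to a section of the other bundle. -/
lemma exists_relSec_apply_eq (h : IsTDualPair C₁ C₂ nat₁ nat₂) {S : Set (Sec B₁ F₁ V₁)}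
    (hS : IsSpanningRel B₂ F₂ nat₁ nat₂ S) {q : Q₁} (a : V₁ q) :
    ∃ (e₁ : Sec B₁ F₁ V₁) (e₂ : Sec B₂ F₂ V₂), RelSec nat₁ nat₂ e₁ e₂ ∧ e₁ q = a := by
  induction hS.span q a using Submodule.span_induction with
  | mem b hb =>
    obtain ⟨s, hs, rfl⟩ := hb
    obtain ⟨e₂, he₂⟩ := hS.rel s hs
    exact ⟨s, e₂, he₂, rfl⟩
  | zero => exact ⟨0, 0, fun m => TDualRel.of_natRel NatRel.zero NatRel.zero, rfl⟩
  | add a b _ _ ha hb =>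
    obtain ⟨e₁, e₂, h1, rfl⟩ := ha
    obtain ⟨e₁', e₂', h1', rfl⟩ := hb
    exact ⟨_, _, h1.add h1' h, rfl⟩
  | smul c a _ ha =>
    obtain ⟨e₁, e₂, h1, rfl⟩ := ha
    exact ⟨_, _, h1.smul c, rfl⟩

/-- The generalised Ricci tensors of T-dual data agree on related sections. -/
lemma GRic_eq (h : IsTDualPair C₁ C₂ nat₁ nat₂) {S : Set (Sec B₁ F₁ V₁)}
    (hS : IsSpanningRel B₂ F₂ nat₁ nat₂ S) (hτ : IsGenIsometry (TDualRel nat₁ nat₂) τ₁ τ₂)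
    (hdv : IsRelatedDiv ϖ₁ ϖ₂ (TDualRel nat₁ nat₂) dv₁ dv₂) {v₁ w₁ : Sec B₁ F₁ V₁}
    {v₂ w₂ : Sec B₂ F₂ V₂} (hv : RelSec nat₁ nat₂ v₁ v₂) (hw : RelSec nat₁ nat₂ w₁ w₂)
    (hv₁ : ∀ q, τ₁.MemPlus (v₁ q)) (hw₁ : ∀ q, τ₁.MemMinus (w₁ q)) (m : M) :
    GRic τ₁ dv₁ v₁ w₁ (ϖ₁ m) = GRic τ₂ dv₂ v₂ w₂ (ϖ₂ m) := by
  obtain ⟨A₁, hA₁⟩ := exists_isRicciEndo τ₁ hv₁ hw₁ (ϖ₁ m)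
  obtain ⟨A₂, hA₂⟩ := exists_isRicciEndo τ₂ (hv.memPlus_right h hτ hv₁)
    (hw.memMinus_right h hτ hw₁) (ϖ₂ m)
  obtain ⟨φ, hφ⟩ := h.exists_transfer m
  -- Every vector extends to a related section, on which both endomorphisms are given by the same
  -- operations. They are therefore conjugate under the isometry and have equal traces.
  have hconj : A₂ = φ.conj A₁ := by
    refine LinearMap.ext fun b => ?_
    obtain ⟨u₁, u₂, hu, hub⟩ := h.exists_relSec_apply_eq hS (φ.symm b)
    have h1 : φ (u₁ (ϖ₁ m)) = u₂ (ϖ₂ m) := (hφ _ _).1 (hu m)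
    have h2 : u₂ (ϖ₂ m) = b := by rw [← h1, hub, φ.apply_symm_apply]
    rw [LinearEquiv.conj_apply_apply, ← hub, ← h2, hA₁, hA₂]
    exact ((hφ _ _).1 ((((((hu.plus h hτ).bracket hw h).minus h hτ).bracket hv h).plus h hτ) m)).symm
  rw [GRic, GRic, hA₁.trace_eq, hA₂.trace_eq, hconj, LinearMap.trace_conj',
    hdv _ _ ((hw.bracket hv h).plus h hτ) m,
    h.dirDeriv_eq (hw m) (SmoothFun.smoothAt _ _) (SmoothFun.smoothAt _ _)
      (hv.div_eventuallyEq hdv m)]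

lemma scalarPart_eq (h : IsTDualPair C₁ C₂ nat₁ nat₂)
    (hdv : IsRelatedDiv ϖ₁ ϖ₂ (TDualRel nat₁ nat₂) dv₁ dv₂) {p q : ℕ}
    {e₁ : Fin p → Sec B₁ F₁ V₁} {e₂ : Fin p → Sec B₂ F₂ V₂} {f₁ : Fin q → Sec B₁ F₁ V₁}
    {f₂ : Fin q → Sec B₂ F₂ V₂} (he : ∀ i, RelSec nat₁ nat₂ (e₁ i) (e₂ i))
    (hf : ∀ i, RelSec nat₁ nat₂ (f₁ i) (f₂ i)) (m : M) :
    scalarPart dv₁ (ϖ₁ m) e₁ f₁ = scalarPart dv₂ (ϖ₂ m) e₂ f₂ := by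
  have h1 : ∀ a, dirDeriv B₁ (dv₁.toFun (e₁ a)) (ϖ₁ m) (C₁.anchor (ϖ₁ m) (e₁ a (ϖ₁ m))) =
      dirDeriv B₂ (dv₂.toFun (e₂ a)) (ϖ₂ m) (C₂.anchor (ϖ₂ m) (e₂ a (ϖ₂ m))) := fun a =>
    h.dirDeriv_eq (he a m) (SmoothFun.smoothAt _ _) (SmoothFun.smoothAt _ _)
      ((he a).div_eventuallyEq hdv m)
  have h2 : ∀ a, dv₁.toFun (e₁ a) (ϖ₁ m) = dv₂.toFun (e₂ a) (ϖ₂ m) := fun a => hdv _ _ (he a) m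
  have h3 : ∀ a b c, C₁.pairing (ϖ₁ m) (C₁.bracket (e₁ a) (e₁ b) (ϖ₁ m)) (e₁ c (ϖ₁ m)) =
      C₂.pairing (ϖ₂ m) (C₂.bracket (e₂ a) (e₂ b) (ϖ₂ m)) (e₂ c (ϖ₂ m)) := fun a b c =>
    h.pairing_eq ((he a).bracket (he b) h m) (he c m)
  have h4 : ∀ a b c, C₁.pairing (ϖ₁ m) (C₁.bracket (e₁ a) (e₁ b) (ϖ₁ m)) (f₁ c (ϖ₁ m)) =
      C₂.pairing (ϖ₂ m) (C₂.bracket (e₂ a) (e₂ b) (ϖ₂ m)) (f₂ c (ϖ₂ m)) := fun a b c =>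
    h.pairing_eq ((he a).bracket (he b) h m) (hf c m)
  simp only [scalarPart, h1, h2, h3, h4]

/-- Properties which hold on the fibres near a point hold near its projection. -/
lemma eventually_right (h : IsTDualPair C₁ C₂ nat₁ nat₂) {m : M} {p : Q₂ → Prop}
    (hp : ∀ᶠ y in 𝓝 m, p (ϖ₂ y)) : ∀ᶠ q in 𝓝 (ϖ₂ m), p q := by
  obtain ⟨s, h1, h2, h3⟩ := exists_local_section h.red₂.smooth_proj (h.red₂.submersion m)
  have h4 : ∀ᶠ q in 𝓝 (ϖ₂ m), p (ϖ₂ (s q)) :=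
    h1.continuousAt.eventually (p := fun y => p (ϖ₂ y)) (by rw [h2]; exact hp)
  filter_upwards [h3, h4] with q h5 h6
  rwa [h5] at h6

/-- Related orthonormal sections of eigenbundles. -/
lemma exists_related_orthonormal (h : IsTDualPair C₁ C₂ nat₁ nat₂) {S : Set (Sec B₁ F₁ V₁)}
    (hS : IsSpanningRel B₂ F₂ nat₁ nat₂ S) {ε : ℝ} (hε : ε * ε = 1)
    (hτ : IsGenIsometry (TDualRel nat₁ nat₂) τ₁ τ₂)
    (hpos : ∀ q (a : V₁ q), τ₁.toFun q a = ε • a → a ≠ 0 → 0 < ε * C₁.pairing q a a) (m : M) :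
    ∃ (e₁ : Fin (Module.finrank ℝ (LinearMap.ker (τ₁.toFun (ϖ₁ m) - ε • LinearMap.id))) →
        Sec B₁ F₁ V₁)
      (e₂ : Fin (Module.finrank ℝ (LinearMap.ker (τ₁.toFun (ϖ₁ m) - ε • LinearMap.id))) →
        Sec B₂ F₂ V₂), (∀ i, RelSec nat₁ nat₂ (e₁ i) (e₂ i)) ∧
      (∀ i q, τ₁.toFun q (e₁ i q) = ε • e₁ i q) ∧ (∀ i q, τ₂.toFun q (e₂ i q) = ε • e₂ i q) ∧
      (∀ᶠ y in 𝓝 (ϖ₁ m), ∀ a b, C₁.pairing y (e₁ a y) (e₁ b y) = if a = b then ε else 0) ∧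
      (∀ᶠ y in 𝓝 (ϖ₂ m), ∀ a b, C₂.pairing y (e₂ a y) (e₂ b y) = if a = b then ε else 0) := by
  -- Gram-Schmidt is run inside sections of one eigenbundle that have a partner over the second
  -- quotient. The allowed coefficients `𝒜` are functions with a partner, since a general function
  -- would destroy relatedness. Pairings of related sections are of this kind.
  let 𝒮 : Submodule ℝ (Sec B₁ F₁ V₁) :=
    { carrier := {e₁ | (∃ e₂ : Sec B₂ F₂ V₂, RelSec nat₁ nat₂ e₁ e₂) ∧
        ∀ q, τ₁.toFun q (e₁ q) = ε • e₁ q}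
      add_mem' := by
        rintro a b ⟨⟨a₂, ha⟩, ha'⟩ ⟨⟨b₂, hb⟩, hb'⟩
        exact ⟨⟨_, ha.add hb h⟩, fun q => by simp [ha', hb']⟩
      zero_mem' := ⟨⟨0, fun m => TDualRel.of_natRel NatRel.zero NatRel.zero⟩, fun q => by simp⟩
      smul_mem' := by
        rintro c a ⟨⟨a₂, ha⟩, ha'⟩
        exact ⟨⟨_, ha.smul c⟩, fun q => by simp [ha', smul_comm c ε]⟩ }
  let 𝒜 : Set (SmoothFun B₁ Q₁) := {f | ∃ g : SmoothFun B₂ Q₂, ∀ m, f (ϖ₁ m) = g (ϖ₂ m)}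
  have hfd : FiniteDimensional ℝ (V₁ (ϖ₁ m)) := finiteDimensional_fiber F₁ _
  let bas := Module.finBasis ℝ (LinearMap.ker (τ₁.toFun (ϖ₁ m) - ε • LinearMap.id))
  have hu : ∀ i, ∃ u ∈ 𝒮, u (ϖ₁ m) = bas i := by
    intro i
    obtain ⟨s₁, s₂, hs, hsi⟩ := h.exists_relSec_apply_eq hS (bas i : V₁ (ϖ₁ m))
    have h1 : τ₁.toFun (ϖ₁ m) (bas i) = ε • (bas i : V₁ (ϖ₁ m)) := by
      have := (bas i).2
      rwa [LinearMap.mem_ker, LinearMap.sub_apply, sub_eq_zero] at this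
    -- The projection to the eigenbundle for ε: it preserves relatedness and fixes the value at the
    -- point.
    refine ⟨(1 / 2 : ℝ) • (s₁ + ε • τ₁.map s₁),
      ⟨⟨_, (hs.add ((hs.map h hτ).smul ε) h).smul _⟩, fun q => ?_⟩, ?_⟩
    · simp only [sec_smul_apply, sec_add_apply, τ₁.map_apply, map_smul, map_add, τ₁.involutive]
      rw [smul_comm ε (1 / 2 : ℝ), smul_add ε, smul_smul ε ε, hε, one_smul, add_comm]
    · simp only [sec_smul_apply, sec_add_apply, τ₁.map_apply, hsi, h1]
      rw [smul_smul ε ε, hε]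
      module
  choose u huS hum using hu
  obtain ⟨e₁, he₁, hort, -⟩ := exists_orthonormal (C := C₁) (𝒮 := 𝒮) (𝒜 := 𝒜) (x := ϖ₁ m)
    (by
      rintro f ⟨g, hg⟩ s ⟨⟨s₂, hs⟩, hs'⟩
      exact ⟨⟨_, hs.funSmul hg⟩, fun q => by simp [hs', smul_comm (f q) ε]⟩)
    (by
      rintro s ⟨⟨s₂, hs⟩, -⟩ t ⟨⟨t₂, ht⟩, -⟩
      exact ⟨C₂.pairFun s₂ t₂, fun m => h.pairing_eq (hs m) (ht m)⟩)
    (by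
      rintro k f ⟨g, hg⟩
      exact ⟨k.comp g, fun m => congrArg k (hg m)⟩)
    hε (fun s hs => hpos _ _ (hs.2 _)) _ u huS (by
      simp only [hum]
      exact bas.linearIndependent.map' (Submodule.subtype _) (Submodule.ker_subtype _))
  choose e₂ he₂ using fun i => (he₁ i).1
  refine ⟨e₁, e₂, he₂, fun i => (he₁ i).2, fun i q => ?_, hort, h.eventually_right ?_⟩
  · obtain ⟨m, rfl⟩ := h.red₂.surjective_proj q
    have h1 := (he₂ i).map h hτ m
    rw [τ₁.map_apply, (he₁ i).2] at h1
    exact h.unique_right h1 ((he₂ i m).smul ε)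
  · filter_upwards [(h.red₁.smooth_proj m).continuousAt.eventually hort] with y hy a b
    rw [← hy a b]
    exact (h.pairing_eq (he₂ a y) (he₂ b y)).symm

/-- Related orthonormal frames. -/
lemma exists_related_orthoFrame (h : IsTDualPair C₁ C₂ nat₁ nat₂) {S : Set (Sec B₁ F₁ V₁)}
    (hS : IsSpanningRel B₂ F₂ nat₁ nat₂ S) (hτ : IsGenIsometry (TDualRel nat₁ nat₂) τ₁ τ₂)
    (m : M) : ∃ (p q : ℕ) (e₁ : Fin p → Sec B₁ F₁ V₁) (e₂ : Fin p → Sec B₂ F₂ V₂)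
      (f₁ : Fin q → Sec B₁ F₁ V₁) (f₂ : Fin q → Sec B₂ F₂ V₂),
      (∀ i, RelSec nat₁ nat₂ (e₁ i) (e₂ i)) ∧ (∀ i, RelSec nat₁ nat₂ (f₁ i) (f₂ i)) ∧
      IsOrthoFrame τ₁ (ϖ₁ m) e₁ f₁ ∧ IsOrthoFrame τ₂ (ϖ₂ m) e₂ f₂ := by
  obtain ⟨e₁, e₂, he, he₁, he₂, heo₁, heo₂⟩ := h.exists_related_orthonormal hS (ε := 1) (by norm_num)
    hτ (fun q a ha h0 => by
      rw [one_smul] at ha; rw [one_mul]; exact τ₁.pairing_pos_of_memPlus ha h0) m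
  obtain ⟨f₁, f₂, hf, hf₁, hf₂, hfo₁, hfo₂⟩ := h.exists_related_orthonormal hS (ε := -1)
    (by norm_num) hτ (fun q a ha h0 => by
      rw [neg_one_smul] at ha
      have := τ₁.pairing_neg_of_memMinus ha h0
      linarith) m
  have hrank := τ₁.finrank_plus_add_finrank_minus (ϖ₁ m)
  rw [show τ₁.toFun (ϖ₁ m) - LinearMap.id = τ₁.toFun (ϖ₁ m) - (1 : ℝ) • LinearMap.id by simp,
    show τ₁.toFun (ϖ₁ m) + LinearMap.id = τ₁.toFun (ϖ₁ m) - (-1 : ℝ) • LinearMap.id by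
      simp] at hrank
  simp only [one_smul, neg_one_smul] at he₁ he₂ hf₁ hf₂
  exact ⟨_, _, e₁, e₂, f₁, f₂, he, hf,
    ⟨hrank, Eventually.of_forall fun y a => he₁ a y, Eventually.of_forall fun y a => hf₁ a y,
      heo₁, hfo₁⟩,
    ⟨hrank.trans (h.finrank_eq m), Eventually.of_forall fun y a => he₂ a y,
      Eventually.of_forall fun y a => hf₂ a y, heo₂, hfo₂⟩⟩

/-- The generalised scalar curvatures of T-dual data agree. -/
lemma GR_eq (h : IsTDualPair C₁ C₂ nat₁ nat₂) {S : Set (Sec B₁ F₁ V₁)}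
    (hS : IsSpanningRel B₂ F₂ nat₁ nat₂ S) (hτ : IsGenIsometry (TDualRel nat₁ nat₂) τ₁ τ₂)
    (hdv : IsRelatedDiv ϖ₁ ϖ₂ (TDualRel nat₁ nat₂) dv₁ dv₂) (m : M) :
    SmoothAt B₁ (GR τ₁ dv₁) (ϖ₁ m) ∧ SmoothAt B₂ (GR τ₂ dv₂) (ϖ₂ m) ∧
      GR τ₁ dv₁ (ϖ₁ m) = GR τ₂ dv₂ (ϖ₂ m) := by
  obtain ⟨p, q, e₁, e₂, f₁, f₂, he, hf, h₁, h₂⟩ := h.exists_related_orthoFrame hS hτ m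
  refine ⟨smoothAt_GR dv₁ h₁, smoothAt_GR dv₂ h₂, ?_⟩
  rw [GenGeom.GR_eq dv₁ h₁, GenGeom.GR_eq dv₂ h₂, h.scalarPart_eq hdv he hf, h.scalarPart_eq hdv hf he]

end IsTDualPair

end Curvature

/-! ### Transfer of the flow to the second quotient. -/

section Flow

variable {B : Type*} [NormedAddCommGroup B] [NormedSpace ℝ B] [FiniteDimensional ℝ B]
  {M : Type*} [TopologicalSpace M] [T2Space M] [ChartedSpace B M] [IsManifold 𝓘(ℝ, B) ∞ M]
  {F : Type*} [NormedAddCommGroup F] [NormedSpace ℝ F] [FiniteDimensional ℝ F]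
  {V : M → Type*} [TopologicalSpace (TotalSpace F V)]
  [∀ x, AddCommGroup (V x)] [∀ x, Module ℝ (V x)] [∀ x, TopologicalSpace (V x)]
  [FiberBundle F V] [VectorBundle ℝ F V] [ContMDiffVectorBundle ∞ F V 𝓘(ℝ, B)]
  {B₁ : Type*} [NormedAddCommGroup B₁] [NormedSpace ℝ B₁] [FiniteDimensional ℝ B₁]
  {Q₁ : Type*} [TopologicalSpace Q₁] [T2Space Q₁] [ChartedSpace B₁ Q₁] [IsManifold 𝓘(ℝ, B₁) ∞ Q₁]
  {F₁ : Type*} [NormedAddCommGroup F₁] [NormedSpace ℝ F₁] [FiniteDimensional ℝ F₁]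
  {V₁ : Q₁ → Type*} [TopologicalSpace (TotalSpace F₁ V₁)]
  [∀ x, AddCommGroup (V₁ x)] [∀ x, Module ℝ (V₁ x)] [∀ x, TopologicalSpace (V₁ x)]
  [FiberBundle F₁ V₁] [VectorBundle ℝ F₁ V₁] [ContMDiffVectorBundle ∞ F₁ V₁ 𝓘(ℝ, B₁)]
  {B₂ : Type*} [NormedAddCommGroup B₂] [NormedSpace ℝ B₂] [FiniteDimensional ℝ B₂]
  {Q₂ : Type*} [TopologicalSpace Q₂] [T2Space Q₂] [ChartedSpace B₂ Q₂] [IsManifold 𝓘(ℝ, B₂) ∞ Q₂]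
  {F₂ : Type*} [NormedAddCommGroup F₂] [NormedSpace ℝ F₂] [FiniteDimensional ℝ F₂]
  {V₂ : Q₂ → Type*} [TopologicalSpace (TotalSpace F₂ V₂)]
  [∀ x, AddCommGroup (V₂ x)] [∀ x, Module ℝ (V₂ x)] [∀ x, TopologicalSpace (V₂ x)]
  [FiberBundle F₂ V₂] [VectorBundle ℝ F₂ V₂] [ContMDiffVectorBundle ∞ F₂ V₂ 𝓘(ℝ, B₂)]
  {C : CourantAlgebroid B F V} {C₁ : CourantAlgebroid B₁ F₁ V₁} {C₂ : CourantAlgebroid B₂ F₂ V₂}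
  {K₁ K₂ : ∀ x, Submodule ℝ (V x)} {ϖ₁ : M → Q₁} {ϖ₂ : M → Q₂}
  {nat₁ : ∀ m, C.perp K₁ m →ₗ[ℝ] V₁ (ϖ₁ m)} {nat₂ : ∀ m, C.perp K₂ m →ₗ[ℝ] V₂ (ϖ₂ m)}
  {τ₁ : ℝ → GenMetric C₁} {τ₂ : ℝ → GenMetric C₂} {dv₁ : ℝ → Divergence C₁}
  {dv₂ : ℝ → Divergence C₂}

namespace IsTDualPair

/-- A family of functions on the second quotient is jointly smooth if it is related to a jointly
smooth family on the first one. -/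
lemma contMDiffOn_right (h : IsTDualPair C₁ C₂ nat₁ nat₂) {I : Set ℝ} {f₁ : ℝ × Q₁ → ℝ}
    {f₂ : ℝ × Q₂ → ℝ}
    (hf₁ : ContMDiffOn (𝓘(ℝ, ℝ).prod 𝓘(ℝ, B₁)) 𝓘(ℝ, ℝ) ∞ f₁ (I ×ˢ univ))
    (hf : ∀ t ∈ I, ∀ m, f₁ (t, ϖ₁ m) = f₂ (t, ϖ₂ m)) :
    ContMDiffOn (𝓘(ℝ, ℝ).prod 𝓘(ℝ, B₂)) 𝓘(ℝ, ℝ) ∞ f₂ (I ×ˢ univ) := by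
  rintro ⟨t, q⟩ ⟨ht, -⟩
  obtain ⟨m, rfl⟩ := h.red₂.surjective_proj q
  obtain ⟨s, h1, h2, h3⟩ := exists_local_section h.red₂.smooth_proj (h.red₂.submersion m)
  have hs : ContMDiffAt (𝓘(ℝ, ℝ).prod 𝓘(ℝ, B₂)) (𝓘(ℝ, ℝ).prod 𝓘(ℝ, B₁)) ∞
      (fun p : ℝ × Q₂ => (p.1, ϖ₁ (s p.2))) (t, ϖ₂ m) :=
    -- With a local section s of ϖ₂, the second family is f₁(t, ϖ₁(s(q))) near the point, and s does
    -- not depend on time.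
    contMDiffAt_fst.prodMk ((h.red₁.smooth_proj _).comp (t, ϖ₂ m)
      (ContMDiffAt.comp (t, ϖ₂ m) h1 contMDiffAt_snd))
  have hmaps : MapsTo (fun p : ℝ × Q₂ => (p.1, ϖ₁ (s p.2))) (I ×ˢ univ) (I ×ˢ univ) :=
    fun p hp => mk_mem_prod hp.1 (mem_univ _)
  have hcomp := ContMDiffWithinAt.comp (t, ϖ₂ m)
    (hf₁ (t, ϖ₁ (s (ϖ₂ m))) (mk_mem_prod ht (mem_univ _))) hs.contMDiffWithinAt hmaps
  have hsnd : Tendsto Prod.snd (𝓝[I ×ˢ univ] (t, ϖ₂ m)) (𝓝 (ϖ₂ m)) :=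
    continuous_snd.continuousAt.mono_left nhdsWithin_le_nhds
  refine hcomp.congr_of_eventuallyEq ?_ ?_
  · filter_upwards [self_mem_nhdsWithin, hsnd.eventually h3] with p hp hp'
    have := hf p.1 hp.1 (s p.2)
    rw [hp'] at this
    exact this.symm
  · have := hf t ht (s (ϖ₂ m))
    rw [h2] at this
    simp only [Function.comp, h2, this]

/-- T-dual families of solutions of the generalised Ricci flow. -/
lemma isGenRicciFlow_right (h : IsTDualPair C₁ C₂ nat₁ nat₂) {S : Set (Sec B₁ F₁ V₁)}
    (hS : IsSpanningRel B₂ F₂ nat₁ nat₂ S) {κ T : ℝ} (hflow : IsGenRicciFlow κ T τ₁ dv₁)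
    (hτ : ∀ t ∈ Ico 0 T, IsGenIsometry (TDualRel nat₁ nat₂) (τ₁ t) (τ₂ t))
    (hdv : ∀ t ∈ Ico 0 T, IsRelatedDiv ϖ₁ ϖ₂ (TDualRel nat₁ nat₂) (dv₁ t) (dv₂ t)) :
    IsGenRicciFlow κ T τ₂ dv₂ := by
  have hmetric : ∀ t ∈ Ico 0 T, ∀ {v₁ w₁ : Sec B₁ F₁ V₁} {v₂ w₂ : Sec B₂ F₂ V₂},
      RelSec nat₁ nat₂ v₁ v₂ → RelSec nat₁ nat₂ w₁ w₂ → ∀ m,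
      C₁.pairing (ϖ₁ m) ((τ₁ t).toFun (ϖ₁ m) (v₁ (ϖ₁ m))) (w₁ (ϖ₁ m)) =
        C₂.pairing (ϖ₂ m) ((τ₂ t).toFun (ϖ₂ m) (v₂ (ϖ₂ m))) (w₂ (ϖ₂ m)) :=
    fun t ht v₁ w₁ v₂ w₂ hv hw m => h.pairing_eq (hv.map h (hτ t ht) m) (hw m)
  refine ⟨fun s s' => ?_, fun s => ?_, fun t ht v w hv hw x => ?_, fun t ht e x => ?_⟩
  · rintro ⟨t, q⟩ ⟨ht, -⟩
    obtain ⟨m, rfl⟩ := h.red₂.surjective_proj q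
    obtain ⟨b₁, b₂, -, hb, -, hli⟩ := h.exists_frame hS m
    obtain ⟨f, hf⟩ := exists_coeff b₂ hli (by simp [h.finrank_eq m]) s
    obtain ⟨f', hf'⟩ := exists_coeff b₂ hli (by simp [h.finrank_eq m]) s'
    have hij : ∀ i j, ContMDiffWithinAt (𝓘(ℝ, ℝ).prod 𝓘(ℝ, B₂)) 𝓘(ℝ, ℝ) ∞
        (fun p : ℝ × Q₂ => C₂.pairing p.2 ((τ₂ p.1).toFun p.2 (b₂ i p.2)) (b₂ j p.2))
        (Ico 0 T ×ˢ univ) (t, ϖ₂ m) := fun i j =>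
      h.contMDiffOn_right (hflow.smooth_metric (b₁ i) (b₁ j))
        (fun r hr y => hmetric r hr (hb i) (hb j) y) (t, ϖ₂ m) (mk_mem_prod ht (mem_univ _))
    have hfs : ∀ g : SmoothFun B₂ Q₂, ContMDiffWithinAt (𝓘(ℝ, ℝ).prod 𝓘(ℝ, B₂)) 𝓘(ℝ, ℝ) ∞
        (fun p : ℝ × Q₂ => g p.2) (Ico 0 T ×ˢ univ) (t, ϖ₂ m) := fun g =>
      (g.contMDiff.comp contMDiff_snd).contMDiffAt.contMDiffWithinAt
    have hsum : ContMDiffWithinAt (𝓘(ℝ, ℝ).prod 𝓘(ℝ, B₂)) 𝓘(ℝ, ℝ) ∞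
        (fun p : ℝ × Q₂ => ∑ i, ∑ j, f i p.2 • f' j p.2 •
          C₂.pairing p.2 ((τ₂ p.1).toFun p.2 (b₂ i p.2)) (b₂ j p.2))
        (Ico 0 T ×ˢ univ) (t, ϖ₂ m) :=
      contMDiffWithinAt_finsetSum fun i _ => contMDiffWithinAt_finsetSum fun j _ =>
        (hfs (f i)).smul ((hfs (f' j)).smul (hij i j))
    have hsnd : Tendsto Prod.snd (𝓝 ((t, ϖ₂ m) : ℝ × Q₂)) (𝓝 (ϖ₂ m)) :=
      continuous_snd.continuousAt
    have hev : ∀ᶠ p in 𝓝 ((t, ϖ₂ m) : ℝ × Q₂),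
        C₂.pairing p.2 ((τ₂ p.1).toFun p.2 (s p.2)) (s' p.2) = ∑ i, ∑ j, f i p.2 • f' j p.2 •
          C₂.pairing p.2 ((τ₂ p.1).toFun p.2 (b₂ i p.2)) (b₂ j p.2) := by
      filter_upwards [hsnd.eventually hf, hsnd.eventually hf'] with p h1 h2
      rw [h1, h2]
      simp only [map_sum, map_smul, LinearMap.sum_apply, LinearMap.smul_apply]
      rw [Finset.sum_comm]
      refine Finset.sum_congr rfl fun i _ => ?_
      rw [Finset.smul_sum]
      exact Finset.sum_congr rfl fun j _ => smul_comm _ _ _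
    exact hsum.congr_of_eventuallyEq (hev.filter_mono nhdsWithin_le_nhds) hev.self_of_nhds
  · rintro ⟨t, q⟩ ⟨ht, -⟩
    obtain ⟨m, rfl⟩ := h.red₂.surjective_proj q
    obtain ⟨b₁, b₂, -, hb, -, hli⟩ := h.exists_frame hS m
    obtain ⟨f, hf⟩ := exists_coeff b₂ hli (by simp [h.finrank_eq m]) s
    have hi : ∀ i, ContMDiffWithinAt (𝓘(ℝ, ℝ).prod 𝓘(ℝ, B₂)) 𝓘(ℝ, ℝ) ∞
        (fun p : ℝ × Q₂ => (dv₂ p.1).toFun (b₂ i) p.2) (Ico 0 T ×ˢ univ) (t, ϖ₂ m) := fun i =>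
      h.contMDiffOn_right (hflow.smooth_div (b₁ i)) (fun r hr y => hdv r hr _ _ (hb i) y)
        (t, ϖ₂ m) (mk_mem_prod ht (mem_univ _))
    have hfs : ∀ g : SmoothFun B₂ Q₂, ContMDiffWithinAt (𝓘(ℝ, ℝ).prod 𝓘(ℝ, B₂)) 𝓘(ℝ, ℝ) ∞
        (fun p : ℝ × Q₂ => g p.2) (Ico 0 T ×ˢ univ) (t, ϖ₂ m) := fun g =>
      (g.contMDiff.comp contMDiff_snd).contMDiffAt.contMDiffWithinAt
    have hsum : ContMDiffWithinAt (𝓘(ℝ, ℝ).prod 𝓘(ℝ, B₂)) 𝓘(ℝ, ℝ) ∞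
        (fun p : ℝ × Q₂ => ∑ i, (f i p.2 • (dv₂ p.1).toFun (b₂ i) p.2 +
          C₂.lieFun (b₂ i) (f i) p.2)) (Ico 0 T ×ˢ univ) (t, ϖ₂ m) :=
      contMDiffWithinAt_finsetSum fun i _ => ((hfs (f i)).smul (hi i)).add (hfs _)
    have hsnd : Tendsto Prod.snd (𝓝 ((t, ϖ₂ m) : ℝ × Q₂)) (𝓝 (ϖ₂ m)) :=
      continuous_snd.continuousAt
    have hev : ∀ᶠ p in 𝓝 ((t, ϖ₂ m) : ℝ × Q₂), (dv₂ p.1).toFun s p.2 =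
        ∑ i, (f i p.2 • (dv₂ p.1).toFun (b₂ i) p.2 + C₂.lieFun (b₂ i) (f i) p.2) := by
      filter_upwards [hsnd.eventually hf.eventually_nhds] with p h1
      exact (dv₂ p.1).apply_of_eq_sum h1
    exact hsum.congr_of_eventuallyEq (hev.filter_mono nhdsWithin_le_nhds) hev.self_of_nhds
  · obtain ⟨m, rfl⟩ := h.red₂.surjective_proj x
    obtain ⟨a, ha⟩ := h.symm.exists_right m (v (ϖ₂ m))
    obtain ⟨c, hc⟩ := h.symm.exists_right m (w (ϖ₂ m))
    -- The given sections need not have partners. They are replaced by the V^± parts of related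
    -- sections with the same values at the point: the time derivative is taken at a fixed point,
    -- and the Ricci term is a tensor.
    obtain ⟨v₁, v₂, hv12, hva⟩ := h.exists_relSec_apply_eq hS a
    obtain ⟨w₁, w₂, hw12, hwc⟩ := h.exists_relSec_apply_eq hS c
    have hv2 : v₂ (ϖ₂ m) = v (ϖ₂ m) := h.unique_right (hv12 m) (hva ▸ ha.symm)
    have hw2 : w₂ (ϖ₂ m) = w (ϖ₂ m) := h.unique_right (hw12 m) (hwc ▸ hc.symm)
    have hvp := hv12.plus h (hτ t ht)
    have hwm := hw12.minus h (hτ t ht)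
    have hv2' : (τ₂ t).plus v₂ (ϖ₂ m) = v (ϖ₂ m) := by
      rw [(τ₂ t).plus_apply, hv2, hv]; module
    have hw2' : (τ₂ t).minus w₂ (ϖ₂ m) = w (ϖ₂ m) := by
      rw [(τ₂ t).minus_apply, hw2, hw]; module
    have h1 := hflow.metric_eq t ht _ _ ((τ₁ t).memPlus_plus v₁) ((τ₁ t).memMinus_minus w₁) (ϖ₁ m)
    rw [h.GRic_eq hS (hτ t ht) (hdv t ht) hvp hwm ((τ₁ t).memPlus_plus v₁)
      ((τ₁ t).memMinus_minus w₁) m, GRic_congr (τ₂ t) (dv₂ t) ((τ₂ t).memPlus_plus v₂) hv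
      ((τ₂ t).memMinus_minus w₂) hw hv2' hw2'] at h1
    refine h1.congr_of_mem (fun r hr => ?_) ht
    rw [hmetric r hr hvp hwm m, hv2', hw2']
  · obtain ⟨m, rfl⟩ := h.red₂.surjective_proj x
    obtain ⟨b₁, b₂, -, hb, -, hli⟩ := h.exists_frame hS m
    obtain ⟨f, hf⟩ := exists_coeff b₂ hli (by simp [h.finrank_eq m]) e
    obtain ⟨hs₁, hs₂, -⟩ := h.GR_eq hS (hτ t ht) (hdv t ht) m
    have h1 : ∀ i, HasDerivWithinAt (fun r => (dv₂ r).toFun (b₂ i) (ϖ₂ m))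
        (-dirDeriv B₂ (GR (τ₂ t) (dv₂ t)) (ϖ₂ m) (C₂.anchor (ϖ₂ m) (b₂ i (ϖ₂ m)))) (Ico 0 T) t := by
      intro i
      have h2 := hflow.div_eq t ht (b₁ i) (ϖ₁ m)
      rw [h.dirDeriv_eq (hb i m) hs₁ hs₂ (Eventually.of_forall fun y =>
        (h.GR_eq hS (hτ t ht) (hdv t ht) y).2.2)] at h2
      exact h2.congr_of_mem (fun r hr => (hdv r hr _ _ (hb i) m).symm) ht
    -- Only the divergences of the frame depend on time; the derivatives of the coefficients in the
    -- Leibniz formula are constant in `r`.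
    have h3 : HasDerivWithinAt (fun r => ∑ i, (f i (ϖ₂ m) * (dv₂ r).toFun (b₂ i) (ϖ₂ m) +
        dirDeriv B₂ (f i) (ϖ₂ m) (C₂.anchor (ϖ₂ m) (b₂ i (ϖ₂ m)))))
        (∑ i, f i (ϖ₂ m) *
          -dirDeriv B₂ (GR (τ₂ t) (dv₂ t)) (ϖ₂ m) (C₂.anchor (ϖ₂ m) (b₂ i (ϖ₂ m)))) (Ico 0 T) t :=
      HasDerivWithinAt.fun_sum fun i _ => ((h1 i).const_mul _).add_const _
    have h4 : ∑ i, f i (ϖ₂ m) *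
          -dirDeriv B₂ (GR (τ₂ t) (dv₂ t)) (ϖ₂ m) (C₂.anchor (ϖ₂ m) (b₂ i (ϖ₂ m))) =
        -dirDeriv B₂ (GR (τ₂ t) (dv₂ t)) (ϖ₂ m) (C₂.anchor (ϖ₂ m) (e (ϖ₂ m))) := by
      rw [hf.self_of_nhds, map_sum, dirDeriv_sum_vec]
      simp only [map_smul, dirDeriv_smul_vec, mul_neg, Finset.sum_neg_distrib]
    rw [h4] at h3
    exact h3.congr_of_mem (fun r _ => (dv₂ r).apply_of_eq_sum hf) ht

end IsTDualPair

end Flow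

end GenGeom

end

/-! ### Assembly of the theorem. -/

theorem theorem4
    -- the exact Courant algebroid over `M`
    {B : Type*} [NormedAddCommGroup B] [NormedSpace ℝ B] [FiniteDimensional ℝ B]
    {M : Type*} [TopologicalSpace M] [T2Space M] [SecondCountableTopology M]
    [ChartedSpace B M] [IsManifold 𝓘(ℝ, B) ∞ M]
    {F : Type*} [NormedAddCommGroup F] [NormedSpace ℝ F] [FiniteDimensional ℝ F]
    {V : M → Type*} [TopologicalSpace (TotalSpace F V)]
    [∀ x, AddCommGroup (V x)] [∀ x, Module ℝ (V x)] [∀ x, TopologicalSpace (V x)]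
    [FiberBundle F V] [VectorBundle ℝ F V] [ContMDiffVectorBundle ∞ F V 𝓘(ℝ, B)]
    (C : CourantAlgebroid B F V) (hC : C.IsExact)
    -- the first reduced Courant algebroid, over `Q₁`
    {B₁ : Type*} [NormedAddCommGroup B₁] [NormedSpace ℝ B₁] [FiniteDimensional ℝ B₁]
    {Q₁ : Type*} [TopologicalSpace Q₁] [T2Space Q₁] [SecondCountableTopology Q₁]
    [ChartedSpace B₁ Q₁] [IsManifold 𝓘(ℝ, B₁) ∞ Q₁]
    {F₁ : Type*} [NormedAddCommGroup F₁] [NormedSpace ℝ F₁] [FiniteDimensional ℝ F₁]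
    {V₁ : Q₁ → Type*} [TopologicalSpace (TotalSpace F₁ V₁)]
    [∀ x, AddCommGroup (V₁ x)] [∀ x, Module ℝ (V₁ x)] [∀ x, TopologicalSpace (V₁ x)]
    [FiberBundle F₁ V₁] [VectorBundle ℝ F₁ V₁] [ContMDiffVectorBundle ∞ F₁ V₁ 𝓘(ℝ, B₁)]
    (C₁ : CourantAlgebroid B₁ F₁ V₁)
    (K₁ : ∀ m, Submodule ℝ (V m)) (ϖ₁ : M → Q₁) (nat₁ : ∀ m, C.perp K₁ m →ₗ[ℝ] V₁ (ϖ₁ m))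
    (hred₁ : IsReduction C K₁ ϖ₁ C₁ nat₁)
    -- the second reduced Courant algebroid, over `Q₂`
    {B₂ : Type*} [NormedAddCommGroup B₂] [NormedSpace ℝ B₂] [FiniteDimensional ℝ B₂]
    {Q₂ : Type*} [TopologicalSpace Q₂] [T2Space Q₂] [SecondCountableTopology Q₂]
    [ChartedSpace B₂ Q₂] [IsManifold 𝓘(ℝ, B₂) ∞ Q₂]
    {F₂ : Type*} [NormedAddCommGroup F₂] [NormedSpace ℝ F₂] [FiniteDimensional ℝ F₂]
    {V₂ : Q₂ → Type*} [TopologicalSpace (TotalSpace F₂ V₂)]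
    [∀ x, AddCommGroup (V₂ x)] [∀ x, Module ℝ (V₂ x)] [∀ x, TopologicalSpace (V₂ x)]
    [FiberBundle F₂ V₂] [VectorBundle ℝ F₂ V₂] [ContMDiffVectorBundle ∞ F₂ V₂ 𝓘(ℝ, B₂)]
    (C₂ : CourantAlgebroid B₂ F₂ V₂)
    (K₂ : ∀ m, Submodule ℝ (V m)) (ϖ₂ : M → Q₂) (nat₂ : ∀ m, C.perp K₂ m →ₗ[ℝ] V₂ (ϖ₂ m))
    (hred₂ : IsReduction C K₂ ϖ₂ C₂ nat₂)
    -- the T-duality setting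
    (hrank : ∀ m, Module.finrank ℝ (K₁ m) = Module.finrank ℝ (K₂ m))
    (hleaves : ∃ d : ℕ, ∀ m,
      Module.finrank ℝ (C.anchorImage K₁ m ⊓ C.anchorImage K₂ m : Submodule ℝ (TSp B m)) = d)
    (hlinear : ∀ (q₁ : Q₁) (q₂ : Q₂) (a a' : V₁ q₁) (b b' : V₂ q₂),
      TDualRel nat₁ nat₂ q₁ q₂ a b → TDualRel nat₁ nat₂ q₁ q₂ a' b' →
        TDualRel nat₁ nat₂ q₁ q₂ (a + a') (b + b'))
    (hbisub : ∀ Y Z : ∀ m : M, TSp B m, SmoothVFOn B Y univ → SmoothVFOn B Z univ →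
      (∀ m, dMap B B₁ ϖ₁ m (Y m) = 0) → (∀ m, dMap B B₂ ϖ₂ m (Z m) = 0) →
      ∀ m, VectorField.mlieBracket 𝓘(ℝ, B) Y Z m ∈
        LinearMap.ker (dMap B B₁ ϖ₁ m) ⊔ LinearMap.ker (dMap B B₂ ϖ₂ m))
    (hK : ∀ m, K₁ m ⊓ K₂ m = ⊥)
    (hKperp : ∀ m, C.perp K₂ m ⊓ K₁ m ≤ K₂ m)
    -- the distribution of T-duality directions and its local generators
    (D₁ : ∀ q : Q₁, Submodule ℝ (TSp B₁ q))
    (hD₁ : ∀ m, D₁ (ϖ₁ m) = (C.anchorImage K₂ m).map (dMap B B₁ ϖ₁ m))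
    {ι : Type*} (U : ι → Set Q₁) (hU : ∀ i, IsOpen (U i)) (hcover : ⋃ i, U i = univ)
    {r : ι → ℕ} (X : ∀ i, Fin (r i) → ∀ q : Q₁, TSp B₁ q)
    (hXsmooth : ∀ i k, SmoothVFOn B₁ (X i k) (U i))
    (hXspan : ∀ i, ∀ q ∈ U i, Submodule.span ℝ (range fun k => X i k q) = D₁ q)
    -- locally compatible adapted splittings
    (σ₁ σ₂ : Splitting C) (hσ₁ : IsAdapted B₁ σ₁ K₁ ϖ₁) (hσ₂ : IsAdapted B₂ σ₂ K₂ ϖ₂)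
    (hcompat : IsLocCompatible B₁ σ₁ σ₂ K₂ ϖ₁ U X)
    (σred : Splitting C₁) (hσred : IsInducedSplitting nat₁ σ₁ σred)
    -- locally invariant sections span the first reduced Courant algebroid
    (hspan : ∀ q, Submodule.span ℝ {a : V₁ q | ∃ e, IsLocInvSec σred U X e ∧ e q = a} = ⊤)
    -- the locally invariant solution of the generalised Ricci flow
    (κ T : ℝ) (hT : 0 < T) (τ₁ : ℝ → GenMetric C₁) (dv₁ : ℝ → Divergence C₁)
    (hflow : IsGenRicciFlow κ T τ₁ dv₁)
    (hτ₁ : ∀ t ∈ Ico 0 T, IsLocInvMetric σred U X (τ₁ t))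
    (hdv₁ : ∀ t ∈ Ico 0 T, IsLocCompatDiv σred U X (dv₁ t)) :
    ∃ (τ₂ : ℝ → GenMetric C₂) (dv₂ : ℝ → Divergence C₂),
      (∀ t ∈ Ico 0 T, IsGenIsometry (TDualRel nat₁ nat₂) (τ₁ t) (τ₂ t) ∧
        IsRelatedDiv ϖ₁ ϖ₂ (TDualRel nat₁ nat₂) (dv₁ t) (dv₂ t)) ∧
      IsGenRicciFlow κ T τ₂ dv₂ ∧
      ∀ (τ₂' : ℝ → GenMetric C₂) (dv₂' : ℝ → Divergence C₂),
        (∀ t ∈ Ico 0 T, IsGenIsometry (TDualRel nat₁ nat₂) (τ₁ t) (τ₂' t) ∧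
          IsRelatedDiv ϖ₁ ϖ₂ (TDualRel nat₁ nat₂) (dv₁ t) (dv₂' t)) →
        ∀ t ∈ Ico 0 T, τ₂' t = τ₂ t ∧ dv₂' t = dv₂ t := by
  obtain ⟨d, hd⟩ := hleaves
  have h : IsTDualPair C₁ C₂ nat₁ nat₂ :=
    .of_transversal hred₁ hred₂ hrank hlinear hK hKperp
  -- The locally invariant sections are the spanning related class to which all the transfer results
  -- are applied.
  have hS : IsSpanningRel B₂ F₂ nat₁ nat₂ {e | IsLocInvSec σred U X e} :=
    ⟨fun q a => by
      have := hspan q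
      rw [Submodule.eq_top_iff'] at this
      exact this a, fun e he => h.exists_relSec hC hd hD₁ hU hcover hXsmooth hXspan hσ₁ hσ₂
        hcompat hσred he⟩
  have hmetric : ∀ t ∈ Ico 0 T, ∃ τ₂ : GenMetric C₂,
      IsGenIsometry (TDualRel nat₁ nat₂) (τ₁ t) τ₂ := fun t ht =>
    h.exists_dual_metric hS (τ₁ t) fun e he => IsLocInvSec.map_metric (hτ₁ t ht) he
  have hdiv : ∀ t ∈ Ico 0 T, ∃ dv₂ : Divergence C₂,
      IsRelatedDiv ϖ₁ ϖ₂ (TDualRel nat₁ nat₂) (dv₁ t) dv₂ := fun t ht =>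
    h.exists_dual_div hS (dv₁ t) fun e he => h.exists_related_fun hD₁ hcover hXspan
      fun i k q hq => (hdv₁ t ht).dirDeriv_eq_zero hU hXsmooth he k hq
  -- The families are functions on all of ℝ, so values outside [0, T) need an arbitrary metric and
  -- divergence. Those at time 0, which is available because T > 0, show that both types are
  -- nonempty.
  obtain ⟨τ', -⟩ := hmetric 0 ⟨le_rfl, hT⟩
  obtain ⟨dv', -⟩ := hdiv 0 ⟨le_rfl, hT⟩
  have : Nonempty (GenMetric C₂) := ⟨τ'⟩
  have : Nonempty (Divergence C₂) := ⟨dv'⟩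
  choose! τ₂ hτ₂ using hmetric
  choose! dv₂ hdv₂ using hdiv
  exact ⟨τ₂, dv₂, fun t ht => ⟨hτ₂ t ht, hdv₂ t ht⟩, h.isGenRicciFlow_right hS hflow hτ₂ hdv₂,
    fun τ₂' dv₂' h' t ht => ⟨h.dual_metric_unique (hτ₂ t ht) (h' t ht).1,
      h.dual_div_unique hS (hdv₂ t ht) (h' t ht).2⟩⟩
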